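/- Let $R$ be a commutative ring. **Conventions.** An $r$-bigraded complex is a family of $R$-modules $A^{p,n}$ ($p,n\in\mathbb Z$) with differentials $d_r\colon A^{p,n}\to A^{p-r,n+1-r}$, $d_r^2=0$; $H(A)$ denotes its homology. An *extended spectral sequence* $X$ consists of $r$-bigraded complexes $(X_r,d_r)$, $r\ge 0$, and bigraded $R$-linear maps $\varphi_{r+1}\colon X_{r+1}\to H(X_r)$ (the characteristic maps); morphisms are families of morphisms of $r$-bigraded complexes compatible with the $\varphi_r$. It is a *spectral sequence* if all $\varphi_r$ are isomorphisms. A *filtered complex* $C$ is a cochain complex of $R$-modules with an increasing $\mathbb Z$-indexed filtration by subcomplexes $F_pC$; morphisms are filtration-preserving chain maps. Its spectral sequence $E(C)$ is $E(C)_r^{p,n}=Z_r^{p,n}/B_r^{p,n}$ with, for $m=n-p$, $Z_r^{p,n}=F_pC^m\cap d^{-1}(F_{p-r}C^{m+1})$, $B_0^{p,n}=F_{p-1}C^m$, $B_{r+1}^{p,n}=Z_r^{p-1,n-1}+dZ_r^{p+r,n+r-1}$, differential $[a]_r\mapsto[da]_r$ and $\varphi_{r+1}[a]_{r+1}=[[a]_r]$.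 Deligne's $\operatorname{Dec}^*(C)$ is the complex $C$ with the filtration $$(\operatorname{Dec}^*F)_pC^m=F_{p-m}C^m+d\,(F_{p-m+1}C^{m-1}).$$ **The functor $\operatorname{LDec}$ on extended spectral sequences.** A linear witness book $L$ consists of $r$-bigraded complexes $(L_r,d_r)$, $r\ge0$, with linear maps $w_{r+1}\colon L_{r+1}\to L_r$ of bidegree $(0,0)$ and $s_r\colon L_r\to L_{r+1}$ of bidegree $(1,1)$ such that $w_{r+1}s_r=0$, $s_rw_{r+1}=0$, $w_{r+1}d_{r+1}s_r=d_r$; in a truncated one only the pages $r\ge1$ are present. A sequence $(x_0,\dots,x_r)$ with $x_i\in X_i^{p,n}$ is compatible if $d_ix_i=0$ and $\varphi_{i+1}(x_{i+1})=[x_i]$ for $0\le i<r$. The nerve $\mathcal N(X)$ has $\mathcal N(X)_r^{p,n}$ equal to the module of pairs $(x;y)$ of compatible sequences of length $r+1$, in bidegrees $(p,n)$ and $(p-r,n+1-r)$, with $d_rx_r=y_r$; its structure maps are $d_r(x;y)=(y;0)$, $w_r(x;y)=((x_0,\dots,x_{r-1});0)$, $s_r(x;y)=(0;(y_0,\dots,y_r,0))$.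 For a linear witness book $L$, the truncated linear witness book $\mathcal W_!(L)$ has, for $i\ge1$, $$\mathcal W_!(L)_i^{p,n}=\bigl(L_0^{p+1-i,n+1-i}\oplus L_0^{p+1,n}\oplus L_i^{p,n}\bigr)/\sim,$$ where $(0,0,s^{i-1}x)\sim(w x,0,0)$ and $(0,0,d_is^{i-1}x)\sim(0,w x,0)$ for $x\in L_1$, with $d_i(a,b,c)=(0,a,d_ic)$, $w_{i+1}(a,b,c)=(0,b,w_{i+1}c)$, $s_i(a,b,c)=(a,0,s_ic)$. For a truncated linear witness book $M$, $\mathcal Q_{\ge1}(M)_1=M_1$ and $\mathcal Q_{\ge1}(M)_i=M_i/(s_{i-1}M_{i-1}+d_is_{i-1}M_{i-1})$ for $i>1$, with characteristic maps $\bar a\mapsto[\overline{w a}]$. Finally $(\mathcal T^{-1}Y)_r^{p,n}=Y_{r+1}^{2p-n,p}$. Then $$\operatorname{LDec}=\mathcal T^{-1}\circ\mathcal Q_{\ge1}\circ\mathcal W_!\circ\mathcal N .$$ In $\operatorname{LDec}(X)_0^{p,n}$ let $\overline{(a,b)}$ denote the class of $(a,b,0)$, for $a\in X_0^{2p-n,p}$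 and $b\in X_0^{2p-n+1,p}$ (identifying $\mathcal N(X)_0$ with $X_0$ by $x\mapsto(x;d_0x)$), and in $\operatorname{LDec}(X)_j^{p,n}$ let $\overline c$ denote the class of $(0,0,c)$, for $c\in\mathcal N(X)_{j+1}^{2p-n,p}$. **Proposition.** For every filtered complex $C$, the extended spectral sequence $\operatorname{LDec}(E(C))$ is a spectral sequence, and there is an isomorphism of spectral sequences $$\eta_C\colon E(\operatorname{Dec}^*(C))\longrightarrow\operatorname{LDec}(E(C)),$$ natural in $C$, whose inverse is given as follows, where $m=n-p$. * On the $0$-page it is the map $\operatorname{LDec}(E(C))_0^{p,n}\to E(\operatorname{Dec}^*(C))_0^{p,n}$, $$\overline{([a]_0,[b]_0)}\mapsto[a+db]_0\qquad(a\in F_{p-m}C^m,\ b\in F_{p-m+1}C^{m-1}).$$ * On every page $j\ge0$ it extends Deligne's canonical map $E(C)_{j+1}^{2p-n,p}\to E(\operatorname{Dec}^*(C))_j^{p,n}$, $[a]_{j+1}\mapsto[a]_j$: for $a\in F_{p-m}C^m$ with $da\in F_{p-m-j-1}C^{m+1}$ and every $c=(x;y)\in\mathcal N(E(C))_{j+1}^{2p-n,p}$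 with $x_{j+1}=[a]_{j+1}$, it sends $\overline c$ to $[a]_j$. -/

import Mathlib

open CategoryTheory

universe u v

/-! ### `r`-bigraded complexes -/

/-- An `r`-bigraded complex: bigraded modules `X p n` with a square-zero differential of
bidegree `(-r, 1 - r)`.  The differential out of `(p, n)` is recorded for every bidegree `(p', n')`
equal to `(p - r, n + 1 - r)`. -/
structure BigradedComplex (R : Type u) [CommRing R] (r : ℕ) where
  X : ℤ → ℤ → Type v
  [addCommGroup : ∀ p n, AddCommGroup (X p n)]
  [module : ∀ p n, Module R (X p n)]
  d : ∀ (p n p' n' : ℤ), p' = p - r → n' = n + 1 - r → (X p n →ₗ[R] X p' n')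
  d_comp_d : ∀ (p n p' n' p'' n'' : ℤ) (hp : p' = p - r) (hn : n' = n + 1 - r)
    (hp' : p'' = p' - r) (hn' : n'' = n' + 1 - r) (x : X p n),
    d p' n' p'' n'' hp' hn' (d p n p' n' hp hn x) = 0

attribute [instance] BigradedComplex.addCommGroup BigradedComplex.module

namespace BigradedComplex

variable {R : Type u} [CommRing R] {r : ℕ}

/-- The identity map `X p n → X p' n'` along equalities of the indices. -/
def cast (A : BigradedComplex.{u, v} R r) {p n p' n' : ℤ} (hp : p = p') (hn : n = n') :
    A.X p n →ₗ[R] A.X p' n' := by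
  subst hp hn
  exact LinearMap.id

@[simp] theorem cast_rfl (A : BigradedComplex.{u, v} R r) {p n : ℤ} (hp : p = p) (hn : n = n)
    (x : A.X p n) : A.cast hp hn x = x := rfl

@[simp] theorem cast_cast (A : BigradedComplex.{u, v} R r) {p n p₁ n₁ p' n' : ℤ}
    (h₁ : p = p₁) (h₂ : n = n₁) (h₃ : p₁ = p') (h₄ : n₁ = n') (x : A.X p n) :
    A.cast h₃ h₄ (A.cast h₁ h₂ x) = A.cast (h₁.trans h₃) (h₂.trans h₄) x := by
  subst h₁ h₂ h₃ h₄
  rfl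

@[simp] theorem d_cast (A : BigradedComplex.{u, v} R r) {p n p₁ n₁ p' n' : ℤ}
    (h₁ : p = p₁) (h₂ : n = n₁) (hp : p' = p₁ - r) (hn : n' = n₁ + 1 - r) (x : A.X p n) :
    A.d p₁ n₁ p' n' hp hn (A.cast h₁ h₂ x) =
      A.d p n p' n' (by rw [h₁, hp]) (by rw [h₂, hn]) x := by
  subst h₁ h₂
  rfl

theorem cast_d (A : BigradedComplex.{u, v} R r) {p n p₁ n₁ p' n' : ℤ}
    (h₁ : p₁ = p') (h₂ : n₁ = n') (hp : p₁ = p - r) (hn : n₁ = n + 1 - r) (x : A.X p n) :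
    A.cast h₁ h₂ (A.d p n p₁ n₁ hp hn x) =
      A.d p n p' n' (by rw [← h₁, hp]) (by rw [← h₂, hn]) x := by
  subst h₁ h₂
  rfl

/-- The cycles `Ker d` in bidegree `(p, n)`. -/
def cycles (A : BigradedComplex.{u, v} R r) (p n : ℤ) : Submodule R (A.X p n) :=
  LinearMap.ker (A.d p n (p - r) (n + 1 - r) rfl rfl)

/-- The boundaries `Im d` in bidegree `(p, n)`. -/
def boundaries (A : BigradedComplex.{u, v} R r) (p n : ℤ) : Submodule R (A.X p n) :=
  LinearMap.range (A.d (p + r) (n - 1 + r) p n (by omega) (by omega))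

theorem mem_cycles_iff (A : BigradedComplex.{u, v} R r) {p n : ℤ} (p' n' : ℤ)
    (hp : p' = p - r) (hn : n' = n + 1 - r) (x : A.X p n) :
    x ∈ A.cycles p n ↔ A.d p n p' n' hp hn x = 0 := by
  subst hp hn
  exact LinearMap.mem_ker

theorem mem_boundaries_iff (A : BigradedComplex.{u, v} R r) (p₀ n₀ : ℤ) {p n : ℤ}
    (hp : p = p₀ - r) (hn : n = n₀ + 1 - r) (x : A.X p n) :
    x ∈ A.boundaries p n ↔ ∃ y, A.d p₀ n₀ p n hp hn y = x := by
  obtain rfl : p₀ = p + r := by omega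
  obtain rfl : n₀ = n - 1 + r := by omega
  exact LinearMap.mem_range

/-- The homology `Ker d / Im d` in bidegree `(p, n)`. -/
abbrev H (A : BigradedComplex.{u, v} R r) (p n : ℤ) : Type v :=
  A.cycles p n ⧸ (A.boundaries p n).submoduleOf (A.cycles p n)

/-- The homology class of a cycle. -/
def cls (A : BigradedComplex.{u, v} R r) (p n : ℤ) : A.cycles p n →ₗ[R] A.H p n :=
  ((A.boundaries p n).submoduleOf (A.cycles p n)).mkQ

theorem cls_surjective (A : BigradedComplex.{u, v} R r) (p n : ℤ) :
    Function.Surjective (A.cls p n) :=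
  Submodule.mkQ_surjective _

theorem cls_eq_zero_iff (A : BigradedComplex.{u, v} R r) {p n : ℤ} (x : A.cycles p n) :
    A.cls p n x = 0 ↔ (x : A.X p n) ∈ A.boundaries p n := by
  unfold cls
  rw [Submodule.mkQ_apply, Submodule.Quotient.mk_eq_zero]
  rfl

/-- The map in homology induced by a linear map preserving cycles and boundaries. -/
def mapH {r' : ℕ} {A : BigradedComplex.{u, v} R r} {B : BigradedComplex.{u, v} R r'}
    {p n p' n' : ℤ} (f : A.X p n →ₗ[R] B.X p' n')
    (hc : ∀ x ∈ A.cycles p n, f x ∈ B.cycles p' n')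
    (hb : ∀ x ∈ A.boundaries p n, f x ∈ B.boundaries p' n') : A.H p n →ₗ[R] B.H p' n' :=
  Submodule.mapQ _ _ (f.restrict hc) (fun x hx => hb x.1 hx)

@[simp] theorem mapH_cls {r' : ℕ} {A : BigradedComplex.{u, v} R r}
    {B : BigradedComplex.{u, v} R r'} {p n p' n' : ℤ} (f : A.X p n →ₗ[R] B.X p' n')
    (hc : ∀ x ∈ A.cycles p n, f x ∈ B.cycles p' n')
    (hb : ∀ x ∈ A.boundaries p n, f x ∈ B.boundaries p' n') (x : A.cycles p n) :
    mapH f hc hb (A.cls p n x) = B.cls p' n' ⟨f x, hc x x.2⟩ := rfl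

/-- Morphisms of `r`-bigraded complexes. -/
@[ext] structure Hom (A B : BigradedComplex.{u, v} R r) where
  f : ∀ p n, A.X p n →ₗ[R] B.X p n
  comm : ∀ (p n p' n' : ℤ) (hp : p' = p - r) (hn : n' = n + 1 - r) (x : A.X p n),
    f p' n' (A.d p n p' n' hp hn x) = B.d p n p' n' hp hn (f p n x)

namespace Hom

variable {A B C : BigradedComplex.{u, v} R r}

/-- The identity morphism. -/
@[simps] def id (A : BigradedComplex.{u, v} R r) : Hom A A where
  f _ _ := LinearMap.id
  comm _ _ _ _ _ _ _ := rfl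

/-- Composition of morphisms. -/
@[simps] def comp (f : Hom A B) (g : Hom B C) : Hom A C where
  f p n := (g.f p n).comp (f.f p n)
  comm p n p' n' hp hn x := by simp [f.comm p n p' n' hp hn, g.comm p n p' n' hp hn]

theorem map_cast (f : Hom A B) {p n p' n' : ℤ} (hp : p = p') (hn : n = n') (x : A.X p n) :
    f.f p' n' (A.cast hp hn x) = B.cast hp hn (f.f p n x) := by
  subst hp hn
  rfl

theorem map_cycles (f : Hom A B) {p n : ℤ} (x : A.X p n) (hx : x ∈ A.cycles p n) :
    f.f p n x ∈ B.cycles p n := by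
  rw [mem_cycles_iff _ _ _ rfl rfl] at hx ⊢
  rw [← f.comm, hx, map_zero]

theorem map_boundaries (f : Hom A B) {p n : ℤ} (x : A.X p n) (hx : x ∈ A.boundaries p n) :
    f.f p n x ∈ B.boundaries p n := by
  obtain ⟨y, rfl⟩ := hx
  exact ⟨f.f _ _ y, (f.comm _ _ _ _ _ _ y).symm⟩

/-- The map induced in homology. -/
def mapH (f : Hom A B) (p n : ℤ) : A.H p n →ₗ[R] B.H p n :=
  BigradedComplex.mapH (f.f p n) f.map_cycles f.map_boundaries

@[simp] theorem mapH_cls (f : Hom A B) {p n : ℤ} (x : A.cycles p n) :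
    f.mapH p n (A.cls p n x) = B.cls p n ⟨f.f p n x, f.map_cycles x.1 x.2⟩ := rfl

end Hom

end BigradedComplex

/-! ### Extended spectral sequences, and their truncations -/

/-- The objects of `tr_{≥ k} ESpSe`: the pages `i + k`, for `i : ℕ`, of an extended spectral
sequence, with the characteristic maps from each page to the homology of the previous one. -/
structure TrESpSe (R : Type u) [CommRing R] (k : ℕ) where
  page : ∀ i : ℕ, BigradedComplex.{u, v} R (i + k)
  φ : ∀ (i : ℕ) (p n : ℤ), (page (i + 1)).X p n →ₗ[R] (page i).H p n

namespace TrESpSe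

variable {R : Type u} [CommRing R] {k : ℕ}

/-- Morphisms: families of morphisms of bigraded complexes compatible with the
characteristic maps. -/
@[ext] structure Hom (X Y : TrESpSe.{u, v} R k) where
  f : ∀ i : ℕ, BigradedComplex.Hom (X.page i) (Y.page i)
  comm : ∀ (i : ℕ) (p n : ℤ) (x : (X.page (i + 1)).X p n),
    Y.φ i p n ((f (i + 1)).f p n x) = (f i).mapH p n (X.φ i p n x)

instance : Category (TrESpSe.{u, v} R k) where
  Hom := Hom
  id X :=
    { f := fun i => BigradedComplex.Hom.id (X.page i)
      comm := fun i p n x => by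
        obtain ⟨z, hz⟩ := (X.page i).cls_surjective p n (X.φ i p n x)
        change X.φ i p n x = _
        rw [← hz]
        rfl }
  comp {X Y Z} f g :=
    { f := fun i => BigradedComplex.Hom.comp (f.f i) (g.f i)
      comm := fun i p n x => by
        obtain ⟨z, hz⟩ := (X.page i).cls_surjective p n (X.φ i p n x)
        change Z.φ i p n ((g.f (i + 1)).f p n ((f.f (i + 1)).f p n x)) = _
        rw [g.comm, f.comm, ← hz]
        rfl }
  id_comp _ := rfl
  comp_id _ := rfl
  assoc _ _ _ := rfl

/-- All characteristic maps are isomorphisms. -/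
def IsSpectralSequence : ObjectProperty (TrESpSe.{u, v} R k) :=
  fun X => ∀ i p n, Function.Bijective (X.φ i p n)

/-- A sequence `(x_0, …, x_m)` is compatible if `d_i x_i = 0` and `φ (x_{i+1}) = [x_i]`
for all `i < m`. -/
def compatible (X : TrESpSe.{u, v} R 0) (m : ℕ) (p n : ℤ) :
    Submodule R (∀ i : Fin (m + 1), (X.page i).X p n) where
  carrier := {x | ∀ (i : ℕ) (hi : i < m),
    ∃ hx : x ⟨i, by omega⟩ ∈ (X.page i).cycles p n,
      X.φ i p n (x ⟨i + 1, by omega⟩) = (X.page i).cls p n ⟨x ⟨i, by omega⟩, hx⟩}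
  zero_mem' i hi := ⟨Submodule.zero_mem _, by
    change X.φ i p n 0 = (X.page i).cls p n 0
    rw [map_zero, map_zero]⟩
  add_mem' {a b} ha hb i hi := by
    obtain ⟨h₁, h₂⟩ := ha i hi
    obtain ⟨h₃, h₄⟩ := hb i hi
    refine ⟨Submodule.add_mem _ h₁ h₃, ?_⟩
    change X.φ i p n (a ⟨i + 1, _⟩ + b ⟨i + 1, _⟩) = _
    rw [map_add, h₂, h₄, ← map_add]
    rfl
  smul_mem' c a ha i hi := by
    obtain ⟨h₁, h₂⟩ := ha i hi
    refine ⟨Submodule.smul_mem _ c h₁, ?_⟩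
    change X.φ i p n (c • a ⟨i + 1, _⟩) = _
    rw [map_smul, h₂, ← map_smul]
    rfl

/-- Transport of a compatible sequence along equalities of the indices. -/
theorem compatible_cast (X : TrESpSe.{u, v} R 0) (m : ℕ) {p n p' n' : ℤ} (hp : p = p')
    (hn : n = n') (x : ∀ i : Fin (m + 1), (X.page i).X p n) (hx : x ∈ X.compatible m p n) :
    (fun i : Fin (m + 1) => (X.page i).cast hp hn (x i)) ∈ X.compatible m p' n' := by
  subst hp hn
  exact hx

/-- Removing the last term of a compatible sequence. -/
theorem compatible_init (X : TrESpSe.{u, v} R 0) (m : ℕ) {p n : ℤ}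
    (x : ∀ i : Fin (m + 2), (X.page i).X p n) (hx : x ∈ X.compatible (m + 1) p n) :
    (fun i : Fin (m + 1) => x ⟨i, by omega⟩) ∈ X.compatible m p n :=
  fun i hi => hx i (by omega)

/-- Appending a zero to a compatible sequence whose last term is a boundary. -/
theorem compatible_snoc_zero (X : TrESpSe.{u, v} R 0) (m : ℕ) {p n : ℤ}
    (x : ∀ i : Fin (m + 1), (X.page i).X p n) (hx : x ∈ X.compatible m p n)
    (hb : x ⟨m, by omega⟩ ∈ (X.page m).boundaries p n)
    (hc : x ⟨m, by omega⟩ ∈ (X.page m).cycles p n) :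
    (fun i : Fin (m + 2) => if h : (i : ℕ) < m + 1 then x ⟨i, h⟩ else 0) ∈
      X.compatible (m + 1) p n := by
  intro i hi
  by_cases him : i < m
  · simp only [show i < m + 1 by omega, show i + 1 < m + 1 by omega, dite_true]
    exact hx i him
  · obtain rfl : i = m := by omega
    simp only [show i < i + 1 by omega, show ¬ (i + 1 < i + 1) by omega, dite_true, dite_false]
    refine ⟨hc, ?_⟩
    rw [map_zero]
    exact (((X.page i).cls_eq_zero_iff ⟨_, hc⟩).2 hb).symm

theorem Hom.map_compatible {X Y : TrESpSe.{u, v} R 0} (f : Hom X Y) (m : ℕ) {p n : ℤ}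
    (x : ∀ i : Fin (m + 1), (X.page i).X p n) (hx : x ∈ X.compatible m p n) :
    (fun i : Fin (m + 1) => (f.f i).f p n (x i)) ∈ Y.compatible m p n := by
  intro i hi
  obtain ⟨h₁, h₂⟩ := hx i hi
  refine ⟨(f.f i).map_cycles _ h₁, ?_⟩
  rw [f.comm, h₂]
  rfl

end TrESpSe

/-- The category of extended spectral sequences. -/
abbrev ESpSe (R : Type u) [CommRing R] := TrESpSe.{u, v} R 0

/-- The category of spectral sequences: the full subcategory of extended spectral sequences whose
characteristic maps are isomorphisms. -/
abbrev SpSe (R : Type u) [CommRing R] :=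
  (TrESpSe.IsSpectralSequence : ObjectProperty (TrESpSe.{u, v} R 0)).FullSubcategory

/-! ### The inverse of the translation functor -/

/-- The inverse `𝒯⁻¹` of the translation functor `(𝒯 A)^{p,n} = A^{n,2n-p}` on bigraded
complexes. -/
@[simps] def BigradedComplex.untranslate {R : Type u} [CommRing R] {r : ℕ}
    (A : BigradedComplex.{u, v} R (r + 1)) : BigradedComplex.{u, v} R r where
  X p n := A.X (2 * p - n) p
  d p n p' n' hp hn := A.d (2 * p - n) p (2 * p' - n') p' (by push_cast; omega)
    (by push_cast; omega)
  d_comp_d _ _ _ _ _ _ _ _ _ _ _ := A.d_comp_d _ _ _ _ _ _ _ _ _ _ _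

namespace BigradedComplex

variable {R : Type u} [CommRing R] {r : ℕ}

theorem mem_untranslate_cycles (A : BigradedComplex.{u, v} R (r + 1)) {p n : ℤ}
    (x : A.X (2 * p - n) p) :
    x ∈ A.untranslate.cycles p n ↔ x ∈ A.cycles (2 * p - n) p :=
  (mem_cycles_iff A.untranslate (p := p) (n := n) _ _ rfl rfl x).trans
    (mem_cycles_iff A (2 * (p - r) - (n + 1 - r)) (p - r) (by push_cast; omega)
      (by push_cast; omega) x).symm

theorem mem_untranslate_boundaries (A : BigradedComplex.{u, v} R (r + 1)) {p n : ℤ}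
    (x : A.X (2 * p - n) p) :
    x ∈ A.untranslate.boundaries p n ↔ x ∈ A.boundaries (2 * p - n) p :=
  (mem_boundaries_iff A.untranslate (p := p) (n := n) (p + r) (n - 1 + r) (by omega)
    (by omega) x).trans
    (mem_boundaries_iff A (2 * (p + r) - (n - 1 + r)) (p + r) (by push_cast; omega)
      (by push_cast; omega) x).symm

/-- The identification of the homology of `A` with that of `𝒯⁻¹ A`. -/
def untranslateH (A : BigradedComplex.{u, v} R (r + 1)) (p n : ℤ) :
    A.H (2 * p - n) p →ₗ[R] A.untranslate.H p n :=
  mapH (A := A) (B := A.untranslate) (p' := p) (n' := n) LinearMap.id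
    (fun x hx => (A.mem_untranslate_cycles x).2 hx)
    (fun x hx => (A.mem_untranslate_boundaries x).2 hx)

end BigradedComplex

/-- The inverse `𝒯⁻¹ : tr_{≥ 1} ESpSe ⥤ ESpSe` of the translation functor. -/
def untranslate (R : Type u) [CommRing R] : TrESpSe.{u, v} R 1 ⥤ ESpSe.{u, v} R where
  obj X :=
    { page := fun i => (X.page i).untranslate
      φ := fun i p n => ((X.page i).untranslateH p n).comp (X.φ i (2 * p - n) p) }
  map {X Y} f :=
    { f := fun i =>
        { f := fun p n => (f.f i).f (2 * p - n) p
          comm := fun _ _ _ _ _ _ _ => (f.f i).comm _ _ _ _ _ _ _ }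
      comm := fun i p n x => by
        obtain ⟨z, hz⟩ := (X.page i).cls_surjective _ _ (X.φ i (2 * p - n) p x)
        refine (congrArg ((Y.page i).untranslateH p n) (f.comm i (2 * p - n) p x)).trans ?_
        refine Eq.trans ?_ (congrArg (fun ξ => BigradedComplex.Hom.mapH _ p n
          ((X.page i).untranslateH p n ξ)) hz)
        rw [← hz]
        rfl }
  map_id _ := rfl
  map_comp _ _ := rfl

/-! ### Linear witness books, and their truncations -/

/-- The objects of `tr_{≥ k} LWB`: the pages `i + k`, for `i : ℕ`, of a linear witness book, with
the witness maps `w` of bidegree `(0, 0)` and the degeneracy maps `s` of bidegree `(1, 1)`. -/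
structure TrLWB (R : Type u) [CommRing R] (k : ℕ) where
  page : ∀ i : ℕ, BigradedComplex.{u, v} R (i + k)
  w : ∀ (i : ℕ) (p n : ℤ), (page (i + 1)).X p n →ₗ[R] (page i).X p n
  s : ∀ (i : ℕ) (p n p' n' : ℤ), p' = p + 1 → n' = n + 1 →
    ((page i).X p n →ₗ[R] (page (i + 1)).X p' n')
  w_s : ∀ (i : ℕ) (p n p' n' : ℤ) (hp : p' = p + 1) (hn : n' = n + 1) (x : (page i).X p n),
    w i p' n' (s i p n p' n' hp hn x) = 0
  s_w : ∀ (i : ℕ) (p n p' n' : ℤ) (hp : p' = p + 1) (hn : n' = n + 1)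
    (x : (page (i + 1)).X p n), s i p n p' n' hp hn (w i p n x) = 0
  w_d_s : ∀ (i : ℕ) (p n p₁ n₁ p' n' : ℤ) (hp : p₁ = p + 1) (hn : n₁ = n + 1)
    (hp' : p' = p₁ - ((i + 1 + k : ℕ) : ℤ)) (hn' : n' = n₁ + 1 - ((i + 1 + k : ℕ) : ℤ))
    (x : (page i).X p n),
    w i p' n' ((page (i + 1)).d p₁ n₁ p' n' hp' hn' (s i p n p₁ n₁ hp hn x)) =
      (page i).d p n p' n' (by push_cast at *; omega) (by push_cast at *; omega) x

namespace TrLWB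

variable {R : Type u} [CommRing R] {k : ℕ}

/-- Morphisms: families of morphisms of bigraded complexes compatible with the witness and
degeneracy maps. -/
@[ext] structure Hom (L M : TrLWB.{u, v} R k) where
  f : ∀ i : ℕ, BigradedComplex.Hom (L.page i) (M.page i)
  comm_w : ∀ (i : ℕ) (p n : ℤ) (x : (L.page (i + 1)).X p n),
    (f i).f p n (L.w i p n x) = M.w i p n ((f (i + 1)).f p n x)
  comm_s : ∀ (i : ℕ) (p n p' n' : ℤ) (hp : p' = p + 1) (hn : n' = n + 1) (x : (L.page i).X p n),
    (f (i + 1)).f p' n' (L.s i p n p' n' hp hn x) = M.s i p n p' n' hp hn ((f i).f p n x)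

instance : Category (TrLWB.{u, v} R k) where
  Hom := Hom
  id L :=
    { f := fun i => BigradedComplex.Hom.id (L.page i)
      comm_w := fun _ _ _ _ => rfl
      comm_s := fun _ _ _ _ _ _ _ _ => rfl }
  comp f g :=
    { f := fun i => BigradedComplex.Hom.comp (f.f i) (g.f i)
      comm_w := fun i p n x => by simp [f.comm_w, g.comm_w]
      comm_s := fun i p n p' n' hp hn x => by simp [f.comm_s, g.comm_s] }
  id_comp _ := rfl
  comp_id _ := rfl
  assoc _ _ _ := rfl

theorem d_w (L : TrLWB.{u, v} R k) (i : ℕ) (p n p' n' : ℤ) (hp : p' = p - ((i + k : ℕ) : ℤ))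
    (hn : n' = n + 1 - ((i + k : ℕ) : ℤ)) (x : (L.page (i + 1)).X p n) :
    (L.page i).d p n p' n' hp hn (L.w i p n x) = 0 := by
  rw [← L.w_d_s i p n (p + 1) (n + 1) p' n' rfl rfl (by push_cast at *; omega)
    (by push_cast at *; omega), L.s_w, map_zero, map_zero]

theorem w_cast (L : TrLWB.{u, v} R k) (i : ℕ) {p n p' n' : ℤ} (hp : p = p') (hn : n = n')
    (x : (L.page (i + 1)).X p n) :
    L.w i p' n' ((L.page (i + 1)).cast hp hn x) = (L.page i).cast hp hn (L.w i p n x) := by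
  subst hp hn
  rfl

theorem s_cast (L : TrLWB.{u, v} R k) (i : ℕ) {p n p₁ n₁ p' n' : ℤ} (h₁ : p = p₁) (h₂ : n = n₁)
    (hp : p' = p₁ + 1) (hn : n' = n₁ + 1) (x : (L.page i).X p n) :
    L.s i p₁ n₁ p' n' hp hn ((L.page i).cast h₁ h₂ x) =
      L.s i p n p' n' (by rw [hp, h₁]) (by rw [hn, h₂]) x := by
  subst h₁ h₂
  rfl

end TrLWB

/-- The category of linear witness books. -/
abbrev LWB (R : Type u) [CommRing R] := TrLWB.{u, v} R 0

/-! ### The nerve functor from extended spectral sequences to linear witness books -/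

namespace TrESpSe

variable {R : Type u} [CommRing R]

/-- `𝒩(X)_r^{p,n}`: the pairs `(x; y)` of compatible sequences `(x_0, …, x_r)` in bidegree `(p, n)`
and `(y_0, …, y_r)` in bidegree `(p - r, n + 1 - r)` with `d_r x_r = y_r`. -/
def nerveModule (X : TrESpSe.{u, v} R 0) (r : ℕ) (p n : ℤ) :
    Submodule R ((∀ i : Fin (r + 1), (X.page i).X p n) ×
      (∀ i : Fin (r + 1), (X.page i).X (p - r) (n + 1 - r))) where
  carrier := {z | z.1 ∈ X.compatible r p n ∧ z.2 ∈ X.compatible r (p - r) (n + 1 - r) ∧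
    (X.page r).d p n (p - r) (n + 1 - r) rfl rfl (z.1 ⟨r, by omega⟩) = z.2 ⟨r, by omega⟩}
  zero_mem' := ⟨Submodule.zero_mem _, Submodule.zero_mem _, map_zero _⟩
  add_mem' {a b} ha hb := ⟨Submodule.add_mem _ ha.1 hb.1, Submodule.add_mem _ ha.2.1 hb.2.1, by
    change (X.page r).d p n (p - r) (n + 1 - r) rfl rfl (a.1 ⟨r, _⟩ + b.1 ⟨r, _⟩) =
      a.2 ⟨r, _⟩ + b.2 ⟨r, _⟩
    rw [map_add, ha.2.2, hb.2.2]⟩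
  smul_mem' c a ha := ⟨Submodule.smul_mem _ c ha.1, Submodule.smul_mem _ c ha.2.1, by
    change (X.page r).d p n (p - r) (n + 1 - r) rfl rfl (c • a.1 ⟨r, _⟩) = c • a.2 ⟨r, _⟩
    rw [map_smul, ha.2.2]⟩

/-- The differential `(x; y) ↦ (y; 0)`. -/
def nerveD (X : TrESpSe.{u, v} R 0) (r : ℕ) (p n p' n' : ℤ) (hp : p' = p - r)
    (hn : n' = n + 1 - r) : X.nerveModule r p n →ₗ[R] X.nerveModule r p' n' where
  toFun z := ⟨(fun i => (X.page i).cast hp.symm hn.symm (z.1.2 i), 0),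
    X.compatible_cast r _ _ _ z.2.2.1, Submodule.zero_mem _, by
      change (X.page r).d p' n' _ _ rfl rfl
        ((X.page r).cast hp.symm hn.symm (z.1.2 ⟨r, by omega⟩)) = 0
      rw [BigradedComplex.d_cast, ← z.2.2.2]
      exact (X.page r).d_comp_d _ _ _ _ _ _ _ _ _ _ _⟩
  map_add' a b := by
    refine Subtype.ext (Prod.ext ?_ (add_zero 0).symm)
    funext i
    exact map_add _ _ _
  map_smul' c a := by
    refine Subtype.ext (Prod.ext ?_ (smul_zero c).symm)
    funext i
    exact map_smul _ _ _

/-- The witness map `(x; y) ↦ ((x_0, …, x_r); 0)`, from page `r + 1` to page `r`. -/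
def nerveW (X : TrESpSe.{u, v} R 0) (r : ℕ) (p n : ℤ) :
    X.nerveModule (r + 1) p n →ₗ[R] X.nerveModule r p n where
  toFun z := ⟨(fun i => z.1.1 ⟨i, by omega⟩, 0), X.compatible_init r _ z.2.1,
    Submodule.zero_mem _, by
      obtain ⟨h, -⟩ := z.2.1 r (by omega)
      exact ((X.page r).mem_cycles_iff _ _ rfl rfl _).1 h⟩
  map_add' a b := Subtype.ext (Prod.ext rfl (add_zero 0).symm)
  map_smul' c a := Subtype.ext (Prod.ext rfl (smul_zero c).symm)

/-- The degeneracy map `(x; y) ↦ (0; (y_0, …, y_r, 0))`, from page `r` to page `r + 1`. -/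
def nerveS (X : TrESpSe.{u, v} R 0) (r : ℕ) (p n p' n' : ℤ) (hp : p' = p + 1)
    (hn : n' = n + 1) : X.nerveModule r p n →ₗ[R] X.nerveModule (r + 1) p' n' where
  toFun z := ⟨(0, fun i =>
      (X.page i).cast (by push_cast; omega) (by push_cast; omega)
        (if h : (i : ℕ) < r + 1 then z.1.2 ⟨i, h⟩ else 0)), Submodule.zero_mem _,
    X.compatible_cast (r + 1) _ _ _ (X.compatible_snoc_zero r _ z.2.2.1
      (((X.page r).mem_boundaries_iff p n rfl rfl _).2 ⟨_, z.2.2.2⟩)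
      (((X.page r).mem_cycles_iff _ _ rfl rfl _).2 (by
        rw [← z.2.2.2]
        exact (X.page r).d_comp_d _ _ _ _ _ _ _ _ _ _ _))), by
      change (X.page (r + 1)).d _ _ _ _ _ _ 0 = _
      simp⟩
  map_add' a b := by
    refine Subtype.ext (Prod.ext (add_zero 0).symm ?_)
    funext i
    change (X.page i).cast _ _ (if h : (i : ℕ) < r + 1 then a.1.2 ⟨i, h⟩ + b.1.2 ⟨i, h⟩ else 0) =
      (X.page i).cast _ _ (if h : (i : ℕ) < r + 1 then a.1.2 ⟨i, h⟩ else 0) +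
        (X.page i).cast _ _ (if h : (i : ℕ) < r + 1 then b.1.2 ⟨i, h⟩ else 0)
    rw [← map_add]
    split_ifs
    · rfl
    · exact congrArg _ (add_zero 0).symm
  map_smul' c a := by
    refine Subtype.ext (Prod.ext (smul_zero c).symm ?_)
    funext i
    change (X.page i).cast _ _ (if h : (i : ℕ) < r + 1 then c • a.1.2 ⟨i, h⟩ else 0) =
      c • (X.page i).cast _ _ (if h : (i : ℕ) < r + 1 then a.1.2 ⟨i, h⟩ else 0)
    rw [← map_smul]
    split_ifs
    · rfl
    · exact congrArg _ (smul_zero c).symm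

end TrESpSe

namespace TrESpSe

variable {R : Type u} [CommRing R]

/-- The linear witness book `𝒩(X)`. -/
@[simps] def nerveObj (X : TrESpSe.{u, v} R 0) : LWB.{u, v} R where
  page r :=
    { X := fun p n => X.nerveModule r p n
      d := X.nerveD r
      d_comp_d := fun p n p' n' p'' n'' hp hn hp' hn' z => by
        refine Subtype.ext (Prod.ext ?_ rfl)
        funext i
        exact map_zero _ }
  w := X.nerveW
  s := X.nerveS
  w_s i p n p' n' hp hn x := rfl
  s_w i p n p' n' hp hn x := by
    refine Subtype.ext (Prod.ext rfl ?_)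
    funext j
    change (X.page j).cast _ _ (if h : (j : ℕ) < i + 1 then 0 else 0) = 0
    rw [dite_eq_ite, ite_self, map_zero]
  w_d_s i p n p₁ n₁ p' n' hp hn hp' hn' z := by
    refine Subtype.ext (Prod.ext ?_ rfl)
    funext j
    change (X.page j).cast _ _ ((X.page j).cast _ _
      (if h : (j : ℕ) < i + 1 then z.1.2 ⟨j, h⟩ else 0)) = (X.page j).cast _ _ (z.1.2 j)
    rw [dif_pos j.2]
    exact BigradedComplex.cast_cast _ _ _ _ _ _

/-- The map induced on `𝒩(-)_r^{p,n}` by a morphism. -/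
def Hom.nerveMap {X Y : TrESpSe.{u, v} R 0} (f : Hom X Y) (r : ℕ) (p n : ℤ) :
    X.nerveModule r p n →ₗ[R] Y.nerveModule r p n where
  toFun z := ⟨(fun i => (f.f i).f p n (z.1.1 i), fun i => (f.f i).f _ _ (z.1.2 i)),
    f.map_compatible r _ z.2.1, f.map_compatible r _ z.2.2.1, by
      refine ((f.f r).comm p n _ _ rfl rfl (z.1.1 ⟨r, by omega⟩)).symm.trans ?_
      exact congrArg ((f.f r).f _ _) z.2.2.2⟩
  map_add' a b := by
    refine Subtype.ext (Prod.ext ?_ ?_) <;> funext i <;> exact map_add _ _ _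
  map_smul' c a := by
    refine Subtype.ext (Prod.ext ?_ ?_) <;> funext i <;> exact map_smul _ _ _

/-- The morphism of linear witness books induced by a morphism. -/
def Hom.nerveHom {X Y : TrESpSe.{u, v} R 0} (f : Hom X Y) :
    TrLWB.Hom X.nerveObj Y.nerveObj where
  f r :=
    { f := fun p n => f.nerveMap r p n
      comm := fun p n p' n' hp hn z => by
        refine Subtype.ext (Prod.ext ?_ ?_) <;> funext i
        · exact (f.f i).map_cast _ _ _
        · exact map_zero _ }
  comm_w r p n z := by
    refine Subtype.ext (Prod.ext rfl ?_)
    funext i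
    exact map_zero _
  comm_s r p n p' n' hp hn z := by
    refine Subtype.ext (Prod.ext ?_ ?_) <;> funext i
    · exact map_zero _
    · refine ((f.f i).map_cast _ _ _).trans ?_
      refine congrArg ((Y.page i).cast _ _) ?_
      by_cases h : (i : ℕ) < r + 1
      · rw [dif_pos h, dif_pos h]
        rfl
      · rw [dif_neg h, dif_neg h, map_zero]

end TrESpSe

/-- The nerve functor `𝒩 : ESpSe ⥤ LWB`. -/
def nerve (R : Type u) [CommRing R] : ESpSe.{u, v} R ⥤ LWB.{u, v} R where
  obj X := X.nerveObj
  map f := TrESpSe.Hom.nerveHom f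
  map_id _ := rfl
  map_comp _ _ := rfl

/-! ### The functors `𝒬` -/

namespace TrLWB

variable {R : Type u} [CommRing R] {k : ℕ}

/-- The subcomplex `S = s L + d s L` of each page, with `S = 0` on the first page. -/
def degen (L : TrLWB.{u, v} R k) : ∀ (i : ℕ) (p n : ℤ), Submodule R ((L.page i).X p n)
  | 0, _, _ => ⊥
  | i + 1, p, n =>
    LinearMap.range (L.s i (p - 1) (n - 1) p n (by omega) (by omega)) ⊔
      LinearMap.range (((L.page (i + 1)).d (p + ((i + 1 + k : ℕ) : ℤ))
          (n - 1 + ((i + 1 + k : ℕ) : ℤ)) p n (by omega) (by omega)).comp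
        (L.s i (p + ((i + 1 + k : ℕ) : ℤ) - 1) (n - 1 + ((i + 1 + k : ℕ) : ℤ) - 1) _ _
          (by omega) (by omega)))

theorem s_mem_degen (L : TrLWB.{u, v} R k) (i : ℕ) {p₀ n₀ p n : ℤ} (hp : p = p₀ + 1)
    (hn : n = n₀ + 1) (x : (L.page i).X p₀ n₀) : L.s i p₀ n₀ p n hp hn x ∈ L.degen (i + 1) p n := by
  obtain rfl : p₀ = p - 1 := by omega
  obtain rfl : n₀ = n - 1 := by omega
  exact Submodule.mem_sup_left ⟨x, rfl⟩

theorem d_s_mem_degen (L : TrLWB.{u, v} R k) (i : ℕ) {p₀ n₀ p₁ n₁ p n : ℤ} (hp : p₁ = p₀ + 1)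
    (hn : n₁ = n₀ + 1) (hp' : p = p₁ - ((i + 1 + k : ℕ) : ℤ))
    (hn' : n = n₁ + 1 - ((i + 1 + k : ℕ) : ℤ)) (x : (L.page i).X p₀ n₀) :
    (L.page (i + 1)).d p₁ n₁ p n hp' hn' (L.s i p₀ n₀ p₁ n₁ hp hn x) ∈ L.degen (i + 1) p n := by
  obtain rfl : p₁ = p + ((i + 1 + k : ℕ) : ℤ) := by omega
  obtain rfl : n₁ = n - 1 + ((i + 1 + k : ℕ) : ℤ) := by omega
  obtain rfl : p₀ = p + ((i + 1 + k : ℕ) : ℤ) - 1 := by omega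
  obtain rfl : n₀ = n - 1 + ((i + 1 + k : ℕ) : ℤ) - 1 := by omega
  exact Submodule.mem_sup_right ⟨x, rfl⟩

/-- `S` is contained in every family of submodules containing its generators. -/
theorem degen_succ_le (L : TrLWB.{u, v} R k) (i : ℕ) {p n : ℤ}
    (P : Submodule R ((L.page (i + 1)).X p n))
    (h₁ : ∀ (p₀ n₀ : ℤ) (hp : p = p₀ + 1) (hn : n = n₀ + 1) (x : (L.page i).X p₀ n₀),
      L.s i p₀ n₀ p n hp hn x ∈ P)
    (h₂ : ∀ (p₀ n₀ p₁ n₁ : ℤ) (hp : p₁ = p₀ + 1) (hn : n₁ = n₀ + 1)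
      (hp' : p = p₁ - ((i + 1 + k : ℕ) : ℤ)) (hn' : n = n₁ + 1 - ((i + 1 + k : ℕ) : ℤ))
      (x : (L.page i).X p₀ n₀),
      (L.page (i + 1)).d p₁ n₁ p n hp' hn' (L.s i p₀ n₀ p₁ n₁ hp hn x) ∈ P) :
    L.degen (i + 1) p n ≤ P := by
  refine sup_le ?_ ?_
  · rintro _ ⟨x, rfl⟩
    exact h₁ _ _ _ _ x
  · rintro _ ⟨x, rfl⟩
    exact h₂ _ _ _ _ _ _ _ _ x

theorem degen_le_d (L : TrLWB.{u, v} R k) (i : ℕ) (p n p' n' : ℤ)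
    (hp : p' = p - ((i + k : ℕ) : ℤ)) (hn : n' = n + 1 - ((i + k : ℕ) : ℤ)) :
    L.degen i p n ≤ (L.degen i p' n').comap ((L.page i).d p n p' n' hp hn) := by
  cases i with
  | zero => exact bot_le
  | succ i =>
    refine L.degen_succ_le i _ ?_ ?_
    · intro p₀ n₀ hp₀ hn₀ x
      exact L.d_s_mem_degen i hp₀ hn₀ hp hn x
    · intro p₀ n₀ p₁ n₁ hp₀ hn₀ hp₁ hn₁ x
      rw [Submodule.mem_comap, (L.page (i + 1)).d_comp_d]
      exact Submodule.zero_mem _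

theorem Hom.degen_le {L M : TrLWB.{u, v} R k} (f : Hom L M) (i : ℕ) (p n : ℤ) :
    L.degen i p n ≤ (M.degen i p n).comap ((f.f i).f p n) := by
  cases i with
  | zero => exact bot_le
  | succ i =>
    refine L.degen_succ_le i _ ?_ ?_
    · intro p₀ n₀ hp₀ hn₀ x
      rw [Submodule.mem_comap, f.comm_s]
      exact M.s_mem_degen i hp₀ hn₀ _
    · intro p₀ n₀ p₁ n₁ hp₀ hn₀ hp₁ hn₁ x
      rw [Submodule.mem_comap, (f.f (i + 1)).comm, f.comm_s]
      exact M.d_s_mem_degen i hp₀ hn₀ hp₁ hn₁ _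

/-- The quotient of a page by the subcomplex `S`. -/
def quotPage (L : TrLWB.{u, v} R k) (i : ℕ) : BigradedComplex.{u, v} R (i + k) where
  X p n := (L.page i).X p n ⧸ L.degen i p n
  d p n p' n' hp hn := Submodule.mapQ _ _ ((L.page i).d p n p' n' hp hn)
    (L.degen_le_d i p n p' n' hp hn)
  d_comp_d p n p' n' p'' n'' hp hn hp' hn' x := by
    obtain ⟨x, rfl⟩ := Submodule.Quotient.mk_surjective _ x
    rw [Submodule.mapQ_apply, Submodule.mapQ_apply, (L.page i).d_comp_d]
    rfl

/-- The class of an element modulo `S`. -/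
def quotMk (L : TrLWB.{u, v} R k) (i : ℕ) (p n : ℤ) :
    (L.page i).X p n →ₗ[R] (L.quotPage i).X p n :=
  (L.degen i p n).mkQ

theorem quotMk_surjective (L : TrLWB.{u, v} R k) (i : ℕ) (p n : ℤ) :
    Function.Surjective (L.quotMk i p n) :=
  Submodule.mkQ_surjective _

theorem quotPage_d_mk (L : TrLWB.{u, v} R k) (i : ℕ) (p n p' n' : ℤ)
    (hp : p' = p - ((i + k : ℕ) : ℤ)) (hn : n' = n + 1 - ((i + k : ℕ) : ℤ))
    (x : (L.page i).X p n) :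
    (L.quotPage i).d p n p' n' hp hn (L.quotMk i p n x) =
      L.quotMk i p' n' ((L.page i).d p n p' n' hp hn x) := rfl

theorem quotMk_w_mem_cycles (L : TrLWB.{u, v} R k) (i : ℕ) (p n : ℤ)
    (x : (L.page (i + 1)).X p n) :
    L.quotMk i p n (L.w i p n x) ∈ (L.quotPage i).cycles p n := by
  rw [BigradedComplex.mem_cycles_iff _ _ _ rfl rfl, quotPage_d_mk, L.d_w, map_zero]

/-- The map `a ↦ [w a]`. -/
def wClass (L : TrLWB.{u, v} R k) (i : ℕ) (p n : ℤ) :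
    (L.page (i + 1)).X p n →ₗ[R] (L.quotPage i).H p n :=
  ((L.quotPage i).cls p n).comp
    (((L.quotMk i p n).comp (L.w i p n)).codRestrict _ (L.quotMk_w_mem_cycles i p n))

theorem degen_le_ker_wClass (L : TrLWB.{u, v} R k) (i : ℕ) (p n : ℤ) :
    L.degen (i + 1) p n ≤ LinearMap.ker (L.wClass i p n) := by
  refine L.degen_succ_le i _ ?_ ?_
  · intro p₀ n₀ hp hn x
    refine LinearMap.mem_ker.2 (((L.quotPage i).cls_eq_zero_iff _).2 ?_)
    change L.quotMk i p n (L.w i p n _) ∈ _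
    rw [L.w_s, map_zero]
    exact Submodule.zero_mem _
  · intro p₀ n₀ p₁ n₁ hp hn hp' hn' x
    refine LinearMap.mem_ker.2 (((L.quotPage i).cls_eq_zero_iff _).2 ?_)
    change L.quotMk i p n (L.w i p n _) ∈ _
    rw [L.w_d_s, (L.quotPage i).mem_boundaries_iff p₀ n₀ (by push_cast at *; omega)
      (by push_cast at *; omega)]
    exact ⟨L.quotMk i p₀ n₀ x, rfl⟩

/-- The object `𝒬(L)`, with characteristic maps `φ(ā) = [w a]`. -/
def quotObj (L : TrLWB.{u, v} R k) : TrESpSe.{u, v} R k where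
  page := L.quotPage
  φ i p n := (L.degen (i + 1) p n).liftQ (L.wClass i p n) (L.degen_le_ker_wClass i p n)

/-- The morphism induced on quotients. -/
def Hom.quotHom {L M : TrLWB.{u, v} R k} (f : Hom L M) : TrESpSe.Hom L.quotObj M.quotObj where
  f i :=
    { f := fun p n => Submodule.mapQ _ _ ((f.f i).f p n) (f.degen_le i p n)
      comm := fun p n p' n' hp hn x => by
        obtain ⟨x, rfl⟩ := L.quotMk_surjective i p n x
        exact congrArg (M.quotMk i p' n') ((f.f i).comm p n p' n' hp hn x) }
  comm i p n x := by
    obtain ⟨x, rfl⟩ := L.quotMk_surjective (i + 1) p n x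
    refine congrArg ((M.quotPage i).cls p n) (Subtype.ext ?_)
    exact congrArg (M.quotMk i p n) (f.comm_w i p n x).symm

end TrLWB

/-- The functor `𝒬_{≥ k} : tr_{≥ k} LWB ⥤ tr_{≥ k} ESpSe`. -/
def degenQuotient (R : Type u) [CommRing R] (k : ℕ) : TrLWB.{u, v} R k ⥤ TrESpSe.{u, v} R k where
  obj L := L.quotObj
  map f := TrLWB.Hom.quotHom f
  map_id L := by
    refine TrESpSe.Hom.ext (funext fun i => BigradedComplex.Hom.ext (funext fun p =>
      funext fun n => LinearMap.ext fun x => ?_))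
    obtain ⟨x, rfl⟩ := L.quotMk_surjective i p n x
    rfl
  map_comp {L M N} f g := by
    refine TrESpSe.Hom.ext (funext fun i => BigradedComplex.Hom.ext (funext fun p =>
      funext fun n => LinearMap.ext fun x => ?_))
    obtain ⟨x, rfl⟩ := L.quotMk_surjective i p n x
    rfl

/-! ### The functor `𝒲_! : LWB ⥤ tr_{≥ 1} LWB` -/

namespace TrLWB

variable {R : Type u} [CommRing R]

/-- The iterated degeneracy `s^j` from page `1` to page `j + 1`. -/
def sIter (L : TrLWB.{u, v} R 0) : ∀ (j : ℕ) (p n p' n' : ℤ), p' = p + j → n' = n + j →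
    ((L.page 1).X p n →ₗ[R] (L.page (j + 1)).X p' n')
  | 0, _, _, _, _, hp, hn => (L.page 1).cast (by rw [hp]; simp) (by rw [hn]; simp)
  | j + 1, p, n, p', n', hp, hn =>
    (L.s (j + 1) (p' - 1) (n' - 1) p' n' (by omega) (by omega)).comp
      (L.sIter j p n (p' - 1) (n' - 1) (by push_cast at hp; omega) (by push_cast at hn; omega))

theorem sIter_succ (L : TrLWB.{u, v} R 0) (j : ℕ) (p n p₁ n₁ p' n' : ℤ) (hp : p₁ = p + j)
    (hn : n₁ = n + j) (hp' : p' = p₁ + 1) (hn' : n' = n₁ + 1) (x : (L.page 1).X p n) :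
    L.sIter (j + 1) p n p' n' (by push_cast; omega) (by push_cast; omega) x =
      L.s (j + 1) p₁ n₁ p' n' hp' hn' (L.sIter j p n p₁ n₁ hp hn x) := by
  obtain rfl : p₁ = p' - 1 := by omega
  obtain rfl : n₁ = n' - 1 := by omega
  rfl

theorem sIter_cast (L : TrLWB.{u, v} R 0) (j : ℕ) {p n p₁ n₁ p' n' : ℤ} (h₁ : p = p₁)
    (h₂ : n = n₁) (hp : p' = p₁ + j) (hn : n' = n₁ + j) (x : (L.page 1).X p n) :
    L.sIter j p₁ n₁ p' n' hp hn ((L.page 1).cast h₁ h₂ x) =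
      L.sIter j p n p' n' (by rw [hp, h₁]) (by rw [hn, h₂]) x := by
  subst h₁ h₂
  rfl

theorem Hom.sIter_comm {L M : TrLWB.{u, v} R 0} (f : Hom L M) (j : ℕ) (p n p' n' : ℤ)
    (hp : p' = p + j) (hn : n' = n + j) (x : (L.page 1).X p n) :
    (f.f (j + 1)).f p' n' (L.sIter j p n p' n' hp hn x) =
      M.sIter j p n p' n' hp hn ((f.f 1).f p n x) := by
  induction j generalizing p' n' with
  | zero => exact (f.f 1).map_cast _ _ x
  | succ j ih =>
    exact (f.comm_s _ _ _ _ _ _ _ _).trans (congrArg (M.s (j + 1) (p' - 1) (n' - 1) p' n' _ _)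
      (ih (p' - 1) (n' - 1) _ _))

/-- The module `L_0^{p-j,n-j} ⊕ L_0^{p+1,n} ⊕ L_{j+1}^{p,n}`. -/
abbrev ShriekPre (L : TrLWB.{u, v} R 0) (j : ℕ) (p n : ℤ) : Type v :=
  (L.page 0).X (p - j) (n - j) × (L.page 0).X (p + 1) n × (L.page (j + 1)).X p n

/-- The relation `x ↦ (w x, 0, - s^j x)`. -/
def shriekRel₁ (L : TrLWB.{u, v} R 0) (j : ℕ) (p n : ℤ) :
    (L.page 1).X (p - j) (n - j) →ₗ[R] L.ShriekPre j p n :=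
  (L.w 0 (p - j) (n - j)).prod (LinearMap.prod 0
    (-(L.sIter j (p - j) (n - j) p n (by omega) (by omega))))

/-- The relation `x ↦ (0, w x, - d s^j x)`. -/
def shriekRel₂ (L : TrLWB.{u, v} R 0) (j : ℕ) (p n : ℤ) :
    (L.page 1).X (p + 1) n →ₗ[R] L.ShriekPre j p n :=
  LinearMap.prod 0 ((L.w 0 (p + 1) n).prod
    (-(((L.page (j + 1)).d (p + 1 + j) (n + j) p n (by push_cast; omega)
      (by push_cast; omega)).comp (L.sIter j (p + 1) n _ _ rfl rfl))))

/-- The submodule generated by both relations. -/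
def shriekRel (L : TrLWB.{u, v} R 0) (j : ℕ) (p n : ℤ) : Submodule R (L.ShriekPre j p n) :=
  LinearMap.range (L.shriekRel₁ j p n) ⊔ LinearMap.range (L.shriekRel₂ j p n)

/-- The differential `(a, b, c) ↦ (0, a, d c)`. -/
def shriekPreD (L : TrLWB.{u, v} R 0) (j : ℕ) (p n p' n' : ℤ)
    (hp : p' = p - ((j + 1 : ℕ) : ℤ)) (hn : n' = n + 1 - ((j + 1 : ℕ) : ℤ)) :
    L.ShriekPre j p n →ₗ[R] L.ShriekPre j p' n' :=
  LinearMap.prod 0 (LinearMap.prodMap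
    ((L.page 0).cast (by push_cast at hp; omega) (by push_cast at hn; omega))
    (((L.page (j + 1)).d p n p' n' hp hn).comp (LinearMap.snd R _ _)))

/-- The witness map `(a, b, c) ↦ (0, b, w c)`. -/
def shriekPreW (L : TrLWB.{u, v} R 0) (j : ℕ) (p n : ℤ) :
    L.ShriekPre (j + 1) p n →ₗ[R] L.ShriekPre j p n :=
  LinearMap.prodMap 0 (LinearMap.prodMap LinearMap.id (L.w (j + 1) p n))

/-- The degeneracy map `(a, b, c) ↦ (a, 0, s c)`. -/
def shriekPreS (L : TrLWB.{u, v} R 0) (j : ℕ) (p n p' n' : ℤ) (hp : p' = p + 1)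
    (hn : n' = n + 1) : L.ShriekPre j p n →ₗ[R] L.ShriekPre (j + 1) p' n' :=
  LinearMap.prodMap ((L.page 0).cast (by push_cast; omega) (by push_cast; omega))
    (LinearMap.prodMap 0 (L.s (j + 1) p n p' n' hp hn))

theorem shriekRel₁_apply (L : TrLWB.{u, v} R 0) (j : ℕ) (p n : ℤ)
    (x : (L.page 1).X (p - j) (n - j)) : L.shriekRel₁ j p n x = (L.w 0 (p - j) (n - j) x, 0,
      -(L.sIter j (p - j) (n - j) p n (by omega) (by omega) x)) := rfl

theorem shriekRel₂_apply (L : TrLWB.{u, v} R 0) (j : ℕ) (p n : ℤ)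
    (x : (L.page 1).X (p + 1) n) : L.shriekRel₂ j p n x = (0, L.w 0 (p + 1) n x,
      -((L.page (j + 1)).d (p + 1 + j) (n + j) p n (by push_cast; omega)
        (by push_cast; omega) (L.sIter j (p + 1) n _ _ rfl rfl x))) := rfl

theorem shriekPreD_apply (L : TrLWB.{u, v} R 0) (j : ℕ) (p n p' n' : ℤ)
    (hp : p' = p - ((j + 1 : ℕ) : ℤ)) (hn : n' = n + 1 - ((j + 1 : ℕ) : ℤ))
    (z : L.ShriekPre j p n) : L.shriekPreD j p n p' n' hp hn z =
      (0, (L.page 0).cast (by push_cast at hp; omega) (by push_cast at hn; omega) z.1,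
        (L.page (j + 1)).d p n p' n' hp hn z.2.2) := rfl

theorem shriekPreW_apply (L : TrLWB.{u, v} R 0) (j : ℕ) (p n : ℤ)
    (z : L.ShriekPre (j + 1) p n) :
    L.shriekPreW j p n z = (0, z.2.1, L.w (j + 1) p n z.2.2) := rfl

theorem shriekPreS_apply (L : TrLWB.{u, v} R 0) (j : ℕ) (p n p' n' : ℤ) (hp : p' = p + 1)
    (hn : n' = n + 1) (z : L.ShriekPre j p n) : L.shriekPreS j p n p' n' hp hn z =
      ((L.page 0).cast (by push_cast; omega) (by push_cast; omega) z.1, 0,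
        L.s (j + 1) p n p' n' hp hn z.2.2) := rfl

theorem shriekRel₁_mem (L : TrLWB.{u, v} R 0) (j : ℕ) {p₀ n₀ p n : ℤ} (hp : p₀ = p - j)
    (hn : n₀ = n - j) (x : (L.page 1).X p₀ n₀) :
    (((L.page 0).cast hp hn (L.w 0 p₀ n₀ x), 0,
      -(L.sIter j p₀ n₀ p n (by omega) (by omega) x)) : L.ShriekPre j p n) ∈
      L.shriekRel j p n := by
  subst hp hn
  exact Submodule.mem_sup_left ⟨x, rfl⟩

theorem shriekRel₂_mem (L : TrLWB.{u, v} R 0) (j : ℕ) {p₀ n₀ p₁ n₁ p n : ℤ} (hp : p₀ = p + 1)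
    (hn : n₀ = n) (hp₁ : p₁ = p₀ + j) (hn₁ : n₁ = n₀ + j) (x : (L.page 1).X p₀ n₀) :
    ((0, (L.page 0).cast hp hn (L.w 0 p₀ n₀ x),
      -((L.page (j + 1)).d p₁ n₁ p n (by push_cast; omega) (by push_cast; omega)
        (L.sIter j p₀ n₀ p₁ n₁ hp₁ hn₁ x))) : L.ShriekPre j p n) ∈
      L.shriekRel j p n := by
  subst hp hn hp₁ hn₁
  exact Submodule.mem_sup_right ⟨x, rfl⟩

theorem shriekRel_le (L : TrLWB.{u, v} R 0) (j : ℕ) {p n : ℤ}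
    (P : Submodule R (L.ShriekPre j p n))
    (h₁ : ∀ x, L.shriekRel₁ j p n x ∈ P) (h₂ : ∀ x, L.shriekRel₂ j p n x ∈ P) :
    L.shriekRel j p n ≤ P := by
  refine sup_le ?_ ?_
  · rintro _ ⟨x, rfl⟩
    exact h₁ x
  · rintro _ ⟨x, rfl⟩
    exact h₂ x

theorem shriekRel_le_d (L : TrLWB.{u, v} R 0) (j : ℕ) (p n p' n' : ℤ)
    (hp : p' = p - ((j + 1 : ℕ) : ℤ)) (hn : n' = n + 1 - ((j + 1 : ℕ) : ℤ)) :
    L.shriekRel j p n ≤ (L.shriekRel j p' n').comap (L.shriekPreD j p n p' n' hp hn) := by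
  refine L.shriekRel_le j _ (fun x => ?_) (fun x => ?_)
  · have h := L.shriekRel₂_mem j (p₀ := p - j) (n₀ := n - j) (p₁ := p) (n₁ := n) (p := p')
      (n := n') (by push_cast at hp; omega) (by push_cast at hn; omega) (by omega) (by omega) x
    rw [← map_neg] at h
    exact h
  · rw [Submodule.mem_comap, shriekPreD_apply, shriekRel₂_apply]
    rw [map_neg, (L.page (j + 1)).d_comp_d, map_zero, neg_zero]
    exact Submodule.zero_mem _

theorem shriekRel_le_w (L : TrLWB.{u, v} R 0) (j : ℕ) (p n : ℤ) :
    L.shriekRel (j + 1) p n ≤ (L.shriekRel j p n).comap (L.shriekPreW j p n) := by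
  refine L.shriekRel_le (j + 1) _ (fun x => ?_) (fun x => ?_)
  · rw [Submodule.mem_comap, shriekPreW_apply, shriekRel₁_apply]
    have h : L.w (j + 1) p n (L.sIter (j + 1) (p - ((j + 1 : ℕ) : ℤ)) (n - ((j + 1 : ℕ) : ℤ)) p n
        (by omega) (by omega) x) = 0 := L.w_s _ _ _ _ _ _ _ _
    rw [map_neg, h, neg_zero]
    exact Submodule.zero_mem _
  · have h := L.shriekRel₂_mem j (p₀ := p + 1) (n₀ := n) (p₁ := p + 1 + j) (n₁ := n + j)
      (p := p) (n := n) rfl rfl rfl rfl x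
    rw [Submodule.mem_comap, shriekPreW_apply, shriekRel₂_apply, map_neg,
      L.sIter_succ j (p + 1) n (p + 1 + j) (n + j) _ _ rfl rfl (by push_cast; omega)
      (by push_cast; omega), L.w_d_s]
    exact h

theorem shriekRel_le_s (L : TrLWB.{u, v} R 0) (j : ℕ) (p n p' n' : ℤ) (hp : p' = p + 1)
    (hn : n' = n + 1) :
    L.shriekRel j p n ≤
      (L.shriekRel (j + 1) p' n').comap (L.shriekPreS j p n p' n' hp hn) := by
  refine L.shriekRel_le j _ (fun x => ?_) (fun x => ?_)
  · have h := L.shriekRel₁_mem (j + 1) (p₀ := p - j) (n₀ := n - j) (p := p') (n := n')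
      (by push_cast; omega) (by push_cast; omega) x
    rw [L.sIter_succ j (p - j) (n - j) p n p' n' (by omega) (by omega) hp hn, ← map_neg] at h
    exact h
  · rw [Submodule.mem_comap, shriekPreS_apply, shriekRel₂_apply, map_neg,
      ← L.w_d_s (j + 1) (p + 1 + j) (n + j) (p + 1 + j + 1) (n + j + 1) p n rfl rfl
        (by push_cast; omega) (by push_cast; omega), L.s_w, map_zero, neg_zero]
    exact Submodule.zero_mem _

/-- The page `j + 1` of `𝒲_!(L)`. -/
noncomputable def shriekPage (L : TrLWB.{u, v} R 0) (j : ℕ) :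
    BigradedComplex.{u, v} R (j + 1) where
  X p n := L.ShriekPre j p n ⧸ L.shriekRel j p n
  d p n p' n' hp hn := Submodule.mapQ _ _ (L.shriekPreD j p n p' n' hp hn)
    (L.shriekRel_le_d j p n p' n' hp hn)
  d_comp_d p n p' n' p'' n'' hp hn hp' hn' x := by
    obtain ⟨x, rfl⟩ := Submodule.Quotient.mk_surjective _ x
    rw [Submodule.mapQ_apply, Submodule.mapQ_apply, shriekPreD_apply, shriekPreD_apply,
      (L.page (j + 1)).d_comp_d, map_zero]
    rfl

/-- The class of a triple `(a, b, c)`. -/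
noncomputable def shriekMk (L : TrLWB.{u, v} R 0) (j : ℕ) (p n : ℤ) :
    L.ShriekPre j p n →ₗ[R] (L.shriekPage j).X p n :=
  (L.shriekRel j p n).mkQ

theorem shriekMk_surjective (L : TrLWB.{u, v} R 0) (j : ℕ) (p n : ℤ) :
    Function.Surjective (L.shriekMk j p n) :=
  Submodule.mkQ_surjective _

/-- The witness map of `𝒲_!(L)`. -/
noncomputable def shriekW (L : TrLWB.{u, v} R 0) (j : ℕ) (p n : ℤ) :
    (L.shriekPage (j + 1)).X p n →ₗ[R] (L.shriekPage j).X p n :=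
  Submodule.mapQ _ _ (L.shriekPreW j p n) (L.shriekRel_le_w j p n)

/-- The degeneracy map of `𝒲_!(L)`. -/
noncomputable def shriekS (L : TrLWB.{u, v} R 0) (j : ℕ) (p n p' n' : ℤ) (hp : p' = p + 1)
    (hn : n' = n + 1) : (L.shriekPage j).X p n →ₗ[R] (L.shriekPage (j + 1)).X p' n' :=
  Submodule.mapQ _ _ (L.shriekPreS j p n p' n' hp hn) (L.shriekRel_le_s j p n p' n' hp hn)

theorem shriekPage_d_mk (L : TrLWB.{u, v} R 0) (j : ℕ) (p n p' n' : ℤ)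
    (hp : p' = p - ((j + 1 : ℕ) : ℤ)) (hn : n' = n + 1 - ((j + 1 : ℕ) : ℤ))
    (z : L.ShriekPre j p n) : (L.shriekPage j).d p n p' n' hp hn (L.shriekMk j p n z) =
      L.shriekMk j p' n' (L.shriekPreD j p n p' n' hp hn z) := rfl

theorem shriekW_mk (L : TrLWB.{u, v} R 0) (j : ℕ) (p n : ℤ) (z : L.ShriekPre (j + 1) p n) :
    L.shriekW j p n (L.shriekMk (j + 1) p n z) = L.shriekMk j p n (L.shriekPreW j p n z) := rfl

theorem shriekS_mk (L : TrLWB.{u, v} R 0) (j : ℕ) (p n p' n' : ℤ) (hp : p' = p + 1)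
    (hn : n' = n + 1) (z : L.ShriekPre j p n) :
    L.shriekS j p n p' n' hp hn (L.shriekMk j p n z) =
      L.shriekMk (j + 1) p' n' (L.shriekPreS j p n p' n' hp hn z) := rfl

theorem shriek_w_d_s (L : TrLWB.{u, v} R 0) (j : ℕ) (p n p₁ n₁ p' n' : ℤ) (hp : p₁ = p + 1)
    (hn : n₁ = n + 1) (hp' : p' = p₁ - ((j + 1 + 1 : ℕ) : ℤ))
    (hn' : n' = n₁ + 1 - ((j + 1 + 1 : ℕ) : ℤ)) (z : (L.shriekPage j).X p n) :
    L.shriekW j p' n' ((L.shriekPage (j + 1)).d p₁ n₁ p' n' hp' hn'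
      (L.shriekS j p n p₁ n₁ hp hn z)) =
      (L.shriekPage j).d p n p' n' (by push_cast at *; omega) (by push_cast at *; omega) z := by
  obtain ⟨z, rfl⟩ := L.shriekMk_surjective j p n z
  rw [shriekS_mk, shriekPage_d_mk, shriekW_mk, shriekPage_d_mk, shriekPreW_apply,
    shriekPreD_apply, shriekPreS_apply, shriekPreD_apply]
  have h := L.w_d_s (j + 1) p n p₁ n₁ p' n' hp hn hp' hn' z.2.2
  rw [h, BigradedComplex.cast_cast]

/-- The truncated linear witness book `𝒲_!(L)`: its page `j + 1` consists of the triples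
`(a, b, c)` in `L_0^{p-j,n-j} ⊕ L_0^{p+1,n} ⊕ L_{j+1}^{p,n}`, modulo the relations
`(0, 0, s^j x) ∼ (w x, 0, 0)` and `(0, 0, d s^j x) ∼ (0, w x, 0)` for `x` in `L_1`. -/
noncomputable def shriekObj (L : TrLWB.{u, v} R 0) : TrLWB.{u, v} R 1 where
  page := L.shriekPage
  w := L.shriekW
  s := L.shriekS
  w_s j p n p' n' hp hn z := by
    obtain ⟨z, rfl⟩ := L.shriekMk_surjective j p n z
    rw [shriekS_mk, shriekW_mk, shriekPreW_apply, shriekPreS_apply, L.w_s]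
    exact map_zero (L.shriekMk j p' n')
  s_w j p n p' n' hp hn z := by
    obtain ⟨z, rfl⟩ := L.shriekMk_surjective (j + 1) p n z
    rw [shriekW_mk, shriekS_mk, shriekPreW_apply, shriekPreS_apply, L.s_w, map_zero]
    exact map_zero (L.shriekMk (j + 1) p' n')
  w_d_s := L.shriek_w_d_s

/-- The map induced by a morphism on triples. -/
noncomputable def Hom.shriekPre {L M : TrLWB.{u, v} R 0} (f : Hom L M) (j : ℕ) (p n : ℤ) :
    L.ShriekPre j p n →ₗ[R] M.ShriekPre j p n :=
  LinearMap.prodMap ((f.f 0).f _ _) (LinearMap.prodMap ((f.f 0).f _ _) ((f.f (j + 1)).f _ _))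

theorem Hom.shriekPre_apply {L M : TrLWB.{u, v} R 0} (f : Hom L M) (j : ℕ) (p n : ℤ)
    (z : L.ShriekPre j p n) : f.shriekPre j p n z =
      ((f.f 0).f _ _ z.1, (f.f 0).f _ _ z.2.1, (f.f (j + 1)).f _ _ z.2.2) := rfl

theorem Hom.shriekRel_le {L M : TrLWB.{u, v} R 0} (f : Hom L M) (j : ℕ) (p n : ℤ) :
    L.shriekRel j p n ≤ (M.shriekRel j p n).comap (f.shriekPre j p n) := by
  refine L.shriekRel_le j _ (fun x => ?_) (fun x => ?_)
  · refine Submodule.mem_sup_left ⟨(f.f 1).f _ _ x, ?_⟩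
    rw [shriekPre_apply, shriekRel₁_apply, shriekRel₁_apply, map_neg, map_zero, f.sIter_comm,
      f.comm_w]
  · refine Submodule.mem_sup_right ⟨(f.f 1).f _ _ x, ?_⟩
    rw [shriekPre_apply, shriekRel₂_apply, shriekRel₂_apply, map_neg, map_zero,
      (f.f (j + 1)).comm, f.sIter_comm, f.comm_w]

/-- The morphism induced by a morphism of linear witness books. -/
noncomputable def Hom.shriekHom {L M : TrLWB.{u, v} R 0} (f : Hom L M) :
    Hom L.shriekObj M.shriekObj where
  f j :=
    { f := fun p n => Submodule.mapQ _ _ (f.shriekPre j p n) (f.shriekRel_le j p n)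
      comm := fun p n p' n' hp hn x => by
        obtain ⟨x, rfl⟩ := L.shriekMk_surjective j p n x
        refine congrArg (M.shriekMk j p' n')
          (?_ : f.shriekPre j p' n' (L.shriekPreD j p n p' n' hp hn x) =
            M.shriekPreD j p n p' n' hp hn (f.shriekPre j p n x))
        have h := (f.f (j + 1)).comm p n p' n' hp hn x.2.2
        rw [shriekPre_apply, shriekPre_apply, shriekPreD_apply, shriekPreD_apply, map_zero,
          (f.f 0).map_cast, h] }
  comm_w j p n x := by
    obtain ⟨x, rfl⟩ := L.shriekMk_surjective (j + 1) p n x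
    refine congrArg (M.shriekMk j p n)
      (?_ : f.shriekPre j p n (L.shriekPreW j p n x) =
        M.shriekPreW j p n (f.shriekPre (j + 1) p n x))
    rw [shriekPre_apply, shriekPre_apply, shriekPreW_apply, shriekPreW_apply, map_zero, f.comm_w]
  comm_s j p n p' n' hp hn x := by
    obtain ⟨x, rfl⟩ := L.shriekMk_surjective j p n x
    refine congrArg (M.shriekMk (j + 1) p' n')
      (?_ : f.shriekPre (j + 1) p' n' (L.shriekPreS j p n p' n' hp hn x) =
        M.shriekPreS j p n p' n' hp hn (f.shriekPre j p n x))
    rw [shriekPre_apply, shriekPre_apply, shriekPreS_apply, shriekPreS_apply, map_zero,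
      (f.f 0).map_cast, f.comm_s]

end TrLWB

/-- The functor `𝒲_! : LWB ⥤ tr_{≥ 1} LWB`, the leftmost functor in the chain of adjoints
`𝒲_! ⊣ ℱ ⊣ 𝒰` where `𝒰 : LWB ⥤ tr_{≥ 1} LWB` forgets the page `0`. -/
noncomputable def wShriek (R : Type u) [CommRing R] : LWB.{u, v} R ⥤ TrLWB.{u, v} R 1 where
  obj L := L.shriekObj
  map f := TrLWB.Hom.shriekHom f
  map_id L := by
    refine TrLWB.Hom.ext (funext fun i => BigradedComplex.Hom.ext (funext fun p =>
      funext fun n => LinearMap.ext fun x => ?_))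
    obtain ⟨x, rfl⟩ := L.shriekMk_surjective i p n x
    rfl
  map_comp {L M N} f g := by
    refine TrLWB.Hom.ext (funext fun i => BigradedComplex.Hom.ext (funext fun p =>
      funext fun n => LinearMap.ext fun x => ?_))
    obtain ⟨x, rfl⟩ := L.shriekMk_surjective i p n x
    rfl

/-- The functor `LDec = 𝒯⁻¹ ∘ 𝒬_{≥ 1} ∘ 𝒲_! ∘ 𝒩` on extended spectral sequences. -/
noncomputable def LDec (R : Type u) [CommRing R] : ESpSe.{u, v} R ⥤ ESpSe.{u, v} R :=
  nerve R ⋙ wShriek R ⋙ degenQuotient R 1 ⋙ untranslate R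

/-- The element `(x; d x)` of `𝒩(X)_0`. -/
def TrESpSe.nerveZero {R : Type u} [CommRing R] (X : ESpSe.{u, v} R) {p n : ℤ}
    (x : (X.page 0).X p n) : X.nerveModule 0 p n :=
  ⟨(fun i => Fin.cases (motive := fun i : Fin 1 => (X.page i).X p n) x (fun j => j.elim0) i,
    fun i => Fin.cases (motive := fun i : Fin 1 => (X.page i).X (p - (0 : ℕ)) (n + 1 - (0 : ℕ)))
      ((X.page 0).d p n _ _ rfl rfl x) (fun j => j.elim0) i),
    fun _ hi => absurd hi (Nat.not_lt_zero _), fun _ hi => absurd hi (Nat.not_lt_zero _), rfl⟩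

namespace LDec

variable {R : Type u} [CommRing R]

/-- The class in the page `j` of `LDec(X)` of a triple `(a, b, c)` in
`𝒩(X)_0 ⊕ 𝒩(X)_0 ⊕ 𝒩(X)_{j+1}`. -/
noncomputable def mk (X : ESpSe.{u, v} R) (j : ℕ) (p n : ℤ)
    (a : X.nerveModule 0 (2 * p - n - j) (p - j)) (b : X.nerveModule 0 (2 * p - n + 1) p)
    (c : X.nerveModule (j + 1) (2 * p - n) p) : (((LDec R).obj X).page j).X p n :=
  X.nerveObj.shriekObj.quotMk j (2 * p - n) p (X.nerveObj.shriekMk j (2 * p - n) p (a, b, c))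

/-- The class in the page `0` of `LDec(X)` of a pair `(a, b)` in `X_0 ⊕ X_0`. -/
noncomputable def ofPair (X : ESpSe.{u, v} R) (p n : ℤ) (a : (X.page 0).X (2 * p - n) p)
    (b : (X.page 0).X (2 * p - n + 1) p) : (((LDec R).obj X).page 0).X p n :=
  mk X 0 p n (X.nerveZero ((X.page 0).cast (by simp) (by simp) a)) (X.nerveZero b) 0

/-- The class in the page `j` of `LDec(X)` of an element of `𝒩(X)_{j+1}`. -/
noncomputable def ofNerve (X : ESpSe.{u, v} R) (j : ℕ) (p n : ℤ)
    (c : X.nerveModule (j + 1) (2 * p - n) p) : (((LDec R).obj X).page j).X p n :=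
  mk X j p n 0 0 c

end LDec

/-! ### Filtered complexes and their spectral sequences -/

/-- A filtered complex: a cochain complex with an increasing filtration
`… ≤ F_{p-1} ≤ F_p ≤ …` by subcomplexes. -/
structure FilteredComplex (R : Type u) [CommRing R] where
  C : CochainComplex (ModuleCat.{v} R) ℤ
  F : ℤ → ∀ n : ℤ, Submodule R (C.X n)
  mono : ∀ p n, F (p - 1) n ≤ F p n
  d_mem : ∀ (p n n' : ℤ) (x : C.X n), x ∈ F p n → (C.d n n').hom x ∈ F p n'

namespace FilteredComplex

variable {R : Type u} [CommRing R]

/-- Morphisms: chain maps preserving the filtrations. -/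
@[ext] structure Hom (A B : FilteredComplex.{u, v} R) where
  hom : A.C ⟶ B.C
  map_mem : ∀ (p n : ℤ) (x : A.C.X n), x ∈ A.F p n → (hom.f n).hom x ∈ B.F p n

instance : Category (FilteredComplex.{u, v} R) where
  Hom := Hom
  id A := { hom := 𝟙 A.C, map_mem := fun _ _ _ hx => hx }
  comp f g :=
    { hom := f.hom ≫ g.hom
      map_mem := fun p n x hx => g.map_mem p n _ (f.map_mem p n x hx) }
  id_comp f := Hom.ext (Category.id_comp f.hom)
  comp_id f := Hom.ext (Category.comp_id f.hom)
  assoc f g h := Hom.ext (Category.assoc f.hom g.hom h.hom)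

theorem mono_le (A : FilteredComplex.{u, v} R) {p q : ℤ} (h : p ≤ q) (n : ℤ) :
    A.F p n ≤ A.F q n := by
  obtain ⟨k, rfl⟩ := Int.le.dest h
  induction k with
  | zero => simp
  | succ k ih =>
    refine (ih (by omega)).trans ?_
    have h := A.mono (p + ((k + 1 : ℕ) : ℤ)) n
    rwa [show p + ((k + 1 : ℕ) : ℤ) - 1 = p + (k : ℤ) by push_cast; omega] at h

theorem d_d (A : FilteredComplex.{u, v} R) (n n' n'' : ℤ) (x : A.C.X n) :
    (A.C.d n' n'').hom ((A.C.d n n').hom x) = 0 := by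
  have h := A.C.d_comp_d n n' n''
  exact congrArg (fun f => f.hom x) h

theorem Hom.map_d {A B : FilteredComplex.{u, v} R} (f : Hom A B) (n n' : ℤ) (x : A.C.X n) :
    (f.hom.f n').hom ((A.C.d n n').hom x) = (B.C.d n n').hom ((f.hom.f n).hom x) := by
  have h := f.hom.comm n n'
  exact (congrArg (fun f => f.hom x) h).symm

/-- The `r`-cycles `Z_r = F_p C^m ∩ d⁻¹(F_{p-r} C^{m+1})`, in cohomological degree `m`. -/
def Z (A : FilteredComplex.{u, v} R) (r : ℕ) (p m : ℤ) : Submodule R (A.C.X m) :=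
  A.F p m ⊓ (A.F (p - r) (m + 1)).comap (A.C.d m (m + 1)).hom

/-- The `r`-boundaries, in cohomological degree `m`: `B_0 = F_{p-1} C^m` and
`B_{r+1} = Z_r^{p-1} + d Z_r^{p+r}`. -/
def B (A : FilteredComplex.{u, v} R) : ℕ → ℤ → ∀ m : ℤ, Submodule R (A.C.X m)
  | 0, p, m => A.F (p - 1) m
  | r + 1, p, m => A.Z r (p - 1) m ⊔ (A.Z r (p + r) (m - 1)).map (A.C.d (m - 1) m).hom

theorem mem_Z_iff (A : FilteredComplex.{u, v} R) (r : ℕ) (p m m' : ℤ) (hm : m' = m + 1)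
    (x : A.C.X m) : x ∈ A.Z r p m ↔ x ∈ A.F p m ∧ (A.C.d m m').hom x ∈ A.F (p - r) m' := by
  subst hm
  rfl

theorem F_le_Z_zero (A : FilteredComplex.{u, v} R) (p m : ℤ) : A.F p m ≤ A.Z 0 p m := by
  intro x hx
  refine (A.mem_Z_iff 0 p m (m + 1) rfl x).2 ⟨hx, ?_⟩
  simpa using A.d_mem p m (m + 1) x hx

theorem mem_B_succ_iff (A : FilteredComplex.{u, v} R) (r : ℕ) (p m m₀ : ℤ) (hm : m = m₀ + 1)
    (x : A.C.X m) : x ∈ A.B (r + 1) p m ↔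
      ∃ y ∈ A.Z r (p - 1) m, ∃ z ∈ A.Z r (p + r) m₀, y + (A.C.d m₀ m).hom z = x := by
  obtain rfl : m₀ = m - 1 := by omega
  simp [B, Submodule.mem_sup]

theorem Z_le_B (A : FilteredComplex.{u, v} R) (r : ℕ) (p m : ℤ) :
    A.Z r (p - 1) m ≤ A.B r p m := by
  cases r with
  | zero => exact inf_le_left
  | succ r =>
    intro x hx
    rw [mem_Z_iff _ _ _ _ _ rfl] at hx
    refine Submodule.mem_sup_left ?_
    rw [mem_Z_iff _ _ _ _ _ rfl]
    exact ⟨hx.1, A.mono_le (by push_cast; omega) _ hx.2⟩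

theorem B_le_Z (A : FilteredComplex.{u, v} R) (r : ℕ) (p m : ℤ) : A.B r p m ≤ A.Z r p m := by
  intro x hx
  cases r with
  | zero =>
    have hx' := A.mono_le (show p - 1 ≤ p by omega) _ hx
    rw [mem_Z_iff _ _ _ _ _ rfl]
    exact ⟨hx', by simpa using A.d_mem p m (m + 1) x hx'⟩
  | succ r =>
    obtain ⟨y, hy, z, hz, rfl⟩ := (A.mem_B_succ_iff r p m (m - 1) (by omega) x).1 hx
    rw [mem_Z_iff _ _ _ _ m (by omega)] at hz
    rw [mem_Z_iff _ _ _ _ _ rfl] at hy ⊢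
    rw [map_add, A.d_d, add_zero]
    refine ⟨Submodule.add_mem _ (A.mono_le (by omega) _ hy.1) ?_,
      A.mono_le (by push_cast; omega) _ hy.2⟩
    exact A.mono_le (by omega) _ hz.2

theorem d_mem_Z (A : FilteredComplex.{u, v} R) (r : ℕ) {p m p' m' : ℤ} (hp : p' = p - r)
    (hm : m' = m + 1) (x : A.C.X m) (hx : x ∈ A.Z r p m) : (A.C.d m m').hom x ∈ A.Z r p' m' := by
  subst hp hm
  rw [mem_Z_iff _ _ _ _ _ rfl] at hx ⊢
  rw [A.d_d]
  exact ⟨hx.2, Submodule.zero_mem _⟩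

theorem d_mem_B (A : FilteredComplex.{u, v} R) (r : ℕ) {p m p' m' : ℤ} (hp : p' = p - r)
    (hm : m' = m + 1) (x : A.C.X m) (hx : x ∈ A.B r p m) : (A.C.d m m').hom x ∈ A.B r p' m' := by
  subst hp hm
  cases r with
  | zero => simpa [B] using A.d_mem _ m (m + 1) x hx
  | succ r =>
    obtain ⟨y, hy, z, hz, rfl⟩ := (A.mem_B_succ_iff r p m (m - 1) (by omega) x).1 hx
    rw [mem_B_succ_iff _ _ _ _ m rfl]
    refine ⟨0, Submodule.zero_mem _, y, ?_, ?_⟩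
    · rw [show p - ((r + 1 : ℕ) : ℤ) + r = p - 1 by push_cast; omega]
      exact hy
    · rw [map_add, A.d_d, add_zero, zero_add]

/-- The `r`-page of the spectral sequence of a filtered complex: `E_r^{p,n} = Z_r / B_r` in
filtration degree `p` and cohomological degree `n - p`, with differential `[a] ↦ [d a]`. -/
def page (A : FilteredComplex.{u, v} R) (r : ℕ) : BigradedComplex.{u, v} R r where
  X p n := A.Z r p (n - p) ⧸ (A.B r p (n - p)).submoduleOf (A.Z r p (n - p))
  d p n p' n' hp hn := Submodule.mapQ _ _
    ((A.C.d (n - p) (n' - p')).hom.restrict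
      (fun x hx => A.d_mem_Z r hp (by omega) x hx))
    (fun x hx => A.d_mem_B r hp (by omega) x.1 hx)
  d_comp_d p n p' n' p'' n'' hp hn hp' hn' x := by
    obtain ⟨x, rfl⟩ := Submodule.Quotient.mk_surjective _ x
    refine (Submodule.Quotient.mk_eq_zero _).2 ?_
    change (A.C.d _ _).hom ((A.C.d _ _).hom x.1) ∈ A.B r p'' (n'' - p'')
    rw [A.d_d]
    exact Submodule.zero_mem _

/-- The class `[a]_r` in the `r`-page of an element of `Z_r` of cohomological degree `m`. -/
def cls (A : FilteredComplex.{u, v} R) (r : ℕ) {p n m : ℤ} (hm : m = n - p) (a : A.C.X m)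
    (ha : a ∈ A.Z r p m) : (A.page r).X p n := by
  subst hm
  exact Submodule.Quotient.mk ⟨a, ha⟩

theorem exists_cls (A : FilteredComplex.{u, v} R) (r : ℕ) {p n m : ℤ} (hm : m = n - p)
    (x : (A.page r).X p n) : ∃ (a : A.C.X m) (ha : a ∈ A.Z r p m), A.cls r hm a ha = x := by
  subst hm
  obtain ⟨x, rfl⟩ := Submodule.Quotient.mk_surjective _ x
  exact ⟨x.1, x.2, rfl⟩

theorem cls_eq_zero_iff (A : FilteredComplex.{u, v} R) (r : ℕ) {p n m : ℤ} (hm : m = n - p)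
    (a : A.C.X m) (ha : a ∈ A.Z r p m) : A.cls r hm a ha = 0 ↔ a ∈ A.B r p m := by
  subst hm
  exact Submodule.Quotient.mk_eq_zero _

theorem cls_sub (A : FilteredComplex.{u, v} R) (r : ℕ) {p n m : ℤ} (hm : m = n - p)
    (a b : A.C.X m) (ha : a ∈ A.Z r p m) (hb : b ∈ A.Z r p m) :
    A.cls r hm a ha - A.cls r hm b hb = A.cls r hm (a - b) (Submodule.sub_mem _ ha hb) := by
  subst hm
  rfl

theorem d_cls (A : FilteredComplex.{u, v} R) (r : ℕ) {p n m p' n' m' : ℤ} (hm : m = n - p)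
    (hp : p' = p - r) (hn : n' = n + 1 - r) (hm' : m' = n' - p') (a : A.C.X m)
    (ha : a ∈ A.Z r p m) : (A.page r).d p n p' n' hp hn (A.cls r hm a ha) =
      A.cls r hm' ((A.C.d m m').hom a) (A.d_mem_Z r hp (by omega) a ha) := by
  subst hm hm'
  rfl

theorem Z_succ_le (A : FilteredComplex.{u, v} R) (r : ℕ) (p m : ℤ) :
    A.Z (r + 1) p m ≤ A.Z r p m := by
  intro x hx
  rw [mem_Z_iff _ _ _ _ _ rfl] at hx ⊢
  exact ⟨hx.1, A.mono_le (by push_cast; omega) _ hx.2⟩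

theorem cls_mem_cycles_iff (A : FilteredComplex.{u, v} R) (r : ℕ) {p n m m' : ℤ}
    (hm : m = n - p) (hm' : m' = m + 1) (a : A.C.X m) (ha : a ∈ A.Z r p m) :
    A.cls r hm a ha ∈ (A.page r).cycles p n ↔ (A.C.d m m').hom a ∈ A.B r (p - r) m' := by
  rw [BigradedComplex.mem_cycles_iff _ (p - r) (n + 1 - r) rfl rfl,
    A.d_cls r hm rfl rfl (m' := m') (by omega), cls_eq_zero_iff]

theorem cls_mem_boundaries_iff (A : FilteredComplex.{u, v} R) (r : ℕ) {p n m m₀ : ℤ}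
    (hm : m = n - p) (hm₀ : m = m₀ + 1) (a : A.C.X m) (ha : a ∈ A.Z r p m) :
    A.cls r hm a ha ∈ (A.page r).boundaries p n ↔
      ∃ y ∈ A.Z r (p + r) m₀, a - (A.C.d m₀ m).hom y ∈ A.B r p m := by
  rw [BigradedComplex.mem_boundaries_iff _ (p + r) (n - 1 + r) (by omega) (by omega)]
  constructor
  · rintro ⟨y, hy⟩
    obtain ⟨y, hy', rfl⟩ := A.exists_cls r (m := m₀) (by omega) y
    refine ⟨y, hy', ?_⟩
    rw [A.d_cls r _ _ _ hm, eq_comm, ← sub_eq_zero, A.cls_sub, cls_eq_zero_iff] at hy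
    exact hy
  · rintro ⟨y, hy, h⟩
    refine ⟨A.cls r (by omega) y hy, ?_⟩
    rw [A.d_cls r _ _ _ hm, eq_comm, ← sub_eq_zero, A.cls_sub, cls_eq_zero_iff]
    exact h

theorem mkQ_mem_cycles (A : FilteredComplex.{u, v} R) (r : ℕ) (p n : ℤ)
    (a : A.Z (r + 1) p (n - p)) :
    A.cls r rfl a.1 (A.Z_succ_le r _ _ a.2) ∈ (A.page r).cycles p n := by
  rw [A.cls_mem_cycles_iff r rfl rfl]
  have h := a.2
  rw [mem_Z_iff _ _ _ _ _ rfl] at h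
  refine A.Z_le_B r _ _ ?_
  rw [mem_Z_iff _ _ _ _ _ rfl, A.d_d]
  exact ⟨A.mono_le (by push_cast; omega) _ h.2, Submodule.zero_mem _⟩

/-- The map `Z_{r+1} → H(E_r)`, `a ↦ [[a]_r]`. -/
def preφ (A : FilteredComplex.{u, v} R) (r : ℕ) (p n : ℤ) :
    A.Z (r + 1) p (n - p) →ₗ[R] (A.page r).H p n :=
  ((A.page r).cls p n).comp
    (LinearMap.codRestrict _
      (((A.B r p (n - p)).submoduleOf (A.Z r p (n - p))).mkQ.comp
        (Submodule.inclusion (A.Z_succ_le r p (n - p))))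
      (A.mkQ_mem_cycles r p n))

theorem preφ_apply (A : FilteredComplex.{u, v} R) (r : ℕ) (p n : ℤ)
    (a : A.Z (r + 1) p (n - p)) : A.preφ r p n a = (A.page r).cls p n
      ⟨A.cls r rfl a.1 (A.Z_succ_le r _ _ a.2), A.mkQ_mem_cycles r p n a⟩ := rfl

theorem preφ_eq_zero_iff (A : FilteredComplex.{u, v} R) (r : ℕ) (p n : ℤ)
    (a : A.Z (r + 1) p (n - p)) :
    A.preφ r p n a = 0 ↔ a ∈ (A.B (r + 1) p (n - p)).submoduleOf (A.Z (r + 1) p (n - p)) := by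
  rw [preφ_apply, BigradedComplex.cls_eq_zero_iff,
    A.cls_mem_boundaries_iff r (m₀ := n - p - 1) rfl (by omega)]
  have ha := a.2
  rw [mem_Z_iff _ _ _ _ _ rfl] at ha
  change _ ↔ a.1 ∈ A.B (r + 1) p (n - p)
  rw [mem_B_succ_iff A r p (n - p) (n - p - 1) (by omega)]
  constructor
  · rintro ⟨y, hy, h⟩
    cases r with
    | zero =>
      refine ⟨a.1 - (A.C.d (n - p - 1) (n - p)).hom y, ?_, y, hy, by simp⟩
      rw [mem_Z_iff _ _ _ _ _ rfl, map_sub, A.d_d, sub_zero]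
      exact ⟨h, by simpa using ha.2⟩
    | succ r =>
      obtain ⟨b, hb, z, hz, e⟩ := (A.mem_B_succ_iff r _ _ (n - p - 1) (by omega) _).1 h
      have e' : a.1 = b + (A.C.d (n - p - 1) (n - p)).hom (z + y) := by
        rw [map_add, ← add_assoc, e]
        abel
      rw [mem_Z_iff _ _ _ _ _ rfl] at hb
      rw [mem_Z_iff _ _ _ _ (n - p) (by omega)] at hz
      refine ⟨b, ?_, z + y, Submodule.add_mem _ ?_ hy, e'.symm⟩
      · rw [mem_Z_iff _ _ _ _ _ rfl]
        refine ⟨hb.1, ?_⟩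
        rw [e', map_add (A.C.d (n - p) (n - p + 1)).hom, A.d_d, add_zero] at ha
        exact A.mono_le (by push_cast; omega) _ ha.2
      · rw [mem_Z_iff _ _ _ _ (n - p) (by omega)]
        exact ⟨A.mono_le (by push_cast; omega) _ hz.1, A.mono_le (by push_cast; omega) _ hz.2⟩
  · rintro ⟨b, hb, y, hy, e⟩
    refine ⟨y, hy, A.Z_le_B r _ _ ?_⟩
    rw [← e]
    simpa using hb

theorem preφ_surjective (A : FilteredComplex.{u, v} R) (r : ℕ) (p n : ℤ) :
    Function.Surjective (A.preφ r p n) := by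
  intro ξ
  obtain ⟨⟨x, hx⟩, rfl⟩ := (A.page r).cls_surjective p n ξ
  obtain ⟨a, ha, rfl⟩ := A.exists_cls r rfl x
  have h := (A.cls_mem_cycles_iff r rfl rfl a ha).1 hx
  have key : ∃ y ∈ A.B r p (n - p), a - y ∈ A.Z (r + 1) p (n - p) := by
    have ha' := (A.mem_Z_iff _ _ _ _ rfl _).1 ha
    cases r with
    | zero =>
      refine ⟨0, Submodule.zero_mem _, ?_⟩
      rw [sub_zero, mem_Z_iff _ _ _ _ _ rfl]
      refine ⟨ha'.1, A.mono_le (by push_cast; omega) _ h⟩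
    | succ r =>
      obtain ⟨b, hb, y, hy, e⟩ := (A.mem_B_succ_iff r _ _ (n - p) rfl _).1 h
      rw [show p - ((r + 1 : ℕ) : ℤ) + r = p - 1 by push_cast; omega,
        mem_Z_iff _ _ _ _ _ rfl] at hy
      rw [mem_Z_iff _ _ _ _ _ rfl] at hb
      have hdy : (A.C.d (n - p) (n - p + 1)).hom (a - y) = b := by
        rw [map_sub, ← e]
        abel
      refine ⟨y, ?_, ?_⟩
      · exact Submodule.mem_sup_left ((A.mem_Z_iff _ _ _ _ rfl _).2 hy)
      · rw [mem_Z_iff _ _ _ _ _ rfl, hdy]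
        exact ⟨Submodule.sub_mem _ ha'.1 (A.mono_le (by omega) _ hy.1),
          A.mono_le (by push_cast; omega) _ hb.1⟩
  obtain ⟨y, hy, hay⟩ := key
  refine ⟨⟨a - y, hay⟩, ?_⟩
  rw [preφ_apply]
  refine congrArg _ (Subtype.ext ?_)
  change A.cls r rfl (a - y) _ = A.cls r rfl a ha
  rw [← sub_eq_zero, A.cls_sub, cls_eq_zero_iff, sub_sub_cancel_left]
  exact Submodule.neg_mem _ hy

/-- The spectral sequence of a filtered complex, with `φ [a]_{r+1} = [[a]_r]`. -/
def toESpSe (A : FilteredComplex.{u, v} R) : ESpSe.{u, v} R where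
  page := A.page
  φ r p n := Submodule.liftQ _ (A.preφ r p n)
    (fun a ha => LinearMap.mem_ker.2 ((A.preφ_eq_zero_iff r p n a).2 ha))

theorem toESpSe_isSpectralSequence (A : FilteredComplex.{u, v} R) :
    TrESpSe.IsSpectralSequence A.toESpSe := by
  intro r p n
  constructor
  · refine (injective_iff_map_eq_zero _).2 fun x hx => ?_
    obtain ⟨x, rfl⟩ := Submodule.Quotient.mk_surjective _ x
    exact (Submodule.Quotient.mk_eq_zero _).2 ((A.preφ_eq_zero_iff r p n x).1 hx)
  · intro ξ
    obtain ⟨a, rfl⟩ := A.preφ_surjective r p n ξ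
    exact ⟨Submodule.Quotient.mk a, rfl⟩

namespace Hom

variable {A B : FilteredComplex.{u, v} R}

theorem map_Z (f : Hom A B) (r : ℕ) (p m : ℤ) (x : A.C.X m) (hx : x ∈ A.Z r p m) :
    (f.hom.f m).hom x ∈ B.Z r p m := by
  rw [mem_Z_iff _ _ _ _ _ rfl] at hx ⊢
  rw [← f.map_d]
  exact ⟨f.map_mem _ _ _ hx.1, f.map_mem _ _ _ hx.2⟩

theorem map_B (f : Hom A B) (r : ℕ) (p m : ℤ) (x : A.C.X m) (hx : x ∈ A.B r p m) :
    (f.hom.f m).hom x ∈ B.B r p m := by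
  cases r with
  | zero => exact f.map_mem _ _ _ hx
  | succ r =>
    obtain ⟨y, hy, z, hz, rfl⟩ := (A.mem_B_succ_iff r p m (m - 1) (by omega) x).1 hx
    rw [mem_B_succ_iff _ _ _ _ (m - 1) (by omega)]
    exact ⟨_, f.map_Z _ _ _ _ hy, _, f.map_Z _ _ _ _ hz, by rw [map_add, f.map_d]⟩

/-- The morphism of spectral sequences induced by a morphism of filtered complexes. -/
def toESpSe (f : Hom A B) : TrESpSe.Hom A.toESpSe B.toESpSe where
  f r :=
    { f := fun p n => Submodule.mapQ _ _
        ((f.hom.f (n - p)).hom.restrict (fun x hx => f.map_Z r p (n - p) x hx))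
        (fun x hx => f.map_B r p (n - p) x.1 hx)
      comm := fun p n p' n' hp hn x => by
        obtain ⟨x, rfl⟩ := Submodule.Quotient.mk_surjective _ x
        refine congrArg Submodule.Quotient.mk (Subtype.ext ?_)
        exact f.map_d _ _ _ }
  comm r p n x := by
    obtain ⟨x, rfl⟩ := Submodule.Quotient.mk_surjective _ x
    rfl

end Hom

/-- Deligne's filtration `(Dec^* F)_p C^n = F_{p-n} C^n + d F_{p-n+1} C^{n-1}`. -/
def decStar (A : FilteredComplex.{u, v} R) : FilteredComplex.{u, v} R where
  C := A.C
  F p n := A.F (p - n) n ⊔ (A.F (p - n + 1) (n - 1)).map (A.C.d (n - 1) n).hom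
  mono p n := sup_le_sup (A.mono_le (by omega) n) (Submodule.map_mono (A.mono_le (by omega) _))
  d_mem p n n' x hx := by
    by_cases hn : n + 1 = n'
    · obtain ⟨y, hy, _, ⟨z, hz, rfl⟩, rfl⟩ := Submodule.mem_sup.1 hx
      rw [map_add, A.d_d, add_zero]
      subst hn
      refine Submodule.mem_sup_right ?_
      have h : ∀ n₀, n₀ = n → (A.C.d n (n + 1)).hom y ∈
          (A.F (p - (n + 1) + 1) n₀).map (A.C.d n₀ (n + 1)).hom := by
        rintro n₀ rfl
        refine ⟨y, ?_, rfl⟩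
        rw [show p - (n₀ + 1) + 1 = p - n₀ by omega]
        exact hy
      exact h _ (by omega)
    · rw [A.C.shape n n' hn]
      exact Submodule.zero_mem _

theorem Hom.map_decStar {A B : FilteredComplex.{u, v} R} (f : Hom A B) (p n : ℤ) (x : A.C.X n)
    (hx : x ∈ A.F (p - n) n ⊔ (A.F (p - n + 1) (n - 1)).map (A.C.d (n - 1) n).hom) :
    (f.hom.f n).hom x ∈ B.F (p - n) n ⊔ (B.F (p - n + 1) (n - 1)).map (B.C.d (n - 1) n).hom := by
  obtain ⟨y, hy, _, ⟨z, hz, rfl⟩, rfl⟩ := Submodule.mem_sup.1 hx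
  rw [map_add, f.map_d]
  exact Submodule.add_mem_sup (f.map_mem _ _ _ hy)
    (Submodule.mem_map_of_mem (f.map_mem _ _ _ hz))

/-- The morphism `Dec^*(f)`, with underlying chain map `f`. -/
def Hom.decStar {A B : FilteredComplex.{u, v} R} (f : Hom A B) : Hom A.decStar B.decStar where
  hom := f.hom
  map_mem := f.map_decStar

end FilteredComplex

/-- Deligne's functor `Dec^*` on filtered complexes. -/
def DecStar (R : Type u) [CommRing R] : FilteredComplex.{u, v} R ⥤ FilteredComplex.{u, v} R where
  obj A := A.decStar
  map f := FilteredComplex.Hom.decStar f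
  map_id _ := rfl
  map_comp _ _ := rfl

/-- The functor `E` from filtered complexes to spectral sequences. -/
def spectralSequence (R : Type u) [CommRing R] : FilteredComplex.{u, v} R ⥤ SpSe.{u, v} R where
  obj A := ⟨A.toESpSe, A.toESpSe_isSpectralSequence⟩
  map f := ObjectProperty.homMk (FilteredComplex.Hom.toESpSe f)
  map_id A := by
    refine ObjectProperty.hom_ext _ (TrESpSe.Hom.ext (funext fun r => BigradedComplex.Hom.ext
      (funext fun p => funext fun n => LinearMap.ext fun x => ?_)))
    obtain ⟨x, rfl⟩ := Submodule.Quotient.mk_surjective _ x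
    rfl
  map_comp f g := by
    refine ObjectProperty.hom_ext _ (TrESpSe.Hom.ext (funext fun r => BigradedComplex.Hom.ext
      (funext fun p => funext fun n => LinearMap.ext fun x => ?_)))
    obtain ⟨x, rfl⟩ := Submodule.Quotient.mk_surjective _ x
    rfl

/-! Fix a bidegree `(p, n)` and put `m = n - p`, `P = 2p - n = p - m`. On page `j` both sides are
quotients of one module of triples `(a, b, c)` with `a ∈ F_{P-j} C^m`, `b ∈ F_{P+1} C^{m-1}` and `c
∈ Z_{j+1}^P` in degree `m`. A triple gives its class in `LDec(E(A))`, and the class of `a + d b + c`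
in `E(Dec^*(A))`. The comparison exists and is bijective because these two maps are onto and have
the same kernel.

For `LDec(E(A))`, surjectivity comes from a concrete description of the nerve. A compatible sequence
in `E(A)` is `([a]_0, …, [a]_r)` for a single `a ∈ Z_r^p` (`exists_clsSeq`). A pair `(x; y)`
likewise comes from one `a`, through `[a]_i` and `[d a]_i` (`exists_nerveMk`), and `a` represents
zero exactly when it lies in `Z_r^{p-1}` (`nerveMk_eq_zero_iff`). So the nerve page is `Z_r^p /
Z_r^{p-1}`, its differential is induced by that of `A`, and `w` and `s` are induced by inclusions.
For `E(Dec^*(A))`, surjectivity is the decomposition `F_{P-j} + d F_{P+1} + Z_{j+1}^P` of the cycles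
(`mem_decStar_Z_iff`).

The kernels agree by `ldecMk_eq_zero_iff`. On a page `j ≥ 1` only `c` matters, and the condition on
both sides is `c ∈ B_{j+1}^P`. In `LDec(E(A))` the degeneracies `s(a, 0, u)` and `d s(b, 0, v)`
absorb `a` and `b` while `u + d v` sweeps out `B_{j+1}^P`; in `E(Dec^*(A))` the summands `F_{P-j}`
and `d F_{P+1}` consist of boundaries (`add_mem_decStar_B_succ_iff`). On page `0` there are no
degeneracies, and the relations of `𝒲_!` are compared directly with `F_{P-1} + d F_P`.

The rule `d(a, b, c) = (0, a, d c)` matches `d(a + d b + c) = d a + d c`, and the entry `a`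
forgotten by the characteristic map is a boundary one page lower. Hence the comparison is a
morphism. As it is bijective on every page and `E(Dec^*(A))` is a spectral sequence, so is
`LDec(E(A))`. -/

theorem BigradedComplex.cls_eq_cls_iff {R : Type u} [CommRing R] {r : ℕ}
    (A : BigradedComplex.{u, v} R r) {p n : ℤ} (x y : A.cycles p n) :
    A.cls p n x = A.cls p n y ↔ (x : A.X p n) - y ∈ A.boundaries p n := by
  rw [← sub_eq_zero, ← map_sub, cls_eq_zero_iff]
  rfl

/-! ### Compatible sequences in the spectral sequence of a filtered complex. -/

namespace FilteredComplex

variable {R : Type u} [CommRing R]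

/-- `Z_r^p` depends only on the two filtration indices `p` and `p - r`, and grows with each of them.
Nearly all later inclusions between cycle modules are instances of this. -/
theorem Z_anti (A : FilteredComplex.{u, v} R) {r r' : ℕ} {p p' m : ℤ} (hp : p ≤ p')
    (hr : p - r ≤ p' - r') : A.Z r p m ≤ A.Z r' p' m := by
  intro x hx
  rw [mem_Z_iff _ _ _ _ _ rfl] at hx ⊢
  exact ⟨A.mono_le hp _ hx.1, A.mono_le hr _ hx.2⟩

theorem Z_le_F (A : FilteredComplex.{u, v} R) (r : ℕ) (p m : ℤ) : A.Z r p m ≤ A.F p m :=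
  inf_le_left

/-- `Z_r^{p-1} ≤ B_i^p` for `i ≤ r + 1`. -/
theorem Z_le_B_of_le (A : FilteredComplex.{u, v} R) {r i : ℕ} (hi : i ≤ r + 1) (p m : ℤ) :
    A.Z r (p - 1) m ≤ A.B i p m := by
  cases i with
  | zero => exact A.Z_le_F _ _ _
  | succ i =>
    exact (A.Z_anti le_rfl (by omega)).trans le_sup_left

/-- `d Z_r ≤ B_i^p` when `r < i`. -/
theorem d_mem_B_of_lt (A : FilteredComplex.{u, v} R) {r i : ℕ} (hi : r < i) {q p m₀ m : ℤ}
    (hq : q = p + r) (hm : m = m₀ + 1) (z : A.C.X m₀) (hz : z ∈ A.Z r q m₀) :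
    (A.C.d m₀ m).hom z ∈ A.B i p m := by
  obtain ⟨i, rfl⟩ : ∃ k, i = k + 1 := ⟨i - 1, by omega⟩
  rw [mem_B_succ_iff _ _ _ _ m₀ hm]
  exact ⟨0, Submodule.zero_mem _, z, A.Z_anti (by omega) (by omega) hz, zero_add _⟩

theorem cls_eq_cls_iff (A : FilteredComplex.{u, v} R) (r : ℕ) {p n m : ℤ} (hm : m = n - p)
    (a b : A.C.X m) (ha : a ∈ A.Z r p m) (hb : b ∈ A.Z r p m) :
    A.cls r hm a ha = A.cls r hm b hb ↔ a - b ∈ A.B r p m := by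
  rw [← sub_eq_zero, A.cls_sub, cls_eq_zero_iff]

theorem cls_add (A : FilteredComplex.{u, v} R) (r : ℕ) {p n m : ℤ} (hm : m = n - p)
    (a b : A.C.X m) (ha : a ∈ A.Z r p m) (hb : b ∈ A.Z r p m) :
    A.cls r hm a ha + A.cls r hm b hb = A.cls r hm (a + b) (Submodule.add_mem _ ha hb) := by
  subst hm
  rfl

theorem smul_cls (A : FilteredComplex.{u, v} R) (r : ℕ) {p n m : ℤ} (hm : m = n - p)
    (k : R) (a : A.C.X m) (ha : a ∈ A.Z r p m) :
    k • A.cls r hm a ha = A.cls r hm (k • a) (Submodule.smul_mem _ k ha) := by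
  subst hm
  rfl

theorem cast_cls (A : FilteredComplex.{u, v} R) (r : ℕ) {p n m p' n' : ℤ} (hp : p = p')
    (hn : n = n') (hm : m = n - p) (a : A.C.X m) (ha : a ∈ A.Z r p m) :
    (A.page r).cast hp hn (A.cls r hm a ha) =
      A.cls r (by omega) a (show a ∈ A.Z r p' m from hp ▸ ha) := by
  subst hp hn
  rfl

theorem toESpSe_φ_cls (A : FilteredComplex.{u, v} R) (r : ℕ) {p n m : ℤ} (hm : m = n - p)
    (a : A.C.X m) (ha : a ∈ A.Z (r + 1) p m)
    (hc : A.cls r hm a (A.Z_succ_le r _ _ ha) ∈ (A.page r).cycles p n) :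
    A.toESpSe.φ r p n (A.cls (r + 1) hm a ha) =
      (A.page r).cls p n ⟨A.cls r hm a (A.Z_succ_le r _ _ ha), hc⟩ := by
  subst hm
  rfl

theorem Hom.toESpSe_cls {A B : FilteredComplex.{u, v} R} (f : Hom A B) (r : ℕ) {p n m : ℤ}
    (hm : m = n - p) (a : A.C.X m) (ha : a ∈ A.Z r p m) :
    (f.toESpSe.f r).f p n (A.cls r hm a ha) = B.cls r hm ((f.hom.f m).hom a)
      (f.map_Z _ _ _ _ ha) := by
  subst hm
  rfl

theorem cls_mem_cycles (A : FilteredComplex.{u, v} R) (r : ℕ) {p n m : ℤ}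
    (hm : m = n - p) (a : A.C.X m) (ha : a ∈ A.Z (r + 1) p m) :
    A.cls r hm a (A.Z_succ_le r _ _ ha) ∈ (A.page r).cycles p n := by
  subst hm
  exact A.mkQ_mem_cycles r p n ⟨a, ha⟩

/-- The compatible sequence `([a]_0, …, [a]_r)` of an `r`-cycle. -/
def clsSeq (A : FilteredComplex.{u, v} R) (r : ℕ) {p n m : ℤ} (hm : m = n - p) (a : A.C.X m)
    (ha : a ∈ A.Z r p m) : ∀ i : Fin (r + 1), (A.toESpSe.page i).X p n :=
  fun i => A.cls i hm a (A.Z_anti le_rfl (by have := i.2; omega) ha)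

theorem clsSeq_mem (A : FilteredComplex.{u, v} R) (r : ℕ) {p n m : ℤ} (hm : m = n - p)
    (a : A.C.X m) (ha : a ∈ A.Z r p m) : A.clsSeq r hm a ha ∈ A.toESpSe.compatible r p n := by
  intro i hi
  have ha' : a ∈ A.Z (i + 1) p m := A.Z_anti le_rfl (by omega) ha
  exact ⟨A.cls_mem_cycles i hm a ha', A.toESpSe_φ_cls i hm a ha' _⟩

theorem clsSeq_congr (A : FilteredComplex.{u, v} R) (r : ℕ) {p n m : ℤ} (hm : m = n - p)
    (a b : A.C.X m) (ha : a ∈ A.Z r p m) (hb : b ∈ A.Z r p m)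
    (h : ∀ i ≤ r, a - b ∈ A.B i p m) :
    A.clsSeq r hm a ha = A.clsSeq r hm b hb :=
  funext fun i => (A.cls_eq_cls_iff i hm a b _ _).2 (h i (by omega))

/-- An element of `B_r` need not lie in the earlier `B_i`, but the obstruction is a single
coboundary. In `w = y + d z` with `y ∈ Z_{r-1}^{p-1}`, the term `y` lies in every `B_i` with `i ≤
r`. Removing `d z` thus makes `w` vanish on all these pages at once, which is what the lifting of
compatible sequences needs. -/
theorem exists_sub_d_mem_B (A : FilteredComplex.{u, v} R) (r : ℕ) {p m m₀ : ℤ} (hm : m = m₀ + 1)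
    (w : A.C.X m) (hw : w ∈ A.B r p m) :
    ∃ z ∈ A.Z r (p + r) m₀, ∀ i ≤ r, w - (A.C.d m₀ m).hom z ∈ A.B i p m := by
  cases r with
  | zero =>
    refine ⟨0, Submodule.zero_mem _, fun i hi => ?_⟩
    obtain rfl : i = 0 := by omega
    simpa using hw
  | succ r =>
    obtain ⟨y, hy, z, hz, rfl⟩ := (A.mem_B_succ_iff r p m m₀ hm w).1 hw
    refine ⟨z, A.Z_anti (by push_cast; omega) (by push_cast; omega) hz, fun i hi => ?_⟩
    rw [add_sub_cancel_right]
    exact A.Z_le_B_of_le hi p m hy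

/-- Every compatible sequence in the spectral sequence of a filtered complex is of the form
`([a]_0, …, [a]_r)`. -/
theorem exists_clsSeq (A : FilteredComplex.{u, v} R) (r : ℕ) {p n m : ℤ} (hm : m = n - p)
    (x : ∀ i : Fin (r + 1), (A.toESpSe.page i).X p n) (hx : x ∈ A.toESpSe.compatible r p n) :
    ∃ (a : A.C.X m) (ha : a ∈ A.Z r p m), A.clsSeq r hm a ha = x := by
  induction r with
  | zero =>
    obtain ⟨a, ha, e⟩ := A.exists_cls 0 hm (x 0)
    refine ⟨a, ha, funext fun i => ?_⟩
    obtain rfl : i = 0 := Fin.fin_one_eq_zero i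
    exact e
  | succ r ih =>
    obtain ⟨a, ha, e⟩ := ih _ (A.toESpSe.compatible_init r x hx)
    have e' : ∀ i (hi : i < r + 1), A.cls i hm a (A.Z_anti le_rfl (by omega) ha) =
        x ⟨i, by omega⟩ := fun i hi => congrFun e ⟨i, hi⟩
    obtain ⟨c, hc, ec⟩ := A.exists_cls (r + 1) hm (x ⟨r + 1, by omega⟩)
    obtain ⟨h₁, h₂⟩ := hx r (by omega)
    -- The representative `c` of the last term agrees with the representative `a` of the earlier
    -- terms only up to a boundary of page `r`.
    have h₃ : A.cls r hm c (A.Z_succ_le r _ _ hc) - A.cls r hm a ha ∈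
        (A.page r).boundaries p n := by
      rw [e' r (by omega)]
      refine ((A.page r).cls_eq_cls_iff ⟨_, A.cls_mem_cycles r hm c hc⟩ ⟨_, h₁⟩).1 ?_
      rw [← A.toESpSe_φ_cls r hm c hc (A.cls_mem_cycles r hm c hc), ec]
      exact h₂
    rw [A.cls_sub, A.cls_mem_boundaries_iff r hm (m₀ := m - 1) (by omega)] at h₃
    obtain ⟨y, hy, hb⟩ := h₃
    obtain ⟨z, hz, hzb⟩ := A.exists_sub_d_mem_B r (m₀ := m - 1) (by omega) _ hb
    have hyz := Submodule.add_mem _ hy hz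
    have hd : (A.C.d (m - 1) m).hom (y + z) ∈ A.Z (r + 1) p m := by
      rw [mem_Z_iff _ _ _ _ (m + 1) rfl, A.d_d]
      rw [mem_Z_iff _ _ _ _ m (by omega)] at hyz
      exact ⟨A.mono_le (by omega) _ hyz.2, Submodule.zero_mem _⟩
    -- The correction is chosen so that `c - d(y + z) - a` lies in every `B_i` with `i ≤ r`, which
    -- gives the earlier classes. It leaves `[c]_{r+1}` unchanged because `d(y + z)` lies in
    -- `B_{r+1}`.
    refine ⟨c - (A.C.d (m - 1) m).hom (y + z), Submodule.sub_mem _ hc hd, funext fun i => ?_⟩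
    obtain ⟨i, hi⟩ := i
    by_cases hir : i < r + 1
    · refine Eq.trans ?_ (e' i hir)
      refine (A.cls_eq_cls_iff i hm _ _ _ _).2 ?_
      convert hzb i (by omega) using 1
      rw [map_add]
      abel
    · obtain rfl : i = r + 1 := by omega
      refine Eq.trans ?_ ec
      refine (A.cls_eq_cls_iff (r + 1) hm _ _ _ _).2 ?_
      rw [sub_sub_cancel_left]
      exact Submodule.neg_mem _ (A.d_mem_B_of_lt (Nat.lt_succ_self r) rfl (by omega) _ hyz)

/-! ### The nerve of the spectral sequence of a filtered complex -/

/-- The target page `r'` is arbitrary: `d a` is a genuine cocycle, so only its filtration index has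
to be controlled. -/
theorem d_mem_Z_of_mem_Z (A : FilteredComplex.{u, v} R) {r r' : ℕ} {p p' m m' : ℤ}
    (hp : p' = p - r) (hm : m' = m + 1) (a : A.C.X m) (ha : a ∈ A.Z r p m) :
    (A.C.d m m').hom a ∈ A.Z r' p' m' := by
  subst hp hm
  rw [mem_Z_iff _ _ _ _ _ rfl] at ha ⊢
  rw [A.d_d]
  exact ⟨ha.2, Submodule.zero_mem _⟩

/-- The element `(([a]_i); ([d a]_i))` of the nerve. -/
def nerveMk (A : FilteredComplex.{u, v} R) (r : ℕ) {p n m : ℤ} (hm : m = n - p) (a : A.C.X m)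
    (ha : a ∈ A.Z r p m) : (A.toESpSe.nerveObj.page r).X p n :=
  (⟨(A.clsSeq r hm a ha, A.clsSeq r (by omega) ((A.C.d m (m + 1)).hom a)
      (A.d_mem_Z_of_mem_Z rfl rfl a ha)),
    A.clsSeq_mem r hm a ha, A.clsSeq_mem r (by omega) _ (A.d_mem_Z_of_mem_Z rfl rfl a ha),
    A.d_cls r hm rfl rfl (by omega) a ha⟩ : A.toESpSe.nerveModule r p n)

/-- The sequences `x` and `y` lift separately to `a` and `b`, and `d_r x_r = y_r` says only that `d
a - b ∈ B_r`. Writing this difference as `y + d z`, the replacement of `a` by `a - z` leaves `y`,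
which is invisible on all pages `≤ r`. The element `z` is invisible there as well, so neither
sequence changes. -/
theorem exists_nerveMk (A : FilteredComplex.{u, v} R) (r : ℕ) {p n m : ℤ} (hm : m = n - p)
    (c : (A.toESpSe.nerveObj.page r).X p n) :
    ∃ (a : A.C.X m) (ha : a ∈ A.Z r p m), A.nerveMk r hm a ha = c := by
  obtain ⟨⟨x, y⟩, hx, hy, h⟩ := c
  obtain ⟨a, ha, rfl⟩ := A.exists_clsSeq r hm x hx
  obtain ⟨b, hb, rfl⟩ := A.exists_clsSeq r (m := m + 1) (by omega) y hy
  have h' : (A.C.d m (m + 1)).hom a - b ∈ A.B r (p - r) (m + 1) :=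
    (A.cls_eq_cls_iff r (n := n + 1 - r) (by omega) _ _ (A.d_mem_Z_of_mem_Z rfl rfl a ha) hb).1
      ((A.d_cls r hm rfl rfl (by omega) a ha).symm.trans h)
  -- correct `a` by an element of smaller filtration
  have key : ∃ z ∈ A.F (p - 1) m, (A.C.d m (m + 1)).hom (a - z) ∈ A.F (p - r) (m + 1) ∧
      (∀ i ≤ r, z ∈ A.B i p m) ∧
      ∀ i ≤ r, (A.C.d m (m + 1)).hom (a - z) - b ∈ A.B i (p - r) (m + 1) := by
    cases r with
    | zero =>
      refine ⟨0, Submodule.zero_mem _, ?_, fun i _ => Submodule.zero_mem _, fun i hi => ?_⟩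
      · rw [sub_zero]
        exact ((A.mem_Z_iff _ _ _ _ rfl _).1 ha).2
      · obtain rfl : i = 0 := by omega
        rwa [sub_zero]
    | succ r =>
      obtain ⟨y, hy, z, hz, e⟩ := (A.mem_B_succ_iff r _ _ m rfl _).1 h'
      rw [show p - ((r + 1 : ℕ) : ℤ) + r = p - 1 by push_cast; omega] at hz
      have hdz : (A.C.d m (m + 1)).hom (a - z) - b = y := by
        rw [map_sub, sub_right_comm, ← e, add_sub_cancel_right]
      refine ⟨z, A.Z_le_F _ _ _ hz, ?_, fun i hi => A.Z_le_B_of_le hi _ _ hz, fun i hi => ?_⟩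
      · rw [← sub_add_cancel ((A.C.d m (m + 1)).hom (a - z)) b, hdz]
        exact Submodule.add_mem _ (A.mono_le (by omega) _ (A.Z_le_F _ _ _ hy)) (A.Z_le_F _ _ _ hb)
      · rw [hdz]
        exact A.Z_le_B_of_le hi _ _ hy
  obtain ⟨z, hz, hdz, hzB, hb'⟩ := key
  have haz : a - z ∈ A.Z r p m := (A.mem_Z_iff _ _ _ _ rfl _).2
    ⟨Submodule.sub_mem _ (A.Z_le_F _ _ _ ha) (A.mono_le (by omega) _ hz), hdz⟩
  refine ⟨a - z, haz, Subtype.ext (Prod.ext ?_ ?_)⟩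
  · refine A.clsSeq_congr r hm _ _ haz ha fun i hi => ?_
    rw [sub_sub_cancel_left]
    exact Submodule.neg_mem _ (hzB i hi)
  · exact A.clsSeq_congr r (by omega) _ _ (A.d_mem_Z_of_mem_Z rfl rfl _ haz) hb hb'

theorem nerveMk_add (A : FilteredComplex.{u, v} R) (r : ℕ) {p n m : ℤ} (hm : m = n - p)
    (a b : A.C.X m) (ha : a ∈ A.Z r p m) (hb : b ∈ A.Z r p m) :
    A.nerveMk r hm a ha + A.nerveMk r hm b hb =
      A.nerveMk r hm (a + b) (Submodule.add_mem _ ha hb) := by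
  refine Subtype.ext (Prod.ext (funext fun i => A.cls_add i hm _ _ _ _) (funext fun i => ?_))
  refine (A.cls_add i (by omega) _ _ _ _).trans ?_
  simp only [nerveMk, clsSeq, map_add]

theorem smul_nerveMk (A : FilteredComplex.{u, v} R) (r : ℕ) {p n m : ℤ} (hm : m = n - p)
    (k : R) (a : A.C.X m) (ha : a ∈ A.Z r p m) :
    k • A.nerveMk r hm a ha = A.nerveMk r hm (k • a) (Submodule.smul_mem _ k ha) := by
  refine Subtype.ext (Prod.ext (funext fun i => A.smul_cls i hm _ _ _) (funext fun i => ?_))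
  refine (A.smul_cls i (by omega) _ _ _).trans ?_
  simp only [nerveMk, clsSeq, map_smul]

/-- The terms of index `0` already decide: `[a]_0 = 0` gives `a ∈ F_{p-1}` and `[d a]_0 = 0` gives
`d a ∈ F_{p-r-1}`, which together define `Z_r^{p-1}`. Conversely `Z_r^{p-1}` lies in all the `B_i`
involved, and so does its image under `d`. With `exists_nerveMk` this identifies the nerve page with
`Z_r^p / Z_r^{p-1}`. -/
theorem nerveMk_eq_zero_iff (A : FilteredComplex.{u, v} R) (r : ℕ) {p n m : ℤ} (hm : m = n - p)
    (a : A.C.X m) (ha : a ∈ A.Z r p m) :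
    A.nerveMk r hm a ha = 0 ↔ a ∈ A.Z r (p - 1) m := by
  constructor
  · intro h
    have h₁ := congrFun (congrArg (fun z : A.toESpSe.nerveModule r p n => z.1.1) h) ⟨0, by omega⟩
    have h₂ := congrFun (congrArg (fun z : A.toESpSe.nerveModule r p n => z.1.2) h) ⟨0, by omega⟩
    have h₁' := (A.cls_eq_zero_iff 0 hm a (A.Z_anti le_rfl (by omega) ha)).1 h₁
    have h₂' := (A.cls_eq_zero_iff 0 (n := n + 1 - r) (by omega) _
      (A.d_mem_Z_of_mem_Z rfl rfl a ha)).1 h₂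
    rw [mem_Z_iff _ _ _ _ _ rfl]
    exact ⟨h₁', A.mono_le (by omega) _ h₂'⟩
  · intro h
    refine Subtype.ext (Prod.ext (funext fun i => ?_) (funext fun i => ?_))
    · exact (A.cls_eq_zero_iff i hm _ _).2 (A.Z_le_B_of_le (by omega) _ _ h)
    · refine (A.cls_eq_zero_iff i (by omega) _ _).2 (A.Z_le_B_of_le (r := i) (by omega) _ _ ?_)
      exact A.d_mem_Z_of_mem_Z (by omega) rfl a h

/-- `nerveMk` as a linear map on the `r`-cycles. -/
def nerveMkₗ (A : FilteredComplex.{u, v} R) (r : ℕ) {p n m : ℤ} (hm : m = n - p) :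
    A.Z r p m →ₗ[R] (A.toESpSe.nerveObj.page r).X p n where
  toFun a := A.nerveMk r hm a.1 a.2
  map_add' _ _ := (A.nerveMk_add r hm _ _ _ _).symm
  map_smul' k _ := (A.smul_nerveMk r hm k _ _).symm

theorem nerveMk_cast (A : FilteredComplex.{u, v} R) (r : ℕ) {p n m p' n' : ℤ} (hp : p = p')
    (hn : n = n') (hm : m = n - p) (a : A.C.X m) (ha : a ∈ A.Z r p m) :
    (A.toESpSe.nerveObj.page r).cast hp hn (A.nerveMk r hm a ha) =
      A.nerveMk r (by omega) a (show a ∈ A.Z r p' m from hp ▸ ha) := by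
  subst hp hn
  rfl

theorem nerveMk_d (A : FilteredComplex.{u, v} R) (r : ℕ) {p n m p' n' m' : ℤ} (hp : p' = p - r)
    (hn : n' = n + 1 - r) (hm : m = n - p) (hm' : m' = n' - p') (a : A.C.X m)
    (ha : a ∈ A.Z r p m) :
    (A.toESpSe.nerveObj.page r).d p n p' n' hp hn (A.nerveMk r hm a ha) =
      A.nerveMk r hm' ((A.C.d m m').hom a) (A.d_mem_Z_of_mem_Z hp (by omega) a ha) := by
  obtain rfl : m' = m + 1 := by omega
  subst hp hn
  refine Subtype.ext (Prod.ext rfl (funext fun i => Eq.symm ?_))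
  refine (A.cls_eq_zero_iff i (by omega) _ _).2 ?_
  rw [A.d_d]
  exact Submodule.zero_mem _

/-- In `Z_r^p / Z_r^{p-1}` the map `w` is induced by the inclusion `Z_{r+1}^p ⊆ Z_r^p`. The zero in
its second component is consistent: `d a ∈ F_{p-r-1}` has zero classes in filtration degree `p - r`.
-/
theorem nerveMk_w (A : FilteredComplex.{u, v} R) (r : ℕ) {p n m : ℤ} (hm : m = n - p)
    (a : A.C.X m) (ha : a ∈ A.Z (r + 1) p m) :
    A.toESpSe.nerveObj.w r p n (A.nerveMk (r + 1) hm a ha) =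
      A.nerveMk r hm a (A.Z_succ_le r _ _ ha) := by
  refine Subtype.ext (Prod.ext rfl (funext fun i => Eq.symm ?_))
  refine (A.cls_eq_zero_iff i (by omega) _ _).2 (A.Z_le_B_of_le (r := i) (by omega) _ _ ?_)
  exact A.d_mem_Z_of_mem_Z (by push_cast; omega) rfl a ha

theorem Z_succ_of_Z (A : FilteredComplex.{u, v} R) (r : ℕ) {p p' m : ℤ} (hp : p' = p + 1) :
    A.Z r p m ≤ A.Z (r + 1) p' m :=
  A.Z_anti (by omega) (by push_cast; omega)

/-- Here `s` is induced by the inclusion `Z_r^p ⊆ Z_{r+1}^{p+1}`. The first sequence vanishes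
because `a` has dropped one step in the filtration relative to the new bidegree. -/
theorem nerveMk_s (A : FilteredComplex.{u, v} R) (r : ℕ) {p n m p' n' : ℤ} (hp : p' = p + 1)
    (hn : n' = n + 1) (hm : m = n - p) (a : A.C.X m) (ha : a ∈ A.Z r p m) :
    A.toESpSe.nerveObj.s r p n p' n' hp hn (A.nerveMk r hm a ha) =
      A.nerveMk (r + 1) (by omega) a (A.Z_succ_of_Z r hp ha) := by
  subst hp hn
  refine Subtype.ext (Prod.ext (funext fun i => Eq.symm ?_) (funext fun i => ?_))
  · refine (A.cls_eq_zero_iff i (by omega) _ _).2 (A.Z_le_B_of_le (r := r) (by omega) _ _ ?_)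
    exact A.Z_anti (by omega) (by omega) ha
  · by_cases h : (i : ℕ) < r + 1
    · refine (congrArg ((A.page i).cast (by push_cast; omega) (by push_cast; omega))
        (dif_pos h)).trans ?_
      exact A.cast_cls i _ _ (by omega) _ _
    · refine (congrArg ((A.page i).cast (by push_cast; omega) (by push_cast; omega))
        (dif_neg h)).trans ?_
      obtain ⟨i, hi⟩ := i
      obtain rfl : i = r + 1 := by
        change ¬ i < r + 1 at h
        omega
      refine (map_zero _).trans (Eq.symm ((A.cls_eq_zero_iff (r + 1) (by omega) _ _).2 ?_))
      exact A.d_mem_B_of_lt (Nat.lt_succ_self r) (by push_cast; omega) rfl a ha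

theorem nerveMk_sIter (A : FilteredComplex.{u, v} R) (j : ℕ) {p n m p' n' : ℤ} (hp : p' = p + j)
    (hn : n' = n + j) (hm : m = n - p) (a : A.C.X m) (ha : a ∈ A.Z 1 p m) :
    A.toESpSe.nerveObj.sIter j p n p' n' hp hn (A.nerveMk 1 hm a ha) =
      A.nerveMk (j + 1) (by omega) a
        (A.Z_anti (by omega) (by push_cast; omega) ha) := by
  induction j generalizing p' n' with
  | zero => exact A.nerveMk_cast 1 _ _ hm a ha
  | succ j ih =>
    rw [A.toESpSe.nerveObj.sIter_succ j p n (p + j) (n + j) p' n' rfl rfl (by push_cast at hp; omega)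
      (by push_cast at hn; omega), ih rfl rfl]
    exact A.nerveMk_s (j + 1) _ _ _ _ _

theorem Hom.nerveMap_nerveMk {A B : FilteredComplex.{u, v} R} (f : Hom A B) (r : ℕ) {p n m : ℤ}
    (hm : m = n - p) (a : A.C.X m) (ha : a ∈ A.Z r p m) :
    f.toESpSe.nerveMap r p n (A.nerveMk r hm a ha) =
      B.nerveMk r hm ((f.hom.f m).hom a) (f.map_Z _ _ _ _ ha) := by
  refine Subtype.ext (Prod.ext (funext fun i => f.toESpSe_cls i hm a _) (funext fun i => ?_))
  refine (f.toESpSe_cls i (by omega) _ _).trans ?_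
  simp only [nerveMk, clsSeq, f.map_d]
  rfl

theorem nerveZero_cls (A : FilteredComplex.{u, v} R) {p n m : ℤ} (hm : m = n - p) (a : A.C.X m)
    (ha : a ∈ A.Z 0 p m) : A.toESpSe.nerveZero (A.cls 0 hm a ha) = A.nerveMk 0 hm a ha := by
  refine Subtype.ext (Prod.ext (funext fun i => ?_) (funext fun i => ?_))
  · obtain rfl : i = 0 := Fin.fin_one_eq_zero i
    rfl
  · obtain rfl : i = 0 := Fin.fin_one_eq_zero i
    exact A.d_cls 0 hm _ _ (by omega) a ha

end FilteredComplex

namespace FilteredComplex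

variable {R : Type u} [CommRing R]

/-! ### Cycles and boundaries of Deligne's filtration -/

/-- The index `P = p - m` translates the filtration degree `p` of `Dec^*(A)` in cohomological degree
`m` into a degree for `F`; in bidegree `(p, n)` it equals `2p - n`. Keeping `P` and the preceding
degree `m₀` as variables tied by equations avoids transport along equalities of indices. -/
theorem mem_decStar_F_iff (A : FilteredComplex.{u, v} R) {p P m m₀ : ℤ} (hP : P = p - m)
    (hm : m = m₀ + 1) (x : A.C.X m) :
    x ∈ A.decStar.F p m ↔
      ∃ a ∈ A.F P m, ∃ b ∈ A.F (P + 1) m₀, a + (A.C.d m₀ m).hom b = x := by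
  obtain rfl : m₀ = m - 1 := by omega
  subst hP
  change x ∈ A.F (p - m) m ⊔ (A.F (p - m + 1) (m - 1)).map (A.C.d (m - 1) m).hom ↔ _
  simp [Submodule.mem_sup]

theorem F_le_decStar_F (A : FilteredComplex.{u, v} R) {p P m : ℤ} (hP : P ≤ p - m) :
    A.F P m ≤ A.decStar.F p m :=
  (A.mono_le hP m).trans le_sup_left

theorem d_mem_decStar_F (A : FilteredComplex.{u, v} R) {p P m m₀ : ℤ} (hP : P ≤ p - m₀)
    (x : A.C.X m₀) (hx : x ∈ A.F P m₀) : (A.C.d m₀ m).hom x ∈ A.decStar.F p m := by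
  by_cases hm : m₀ + 1 = m
  · rw [A.mem_decStar_F_iff rfl hm.symm]
    exact ⟨0, Submodule.zero_mem _, x, A.mono_le (by omega) _ hx, zero_add _⟩
  · rw [A.C.shape m₀ m hm]
    exact Submodule.zero_mem _

theorem F_le_decStar_Z (A : FilteredComplex.{u, v} R) (j : ℕ) {p P m : ℤ} (hP : P ≤ p - m - j) :
    A.F P m ≤ A.decStar.Z j p m := fun x hx =>
  (A.decStar.mem_Z_iff j p m _ rfl x).2
    ⟨A.F_le_decStar_F (by omega) hx, A.d_mem_decStar_F (by omega) x hx⟩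

theorem d_mem_decStar_Z (A : FilteredComplex.{u, v} R) (j : ℕ) {p P m m₀ : ℤ}
    (hP : P ≤ p - m₀) (x : A.C.X m₀) (hx : x ∈ A.F P m₀) :
    (A.C.d m₀ m).hom x ∈ A.decStar.Z j p m :=
  (A.decStar.mem_Z_iff j p m _ rfl _).2 ⟨A.d_mem_decStar_F hP x hx, by
    change (A.C.d m (m + 1)).hom _ ∈ _
    rw [A.d_d]
    exact Submodule.zero_mem _⟩

/-- This inclusion underlies Deligne's map `[a]_{j+1} ↦ [a]_j`. The page drops by one because
passing from degree `m` to `m + 1` already shifts the decaled filtration by one. -/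
theorem Z_succ_le_decStar_Z (A : FilteredComplex.{u, v} R) (j : ℕ) {p P m : ℤ} (hP : P ≤ p - m) :
    A.Z (j + 1) P m ≤ A.decStar.Z j p m := fun x hx => by
  rw [mem_Z_iff _ _ _ _ _ rfl] at hx
  exact (A.decStar.mem_Z_iff j p m _ rfl x).2
    ⟨A.F_le_decStar_F hP hx.1, A.F_le_decStar_F (by push_cast; omega) hx.2⟩

/-- For `x = a + d b` the condition on `d x = d a` reads `d a = h + d k` with `h ∈ F_{P-j-1}` and `k
∈ F_{P-j}`. Then `d(a - k) = h`, so `a - k ∈ Z_{j+1}^P`, and `x = k + d b + (a - k)` is the required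
decomposition. It supplies the triples that cover `E(Dec^*(A))`. -/
theorem mem_decStar_Z_iff (A : FilteredComplex.{u, v} R) (j : ℕ) {p P m m₀ : ℤ} (hP : P = p - m)
    (hm : m = m₀ + 1) (x : A.C.X m) :
    x ∈ A.decStar.Z j p m ↔ ∃ a ∈ A.F (P - j) m, ∃ b ∈ A.F (P + 1) m₀, ∃ c ∈ A.Z (j + 1) P m,
      a + (A.C.d m₀ m).hom b + c = x := by
  constructor
  · intro hx
    have hx' := (A.decStar.mem_Z_iff j p m (m + 1) rfl x).1 hx
    obtain ⟨a, ha, b, hb, rfl⟩ := (A.mem_decStar_F_iff hP hm x).1 hx'.1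
    obtain ⟨h, hh, k, hk, e⟩ := (A.mem_decStar_F_iff (P := P - j - 1) (m₀ := m) (by omega) rfl _).1
      hx'.2
    have e' : h + (A.C.d m (m + 1)).hom k = (A.C.d m (m + 1)).hom (a + (A.C.d m₀ m).hom b) := e
    rw [map_add, A.d_d, add_zero] at e'
    rw [show P - j - 1 + 1 = P - j by omega] at hk
    refine ⟨k, hk, b, hb, a - k, ?_, by abel⟩
    rw [mem_Z_iff _ _ _ _ _ rfl, map_sub, ← e', add_sub_cancel_right]
    exact ⟨Submodule.sub_mem _ ha (A.mono_le (by omega) _ hk),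
      A.mono_le (by push_cast; omega) _ hh⟩
  · rintro ⟨a, ha, b, hb, c, hc, rfl⟩
    exact Submodule.add_mem _ (Submodule.add_mem _ (A.F_le_decStar_Z j (by omega) ha)
      (A.d_mem_decStar_Z j (by omega) b hb)) (A.Z_succ_le_decStar_Z j (by omega) hc)

theorem mem_decStar_B_zero_iff (A : FilteredComplex.{u, v} R) {p P m m₀ : ℤ} (hP : P = p - m)
    (hm : m = m₀ + 1) (x : A.C.X m) :
    x ∈ A.decStar.B 0 p m ↔
      ∃ a ∈ A.F (P - 1) m, ∃ b ∈ A.F P m₀, a + (A.C.d m₀ m).hom b = x := by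
  refine (A.mem_decStar_F_iff (p := p - 1) (P := P - 1) (by omega) hm x).trans ?_
  rw [show P - 1 + 1 = P by omega]

/-- Together with `d_mem_decStar_B_succ` this shows that the first two summands of a cycle
contribute nothing to its class on pages `≥ 1`. -/
theorem F_le_decStar_B_succ (A : FilteredComplex.{u, v} R) (j : ℕ) {p P m : ℤ}
    (hP : P + (j + 1 : ℕ) ≤ p - m) : A.F P m ≤ A.decStar.B (j + 1) p m :=
  (A.F_le_decStar_Z j (p := p - 1) (by push_cast at hP; omega)).trans le_sup_left

theorem d_mem_decStar_B_succ (A : FilteredComplex.{u, v} R) (j : ℕ) {p P m m₀ : ℤ}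
    (hm : m = m₀ + 1) (hP : P ≤ p - m + 1) (x : A.C.X m₀) (hx : x ∈ A.F P m₀) :
    (A.C.d m₀ m).hom x ∈ A.decStar.B (j + 1) p m :=
  (A.decStar.mem_B_succ_iff j p m m₀ hm _).2 ⟨0, Submodule.zero_mem _, x,
    A.F_le_decStar_Z j (by omega) hx, zero_add _⟩

/-- `B_{j+1}` for the filtration `F` is contained in `B_j` for `Dec^* F`. -/
theorem B_succ_le_decStar_B (A : FilteredComplex.{u, v} R) (j : ℕ) {p P m : ℤ} (hP : P = p - m) :
    A.B (j + 1) P m ≤ A.decStar.B j p m := by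
  intro x hx
  obtain ⟨y, hy, z, hz, rfl⟩ := (A.mem_B_succ_iff j P m (m - 1) (by omega) x).1 hx
  cases j with
  | zero =>
    refine (A.mem_decStar_B_zero_iff hP (m₀ := m - 1) (by omega) _).2 ⟨y, A.Z_le_F _ _ _ hy, z, ?_, rfl⟩
    simpa using A.Z_le_F _ _ _ hz
  | succ j =>
    refine (A.decStar.mem_B_succ_iff j p m (m - 1) (by omega) _).2
      ⟨y, A.Z_succ_le_decStar_Z j (by omega) hy, z,
        A.Z_succ_le_decStar_Z j (by push_cast; omega) hz, rfl⟩

/-- Membership in `B_{j+1}` for `Dec^* F` of an element of `F_{P-j-1} + d F_{P+1} + Z_{j+2}^P`. -/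
theorem add_mem_decStar_B_succ_iff (A : FilteredComplex.{u, v} R) (j : ℕ) {p P m m₀ : ℤ}
    (hP : P = p - m) (hm : m = m₀ + 1) (a : A.C.X m) (b : A.C.X m₀) (c : A.C.X m)
    (ha : a ∈ A.F (P - (j + 1 : ℕ)) m) (hb : b ∈ A.F (P + 1) m₀) (hc : c ∈ A.Z (j + 2) P m) :
    a + (A.C.d m₀ m).hom b + c ∈ A.decStar.B (j + 1) p m ↔ c ∈ A.B (j + 2) P m := by
  refine (Submodule.add_mem_iff_right (A.decStar.B (j + 1) p m) (Submodule.add_mem _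
    (A.F_le_decStar_B_succ j (by omega) ha)
    (A.d_mem_decStar_B_succ j hm (by omega) b hb))).trans ?_
  refine ⟨fun h => ?_, fun h => A.B_succ_le_decStar_B (j + 1) hP h⟩
  obtain ⟨y, hy, z, hz, e⟩ := (A.decStar.mem_B_succ_iff j p m m₀ hm _).1 h
  -- Both parts of the boundary are expanded by the cycle decomposition. The summand `d g'` of `z`
  -- is killed by `d`, and the rest regroups as `c = (f + u) + d(g + f' + u')`.
  obtain ⟨f, hf, g, hg, u, hu, rfl⟩ := (A.mem_decStar_Z_iff j (P := P - 1) (by omega) hm y).1 hy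
  obtain ⟨f', hf', g', hg', u', hu', rfl⟩ :=
    (A.mem_decStar_Z_iff j (P := P + j + 1) (m₀ := m₀ - 1) (by omega) (by omega) z).1 hz
  have e' : f + (A.C.d m₀ m).hom g + u +
    (A.C.d m₀ m).hom (f' + (A.C.d (m₀ - 1) m₀).hom g' + u') = c := e
  rw [map_add, map_add, A.d_d, add_zero] at e'
  have hc' := (A.mem_Z_iff _ _ _ _ rfl _).1 hc
  have hfu : f + u ∈ A.F (P - 1) m :=
    Submodule.add_mem _ (A.mono_le (by omega) _ hf) (A.Z_le_F _ _ _ hu)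
  have hdg : (A.C.d m₀ m).hom (g + f' + u') = c - (f + u) := by
    rw [← e', map_add, map_add]
    abel
  -- Since `c - (f + u)` is a coboundary, `f + u` inherits the bound on `d c`; this places it in
  -- `Z_{j+1}^{P-1}`, although `f` alone need not lie there.
  have hdfu : (A.C.d m (m + 1)).hom (f + u) = (A.C.d m (m + 1)).hom c := by
    have := A.d_d m₀ m (m + 1) (g + f' + u')
    rw [hdg, map_sub, sub_eq_zero] at this
    exact this.symm
  refine (A.mem_B_succ_iff (j + 1) P m m₀ hm c).2 ⟨f + u, ?_, g + f' + u', ?_, ?_⟩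
  · rw [mem_Z_iff _ _ _ _ _ rfl, hdfu]
    exact ⟨hfu, A.mono_le (by push_cast; omega) _ hc'.2⟩
  · rw [mem_Z_iff _ _ _ _ m hm, hdg]
    refine ⟨Submodule.add_mem _ (Submodule.add_mem _ (A.mono_le (by push_cast; omega) _ hg)
      (A.mono_le (by push_cast; omega) _ hf'))
      (A.mono_le (by push_cast; omega) _ (A.Z_le_F _ _ _ hu')), ?_⟩
    exact Submodule.sub_mem _ (A.mono_le (by push_cast; omega) _ hc'.1)
      (A.mono_le (by push_cast; omega) _ hfu)
  · rw [hdg]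
    abel

end FilteredComplex

namespace FilteredComplex

variable {R : Type u} [CommRing R]

/-! ### The decalage of the spectral sequence of a filtered complex -/

theorem nerveMk_neg (A : FilteredComplex.{u, v} R) (r : ℕ) {p n m : ℤ} (hm : m = n - p)
    (a : A.C.X m) (ha : a ∈ A.Z r p m) :
    -A.nerveMk r hm a ha = A.nerveMk r hm (-a) (Submodule.neg_mem _ ha) :=
  (map_neg (A.nerveMkₗ r hm) ⟨a, ha⟩).symm

theorem nerveMk_eq_iff (A : FilteredComplex.{u, v} R) (r : ℕ) {p n m : ℤ} (hm : m = n - p)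
    (a b : A.C.X m) (ha : a ∈ A.Z r p m) (hb : b ∈ A.Z r p m) :
    A.nerveMk r hm a ha = A.nerveMk r hm b hb ↔ a - b ∈ A.Z r (p - 1) m := by
  rw [← sub_eq_zero, sub_eq_add_neg, nerveMk_neg, nerveMk_add, nerveMk_eq_zero_iff,
    ← sub_eq_add_neg]

theorem nerveMk_zero (A : FilteredComplex.{u, v} R) (r : ℕ) {p n m : ℤ} (hm : m = n - p) :
    A.nerveMk r hm 0 (Submodule.zero_mem _) = 0 :=
  (A.nerveMk_eq_zero_iff r hm 0 _).2 (Submodule.zero_mem _)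

theorem add_d_mem_Z (A : FilteredComplex.{u, v} R) (j : ℕ) {p m m₀ : ℤ} (hm : m = m₀ + 1)
    {x : A.C.X m} {y : A.C.X m₀} (hx : x ∈ A.Z 1 (p - j) m) (hy : y ∈ A.Z 1 (p + 1) m₀) :
    x + (A.C.d m₀ m).hom y ∈ A.Z (j + 1) p m :=
  Submodule.add_mem _ (A.Z_anti (by omega) (by push_cast; omega) hx)
    (A.d_mem_Z_of_mem_Z (by push_cast; omega) hm y hy)

theorem shriekRel₁_nerveMk (A : FilteredComplex.{u, v} R) (j : ℕ) {p n m : ℤ} (hm : m = n - p)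
    (x : A.C.X m) (hx : x ∈ A.Z 1 (p - j) m) :
    A.toESpSe.nerveObj.shriekRel₁ j p n (A.nerveMk 1 (by omega) x hx) =
      (A.nerveMk 0 (by omega) x (A.Z_succ_le 0 _ _ hx), 0,
        -A.nerveMk (j + 1) hm x (A.Z_anti (by omega) (by push_cast; omega) hx)) := by
  rw [TrLWB.shriekRel₁_apply, nerveMk_sIter]
  refine Prod.ext ?_ rfl
  exact A.nerveMk_w 0 _ x hx

theorem shriekRel₂_nerveMk (A : FilteredComplex.{u, v} R) (j : ℕ) {p n m m₀ : ℤ}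
    (hm : m = n - p) (hm₀ : m = m₀ + 1) (y : A.C.X m₀) (hy : y ∈ A.Z 1 (p + 1) m₀) :
    A.toESpSe.nerveObj.shriekRel₂ j p n (A.nerveMk 1 (by omega) y hy) =
      (0, A.nerveMk 0 (by omega) y (A.Z_succ_le 0 _ _ hy), -A.nerveMk (j + 1) hm
        ((A.C.d m₀ m).hom y) (A.d_mem_Z_of_mem_Z (by push_cast; omega) hm₀ y hy)) := by
  rw [TrLWB.shriekRel₂_apply, nerveMk_sIter, A.nerveMk_d _ _ _ _ hm]
  refine Prod.ext rfl (Prod.ext ?_ rfl)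
  exact A.nerveMk_w 0 _ y hy

/-- Every element of the nerve page `1` comes from `Z_1`, so one `x` and one `y` parametrize all
sums of the two kinds of relation, and their third entries combine into `-(x + d y)`. -/
theorem mem_shriekRel_iff (A : FilteredComplex.{u, v} R) (j : ℕ) {p n m m₀ : ℤ}
    (hm : m = n - p) (hm₀ : m = m₀ + 1) (t : A.toESpSe.nerveObj.ShriekPre j p n) :
    t ∈ A.toESpSe.nerveObj.shriekRel j p n ↔
      ∃ (x : A.C.X m) (hx : x ∈ A.Z 1 (p - j) m) (y : A.C.X m₀) (hy : y ∈ A.Z 1 (p + 1) m₀),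
        (A.nerveMk 0 (by omega) x (A.Z_succ_le 0 _ _ hx),
          A.nerveMk 0 (by omega) y (A.Z_succ_le 0 _ _ hy),
          -A.nerveMk (j + 1) hm (x + (A.C.d m₀ m).hom y) (A.add_d_mem_Z j hm₀ hx hy)) = t := by
  have key : ∀ (x : A.C.X m) (hx : x ∈ A.Z 1 (p - j) m) (y : A.C.X m₀)
      (hy : y ∈ A.Z 1 (p + 1) m₀),
      A.toESpSe.nerveObj.shriekRel₁ j p n (A.nerveMk 1 (by omega) x hx) +
        A.toESpSe.nerveObj.shriekRel₂ j p n (A.nerveMk 1 (by omega) y hy) =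
      (A.nerveMk 0 (by omega) x (A.Z_succ_le 0 _ _ hx),
          A.nerveMk 0 (by omega) y (A.Z_succ_le 0 _ _ hy),
          -A.nerveMk (j + 1) hm (x + (A.C.d m₀ m).hom y) (A.add_d_mem_Z j hm₀ hx hy)) := by
    intro x hx y hy
    rw [A.shriekRel₁_nerveMk j hm, A.shriekRel₂_nerveMk j hm hm₀,
      ← A.nerveMk_add (j + 1) hm x _ (A.Z_anti (by omega) (by push_cast; omega) hx)
        (A.d_mem_Z_of_mem_Z (by push_cast; omega) hm₀ y hy), neg_add]
    exact Prod.ext (add_zero _) (Prod.ext (zero_add _) rfl)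
  constructor
  · intro ht
    obtain ⟨_, ⟨X, rfl⟩, _, ⟨Y, rfl⟩, rfl⟩ := Submodule.mem_sup.1 ht
    obtain ⟨x, hx, rfl⟩ := A.exists_nerveMk 1 (m := m) (by omega) X
    obtain ⟨y, hy, rfl⟩ := A.exists_nerveMk 1 (m := m₀) (by omega) Y
    exact ⟨x, hx, y, hy, (key x hx y hy).symm⟩
  · rintro ⟨x, hx, y, hy, rfl⟩
    rw [← key x hx y hy]
    exact Submodule.add_mem_sup ⟨_, rfl⟩ ⟨_, rfl⟩

theorem exists_nerveMk_triple (A : FilteredComplex.{u, v} R) (j : ℕ) {p n m m₀ : ℤ}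
    (hm : m = n - p) (hm₀ : m = m₀ + 1) (t : A.toESpSe.nerveObj.ShriekPre j p n) :
    ∃ (a : A.C.X m) (ha : a ∈ A.Z 0 (p - j) m) (b : A.C.X m₀) (hb : b ∈ A.Z 0 (p + 1) m₀)
      (c : A.C.X m) (hc : c ∈ A.Z (j + 1) p m),
      (A.nerveMk 0 (by omega) a ha, A.nerveMk 0 (by omega) b hb, A.nerveMk (j + 1) hm c hc) = t := by
  obtain ⟨x, y, z⟩ := t
  obtain ⟨a, ha, rfl⟩ := A.exists_nerveMk 0 (m := m) (by omega) x
  obtain ⟨b, hb, rfl⟩ := A.exists_nerveMk 0 (m := m₀) (by omega) y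
  obtain ⟨c, hc, rfl⟩ := A.exists_nerveMk (j + 1) hm z
  exact ⟨a, ha, b, hb, c, hc, rfl⟩

/-- The submodule of the nerve corresponding to `B_r`. -/
def nerveB (A : FilteredComplex.{u, v} R) (r : ℕ) {p n m : ℤ} (hm : m = n - p) :
    Submodule R ((A.toESpSe.nerveObj.page r).X p n) :=
  ((A.B r p m).submoduleOf (A.Z r p m)).map (A.nerveMkₗ r hm)

/-- Membership can be tested on any representative because the kernel `Z_r^{p-1}` of `nerveMk` is
contained in `B_r^p`. -/
theorem nerveMk_mem_nerveB_iff (A : FilteredComplex.{u, v} R) (r : ℕ) {p n m : ℤ}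
    (hm : m = n - p) (a : A.C.X m) (ha : a ∈ A.Z r p m) :
    A.nerveMk r hm a ha ∈ A.nerveB r hm ↔ a ∈ A.B r p m := by
  constructor
  · rintro ⟨⟨b, hb⟩, hbB, e⟩
    have h := A.Z_le_B_of_le (Nat.le_succ r) _ _ ((A.nerveMk_eq_iff r hm b a hb ha).1 e)
    rw [← sub_sub_cancel b a]
    exact Submodule.sub_mem _ hbB h
  · exact fun h => ⟨⟨a, ha⟩, h, rfl⟩

/-- The third entry of a relation is `-(x + d y)` with `x ∈ Z_1^{p-j-1} ⊆ Z_{j+1}^{p-1}` and `y ∈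
Z_1^{p+1}`, and both `x` and `d y` lie in `B_{j+2}^p`. Hence the condition that the third entry be a
boundary descends to `𝒲_!`. The shift from `j` to `j + 1` is needed: otherwise, for `j = 0`, one
would only have `x ∈ Z_1^p`. -/
theorem shriekRel_le_nerveB (A : FilteredComplex.{u, v} R) (j : ℕ) {p n m : ℤ} (hm : m = n - p) :
    A.toESpSe.nerveObj.shriekRel (j + 1) p n ≤ (A.nerveB (j + 2) hm).comap
      ((LinearMap.snd R _ _).comp (LinearMap.snd R _ _)) := by
  intro t ht
  obtain ⟨x, hx, y, hy, rfl⟩ := (A.mem_shriekRel_iff (j + 1) hm (m₀ := m - 1) (by omega) t).1 ht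
  refine Submodule.neg_mem _ ((A.nerveMk_mem_nerveB_iff (j + 2) hm _ _).2 ?_)
  exact Submodule.add_mem _ (A.Z_le_B_of_le (r := j + 1) le_rfl _ _
    (A.Z_anti (by push_cast; omega) (by push_cast; omega) hx))
    (A.d_mem_B_of_lt (r := 1) (by omega) (by push_cast; omega) (by omega) y hy)

/-- The two kinds of generators have third entries in the two summands of `B_{j+2}^p = Z_{j+1}^{p-1}
+ d Z_{j+1}^{p+j+1}`: images of `s` in the first, images of `d s` in the second. -/
theorem degen_le_nerveB (A : FilteredComplex.{u, v} R) (j : ℕ) {p n m : ℤ} (hm : m = n - p) :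
    A.toESpSe.nerveObj.shriekObj.degen (j + 1) p n ≤ ((A.nerveB (j + 2) hm).comap
      ((LinearMap.snd R _ _).comp (LinearMap.snd R _ _))).map
        (A.toESpSe.nerveObj.shriekMk (j + 1) p n) := by
  refine A.toESpSe.nerveObj.shriekObj.degen_succ_le j _ ?_ ?_
  · intro p₀ n₀ hp hn ξ
    obtain ⟨⟨X, Y, c⟩, rfl⟩ := A.toESpSe.nerveObj.shriekMk_surjective j p₀ n₀ ξ
    obtain ⟨c, hc, rfl⟩ := A.exists_nerveMk (j + 1) (m := m) (by omega) c
    refine ⟨_, ?_, (A.toESpSe.nerveObj.shriekS_mk j p₀ n₀ p n hp hn _).symm⟩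
    change A.toESpSe.nerveObj.s (j + 1) p₀ n₀ p n hp hn (A.nerveMk (j + 1) _ c hc) ∈
      A.nerveB (j + 2) hm
    rw [nerveMk_s, nerveMk_mem_nerveB_iff]
    obtain rfl : p₀ = p - 1 := by omega
    exact A.Z_le_B_of_le le_rfl _ _ hc
  · intro p₀ n₀ p₁ n₁ hp hn hp' hn' ξ
    obtain ⟨⟨X, Y, c⟩, rfl⟩ := A.toESpSe.nerveObj.shriekMk_surjective j p₀ n₀ ξ
    obtain ⟨c, hc, rfl⟩ := A.exists_nerveMk (j + 1) (m := m - 1) (by push_cast at *; omega) c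
    refine ⟨_, ?_, (A.toESpSe.nerveObj.shriekPage_d_mk (j + 1) p₁ n₁ p n hp' hn' _).symm⟩
    change (A.toESpSe.nerveObj.page (j + 1 + 1)).d p₁ n₁ p n hp' hn'
      (A.toESpSe.nerveObj.s (j + 1) p₀ n₀ p₁ n₁ hp hn (A.nerveMk (j + 1) _ c hc)) ∈
        A.nerveB (j + 2) hm
    rw [nerveMk_s, A.nerveMk_d _ _ _ _ hm, nerveMk_mem_nerveB_iff]
    exact A.d_mem_B_of_lt (Nat.lt_succ_self _) (by push_cast at *; omega) (by omega) c hc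

/-! ### Classes of triples in `LDec(E(A))` and their vanishing. -/

theorem eq_sub_two_mul_sub {p n m : ℤ} (hm : m = n - p) : m = p - (2 * p - n) := by
  omega

theorem eq_sub_two_mul_sub_add_one {p n m m₀ : ℤ} (hm : m = n - p) (hm₀ : m = m₀ + 1) :
    m₀ = p - (2 * p - n + 1) := by
  omega

/-- The class in `LDec(E(A))` of a triple of elements of `A`. -/
noncomputable def ldecMk (A : FilteredComplex.{u, v} R) (j : ℕ) {p n m m₀ : ℤ} (hm : m = n - p)
    (hm₀ : m = m₀ + 1) (a : A.C.X m) (ha : a ∈ A.Z 0 (2 * p - n - j) m) (b : A.C.X m₀)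
    (hb : b ∈ A.Z 0 (2 * p - n + 1) m₀) (c : A.C.X m) (hc : c ∈ A.Z (j + 1) (2 * p - n) m) :
    (((LDec R).obj A.toESpSe).page j).X p n :=
  LDec.mk A.toESpSe j p n
    (A.nerveMk 0 (by rw [eq_sub_two_mul_sub hm]; abel) a ha)
    (A.nerveMk 0 (eq_sub_two_mul_sub_add_one hm hm₀) b hb)
    (A.nerveMk (j + 1) (eq_sub_two_mul_sub hm) c hc)

theorem exists_ldecMk (A : FilteredComplex.{u, v} R) (j : ℕ) {p n m m₀ : ℤ} (hm : m = n - p)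
    (hm₀ : m = m₀ + 1) (ξ : (((LDec R).obj A.toESpSe).page j).X p n) :
    ∃ a ha b hb c hc, A.ldecMk j hm hm₀ a ha b hb c hc = ξ := by
  obtain ⟨ξ, rfl⟩ := A.toESpSe.nerveObj.shriekObj.quotMk_surjective j (2 * p - n) p ξ
  obtain ⟨t, rfl⟩ := A.toESpSe.nerveObj.shriekMk_surjective j (2 * p - n) p ξ
  obtain ⟨a, ha, b, hb, c, hc, rfl⟩ := A.exists_nerveMk_triple j (m := m) (by omega) hm₀ t
  exact ⟨a, ha, b, hb, c, hc, rfl⟩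

/-- On page `0` nothing is divided out after `𝒲_!`, so the triple has to be a relation `(x, y, -(x +
d y))`. The three conditions compare entries modulo the kernels of `nerveMk`, which for the first
two entries are just `F_{P-1}` and `F_P`. -/
theorem ldecMk_zero_eq_zero_iff (A : FilteredComplex.{u, v} R) {p n m m₀ : ℤ} (hm : m = n - p)
    (hm₀ : m = m₀ + 1) (a : A.C.X m) (ha : a ∈ A.Z 0 (2 * p - n - (0 : ℕ)) m) (b : A.C.X m₀)
    (hb : b ∈ A.Z 0 (2 * p - n + 1) m₀) (c : A.C.X m) (hc : c ∈ A.Z (0 + 1) (2 * p - n) m) :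
    A.ldecMk 0 hm hm₀ a ha b hb c hc = 0 ↔
      ∃ x ∈ A.Z 1 (2 * p - n) m, ∃ y ∈ A.Z 1 (2 * p - n + 1) m₀,
        x - a ∈ A.F (2 * p - n - 1) m ∧ y - b ∈ A.F (2 * p - n) m₀ ∧
          c + (x + (A.C.d m₀ m).hom y) ∈ A.Z 1 (2 * p - n - 1) m := by
  have h₁ : A.ldecMk 0 hm hm₀ a ha b hb c hc = 0 ↔
      (A.nerveMk 0 (by omega) a ha, A.nerveMk 0 (by omega) b hb,
        A.nerveMk (0 + 1) (by omega) c hc) ∈ A.toESpSe.nerveObj.shriekRel 0 (2 * p - n) p :=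
    (Submodule.Quotient.mk_eq_zero _).trans
      ((Submodule.mem_bot R).trans (Submodule.Quotient.mk_eq_zero _))
  have h₀ : ∀ q k (z : A.C.X k), z ∈ A.Z 0 q k ↔ z ∈ A.F q k := fun q k z =>
    ⟨fun h => A.Z_le_F _ _ _ h, fun h => A.F_le_Z_zero _ _ h⟩
  rw [h₁, A.mem_shriekRel_iff 0 (m := m) (by omega) hm₀]
  have h₂ : 2 * p - n - ((0 : ℕ) : ℤ) = 2 * p - n := by simp
  simp only [Prod.mk.injEq, nerveMk_eq_iff, nerveMk_neg, h₀]
  have h₃ : ∀ z, -z - c ∈ A.Z (0 + 1) (2 * p - n - 1) m ↔ c + z ∈ A.Z 1 (2 * p - n - 1) m :=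
    fun z => by
      rw [← Submodule.neg_mem_iff, show -(-z - c) = c + z by abel]
  simp only [h₃, h₂, add_sub_cancel_right, exists_prop]

/-- The entries `a` and `b` impose no condition, because degeneracies can have any such first two
entries. What remains is the third entry modulo the third entries of degeneracies and relations,
that is, modulo `B_{j+2}`. -/
theorem ldecMk_succ_eq_zero_iff (A : FilteredComplex.{u, v} R) (j : ℕ) {p n m m₀ : ℤ}
    (hm : m = n - p) (hm₀ : m = m₀ + 1) (a : A.C.X m)
    (ha : a ∈ A.Z 0 (2 * p - n - (j + 1 : ℕ)) m) (b : A.C.X m₀)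
    (hb : b ∈ A.Z 0 (2 * p - n + 1) m₀) (c : A.C.X m)
    (hc : c ∈ A.Z (j + 1 + 1) (2 * p - n) m) :
    A.ldecMk (j + 1) hm hm₀ a ha b hb c hc = 0 ↔ c ∈ A.B (j + 2) (2 * p - n) m := by
  have hm' : m = p - (2 * p - n) := by omega
  have h₁ : A.ldecMk (j + 1) hm hm₀ a ha b hb c hc = 0 ↔
      A.toESpSe.nerveObj.shriekMk (j + 1) (2 * p - n) p (A.nerveMk 0 (by omega) a ha,
        A.nerveMk 0 (by omega) b hb, A.nerveMk (j + 1 + 1) hm' c hc) ∈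
          A.toESpSe.nerveObj.shriekObj.degen (j + 1) (2 * p - n) p :=
    Submodule.Quotient.mk_eq_zero _
  rw [h₁]
  constructor
  · intro h
    -- The triple `t` differs from the given one by a relation of `𝒲_!`, whose third entry is itself
    -- a boundary, so the conclusion passes from `t` to `c`.
    obtain ⟨t, ht, e⟩ := A.degen_le_nerveB j hm' h
    have h₂ := A.shriekRel_le_nerveB j hm' ((Submodule.Quotient.eq _).1 e)
    have h₃ := Submodule.sub_mem _ ht h₂
    rw [sub_sub_cancel] at h₃
    exact (A.nerveMk_mem_nerveB_iff (j + 2) hm' c hc).1 h₃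
  · intro h
    obtain ⟨u, hu, v, hv, rfl⟩ := (A.mem_B_succ_iff (j + 1) _ _ m₀ hm₀ _).1 h
    -- Write `c = u + d v`. The degeneracy `s(a, 0, u)` is `(a, 0, u)`, and `d s(b, 0, v)` below is
    -- `(0, b, d v)`, because `d` moves the first entry to the second place. Their sum is the given
    -- triple.
    have hs := A.toESpSe.nerveObj.shriekObj.s_mem_degen j (p₀ := 2 * p - n - 1) (n₀ := p - 1)
      (p := 2 * p - n) (n := p) (by omega) (by omega)
      (A.toESpSe.nerveObj.shriekMk j _ _
        (A.nerveMk 0 (by omega) a (by convert ha using 2; push_cast; omega), 0,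
          A.nerveMk (j + 1) (by omega) u hu))
    have hd := A.toESpSe.nerveObj.shriekObj.d_s_mem_degen j
      (p₀ := 2 * p - n + (j + 1 : ℕ)) (n₀ := p + j)
      (p₁ := 2 * p - n + (j + 1 : ℕ) + 1) (n₁ := p + j + 1)
      (p := 2 * p - n) (n := p) rfl rfl (by push_cast; omega) (by push_cast; omega)
      (A.toESpSe.nerveObj.shriekMk j _ _
        (A.nerveMk 0 (by omega) b (by convert hb using 2; push_cast; omega), 0,
          A.nerveMk (j + 1) (by push_cast; omega) v hv))
    have hsd := Submodule.add_mem _ hs hd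
    refine (congrArg (· ∈ A.toESpSe.nerveObj.shriekObj.degen (j + 1) (2 * p - n) p) ?_).mp hsd
    refine (map_add (A.toESpSe.nerveObj.shriekMk (j + 1) (2 * p - n) p) _ _).symm.trans
      (congrArg _ ?_)
    refine Prod.ext ((add_zero _).trans (A.nerveMk_cast 0 _ _ _ a _)) (Prod.ext ?_ ?_)
    · exact (zero_add _).trans ((congrArg _ (A.nerveMk_cast 0 _ _ _ b _)).trans
        (A.nerveMk_cast 0 _ _ _ b _))
    · have e₁ := A.nerveMk_s (j + 1) (n := p - 1) (p' := 2 * p - n) (n' := p) (by omega) (by omega)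
        (by omega) u hu
      have e₂ := A.nerveMk_s (j + 1) (n := p + j)
        (p' := 2 * p - n + (j + 1 : ℕ) + 1) (n' := p + j + 1)
        rfl rfl (by push_cast; omega) v hv
      have e₃ := A.nerveMk_d (j + 2) (n := p + j + 1) (p' := 2 * p - n) (n' := p) (by push_cast; omega)
        (by push_cast; omega) (by push_cast; omega) hm' v
        (A.Z_succ_of_Z (j + 1) (p' := 2 * p - n + (j + 1 : ℕ) + 1) rfl hv)
      refine (congrArg₂ (· + ·) e₁ ((congrArg ((A.toESpSe.nerveObj.page (j + 2)).d _ _ _ _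
        (by push_cast; omega) (by push_cast; omega)) e₂).trans e₃)).trans ?_
      exact A.nerveMk_add (j + 2) hm' u _ _ _

end FilteredComplex

/-! ### Isomorphisms of extended spectral sequences -/

namespace BigradedComplex.Hom

variable {R : Type u} [CommRing R] {r : ℕ} {A B : BigradedComplex.{u, v} R r}

/-- The inverse of a bijective morphism of bigraded complexes. -/
noncomputable def inverse (f : Hom A B) (h : ∀ p n, Function.Bijective (f.f p n)) : Hom B A where
  f p n := (LinearEquiv.ofBijective (f.f p n) (h p n)).symm.toLinearMap
  comm p n p' n' hp hn y := by
    obtain ⟨x, rfl⟩ := (h p n).2 y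
    rw [← f.comm]
    exact (LinearEquiv.ofBijective_symm_apply_apply (f.f p' n') (h := h p' n') _).trans
      (congrArg _ (LinearEquiv.ofBijective_symm_apply_apply (f.f p n) (h := h p n) x).symm)

theorem inverse_apply (f : Hom A B) (h : ∀ p n, Function.Bijective (f.f p n)) (p n : ℤ)
    (x : A.X p n) : (f.inverse h).f p n (f.f p n x) = x :=
  LinearEquiv.ofBijective_symm_apply_apply (f.f p n) (h := h p n) x

theorem apply_inverse (f : Hom A B) (h : ∀ p n, Function.Bijective (f.f p n)) (p n : ℤ)
    (y : B.X p n) : f.f p n ((f.inverse h).f p n y) = y :=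
  LinearEquiv.apply_ofBijective_symm_apply (f.f p n) (h := h p n) y

theorem mapH_inverse (f : Hom A B) (h : ∀ p n, Function.Bijective (f.f p n)) (p n : ℤ)
    (ξ : A.H p n) : (f.inverse h).mapH p n (f.mapH p n ξ) = ξ := by
  obtain ⟨x, rfl⟩ := A.cls_surjective p n ξ
  exact congrArg (A.cls p n) (Subtype.ext (f.inverse_apply h p n x))

end BigradedComplex.Hom

namespace TrESpSe.Hom

variable {R : Type u} [CommRing R] {k : ℕ} {X Y : TrESpSe.{u, v} R k}

/-- The isomorphism given by a morphism all of whose components are bijective. -/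
noncomputable def isoOfBijective (f : Hom X Y)
    (h : ∀ i p n, Function.Bijective ((f.f i).f p n)) : X ≅ Y where
  hom := f
  inv :=
    { f := fun i => (f.f i).inverse (h i)
      comm := fun i p n y => by
        obtain ⟨x, rfl⟩ := (h (i + 1) p n).2 y
        rw [f.comm, BigradedComplex.Hom.mapH_inverse, BigradedComplex.Hom.inverse_apply] }
  hom_inv_id := TrESpSe.Hom.ext (funext fun i => BigradedComplex.Hom.ext (funext fun p =>
    funext fun n => LinearMap.ext fun x => (f.f i).inverse_apply (h i) p n x))
  inv_hom_id := TrESpSe.Hom.ext (funext fun i => BigradedComplex.Hom.ext (funext fun p =>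
    funext fun n => LinearMap.ext fun y => (f.f i).apply_inverse (h i) p n y))

/-- Compatibility conjugates each characteristic map of `X` to one of `Y`. The property thus passes
from `E(Dec^*(A))` back to `LDec(E(A))`, with no direct study of the characteristic maps of the
latter. -/
theorem isSpectralSequence_of_bijective (f : Hom X Y)
    (h : ∀ i p n, Function.Bijective ((f.f i).f p n)) (hY : IsSpectralSequence Y) :
    IsSpectralSequence X := by
  intro i p n
  constructor
  · refine (injective_iff_map_eq_zero _).2 fun x hx => (h (i + 1) p n).1 ((hY i p n).1 ?_)
    rw [f.comm, hx, map_zero, map_zero, map_zero]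
  · intro ξ
    obtain ⟨y, hy⟩ := (hY i p n).2 ((f.f i).mapH p n ξ)
    obtain ⟨x, rfl⟩ := (h (i + 1) p n).2 y
    refine ⟨x, ?_⟩
    rw [f.comm] at hy
    rw [← (f.f i).mapH_inverse (h i) p n (X.φ i p n x), hy, BigradedComplex.Hom.mapH_inverse]

end TrESpSe.Hom

/-- The isomorphism between the targets of two surjective linear maps with the same kernel. -/
noncomputable def LinearEquiv.ofKerEq {R M N N' : Type*} [Ring R] [AddCommGroup M]
    [AddCommGroup N] [AddCommGroup N'] [Module R M] [Module R N] [Module R N'] (g : M →ₗ[R] N)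
    (h : M →ₗ[R] N') (hg : Function.Surjective g) (hh : Function.Surjective h)
    (hk : LinearMap.ker g = LinearMap.ker h) : N ≃ₗ[R] N' :=
  (g.quotKerEquivOfSurjective hg).symm ≪≫ₗ Submodule.quotEquivOfEq _ _ hk ≪≫ₗ
    h.quotKerEquivOfSurjective hh

theorem LinearEquiv.ofKerEq_apply {R M N N' : Type*} [Ring R] [AddCommGroup M]
    [AddCommGroup N] [AddCommGroup N'] [Module R M] [Module R N] [Module R N'] (g : M →ₗ[R] N)
    (h : M →ₗ[R] N') (hg : Function.Surjective g) (hh : Function.Surjective h)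
    (hk : LinearMap.ker g = LinearMap.ker h) (x : M) :
    LinearEquiv.ofKerEq g h hg hh hk (g x) = h x := by
  have e : (g.quotKerEquivOfSurjective hg).symm (g x) = Submodule.Quotient.mk x := by
    rw [LinearEquiv.symm_apply_eq]
    rfl
  simp only [LinearEquiv.ofKerEq, LinearEquiv.trans_apply, e]
  rfl

/-! ### The differential and the characteristic maps of `LDec` on triples. -/

theorem LDec.mk_d {R : Type u} [CommRing R] (X : ESpSe.{u, v} R) (j : ℕ) {p n p' n' : ℤ}
    (hp : p' = p - ((j + 0 : ℕ) : ℤ)) (hn : n' = n + 1 - ((j + 0 : ℕ) : ℤ))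
    (a : X.nerveModule 0 (2 * p - n - j) (p - j)) (b : X.nerveModule 0 (2 * p - n + 1) p)
    (c : X.nerveModule (j + 1) (2 * p - n) p) :
    (((LDec R).obj X).page j).d p n p' n' hp hn (LDec.mk X j p n a b c) =
      LDec.mk X j p' n' 0
        ((X.nerveObj.page 0).cast (by push_cast at *; omega) (by push_cast at *; omega) a)
        ((X.nerveObj.page (j + 1)).d (2 * p - n) p (2 * p' - n') p' (by push_cast at *; omega)
          (by push_cast at *; omega) c) := rfl

theorem TrLWB.quotObj_φ_mk {R : Type u} [CommRing R] {k : ℕ} (L : TrLWB.{u, v} R k) (i : ℕ)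
    (p n : ℤ) (x : (L.page (i + 1)).X p n) :
    L.quotObj.φ i p n (L.quotMk (i + 1) p n x) =
      (L.quotPage i).cls p n ⟨L.quotMk i p n (L.w i p n x), L.quotMk_w_mem_cycles i p n x⟩ := rfl

theorem untranslate_φ {R : Type u} [CommRing R] (Y : TrESpSe.{u, v} R 1) (i : ℕ) (p n : ℤ)
    (x : (Y.page (i + 1)).X (2 * p - n) p) (z : (Y.page i).X (2 * p - n) p)
    (h : z ∈ (Y.page i).cycles (2 * p - n) p)
    (e : Y.φ i (2 * p - n) p x = (Y.page i).cls (2 * p - n) p ⟨z, h⟩) :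
    ((untranslate R).obj Y).φ i p n x =
      (Y.page i).untranslate.cls p n ⟨z, ((Y.page i).mem_untranslate_cycles z).2 h⟩ :=
  congrArg ((Y.page i).untranslateH p n) e

/-- This and the next two results pass the formula for the characteristic map through the functors
composing `LDec`, one at a time. The cycle condition is an existential witness because a homology
class is formed from an element of the subtype of cycles. -/
theorem TrLWB.shriekObj_φ_mk {R : Type u} [CommRing R] (L : TrLWB.{u, v} R 0) (j : ℕ) (p n : ℤ)
    (a : (L.page 0).X (p - (j + 1 : ℕ)) (n - (j + 1 : ℕ))) (b : (L.page 0).X (p + 1) n)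
    (c : (L.page (j + 2)).X p n) :
    ∃ h : L.shriekObj.quotMk j p n (L.shriekMk j p n (0, b, L.w (j + 1) p n c)) ∈
        (L.shriekObj.quotPage j).cycles p n,
      L.shriekObj.quotObj.φ j p n
        (L.shriekObj.quotMk (j + 1) p n (L.shriekMk (j + 1) p n (a, b, c))) =
      (L.shriekObj.quotPage j).cls p n ⟨_, h⟩ :=
  ⟨_, L.shriekObj.quotObj_φ_mk j p n _⟩

theorem TrLWB.untranslate_shriekObj_φ_mk {R : Type u} [CommRing R] (L : TrLWB.{u, v} R 0) (j : ℕ)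
    (p n : ℤ) (a : (L.page 0).X (2 * p - n - (j + 1 : ℕ)) (p - (j + 1 : ℕ)))
    (b : (L.page 0).X (2 * p - n + 1) p) (c : (L.page (j + 2)).X (2 * p - n) p) :
    ∃ h : L.shriekObj.quotMk j (2 * p - n) p
        (L.shriekMk j (2 * p - n) p (0, b, L.w (j + 1) (2 * p - n) p c)) ∈
          (((untranslate R).obj L.shriekObj.quotObj).page j).cycles p n,
      ((untranslate R).obj L.shriekObj.quotObj).φ j p n (L.shriekObj.quotMk (j + 1) (2 * p - n) p
        (L.shriekMk (j + 1) (2 * p - n) p (a, b, c))) =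
      (((untranslate R).obj L.shriekObj.quotObj).page j).cls p n ⟨_, h⟩ := by
  obtain ⟨h, e⟩ := L.shriekObj_φ_mk j (2 * p - n) p a b c
  exact ⟨_, untranslate_φ _ j p n _ _ h e⟩

theorem LDec.mk_φ {R : Type u} [CommRing R] (X : ESpSe.{u, v} R) (j : ℕ) (p n : ℤ)
    (a : X.nerveModule 0 (2 * p - n - (j + 1 : ℕ)) (p - (j + 1 : ℕ)))
    (b : X.nerveModule 0 (2 * p - n + 1) p) (c : X.nerveModule (j + 1 + 1) (2 * p - n) p) :
    ∃ h : LDec.mk X j p n 0 b (X.nerveObj.w (j + 1) (2 * p - n) p c) ∈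
        (((LDec R).obj X).page j).cycles p n,
      ((LDec R).obj X).φ j p n (LDec.mk X (j + 1) p n a b c) =
        (((LDec R).obj X).page j).cls p n ⟨_, h⟩ :=
  X.nerveObj.untranslate_shriekObj_φ_mk j p n a b c

namespace FilteredComplex

variable {R : Type u} [CommRing R]

/-! ### The comparison of `LDec(E(A))` and `E(Dec^*(A))` -/

theorem cls_congr (A : FilteredComplex.{u, v} R) (r : ℕ) {p n m : ℤ} (hm : m = n - p)
    {a b : A.C.X m} (h : a = b) (ha : a ∈ A.Z r p m) (hb : b ∈ A.Z r p m) :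
    A.cls r hm a ha = A.cls r hm b hb := by
  subst h
  rfl

theorem add_mem_decStar_Z (A : FilteredComplex.{u, v} R) (j : ℕ) {p n m m₀ : ℤ} (hm : m = n - p)
    (hm₀ : m = m₀ + 1) (a : A.C.X m) (ha : a ∈ A.Z 0 (2 * p - n - j) m) (b : A.C.X m₀)
    (hb : b ∈ A.Z 0 (2 * p - n + 1) m₀) (c : A.C.X m) (hc : c ∈ A.Z (j + 1) (2 * p - n) m) :
    a + (A.C.d m₀ m).hom b + c ∈ A.decStar.Z j p m :=
  (A.mem_decStar_Z_iff j (P := 2 * p - n) (by omega) hm₀ _).2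
    ⟨a, A.Z_le_F _ _ _ ha, b, A.Z_le_F _ _ _ hb, c, hc, rfl⟩

/-- The class of `a + d b + c` in `E(Dec^*(A))`. -/
def decMk (A : FilteredComplex.{u, v} R) (j : ℕ) {p n m m₀ : ℤ} (hm : m = n - p)
    (hm₀ : m = m₀ + 1) (a : A.C.X m) (ha : a ∈ A.Z 0 (2 * p - n - j) m) (b : A.C.X m₀)
    (hb : b ∈ A.Z 0 (2 * p - n + 1) m₀) (c : A.C.X m) (hc : c ∈ A.Z (j + 1) (2 * p - n) m) :
    (A.decStar.toESpSe.page j).X p n :=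
  A.decStar.cls j hm (a + (A.C.d m₀ m).hom b + c) (A.add_mem_decStar_Z j hm hm₀ a ha b hb c hc)

theorem exists_decMk (A : FilteredComplex.{u, v} R) (j : ℕ) {p n m m₀ : ℤ} (hm : m = n - p)
    (hm₀ : m = m₀ + 1) (ξ : (A.decStar.toESpSe.page j).X p n) :
    ∃ a ha b hb c hc, A.decMk j hm hm₀ a ha b hb c hc = ξ := by
  obtain ⟨x, hx, rfl⟩ := A.decStar.exists_cls j hm ξ
  obtain ⟨a, ha, b, hb, c, hc, rfl⟩ :=
    (A.mem_decStar_Z_iff j (P := 2 * p - n) (by omega) hm₀ x).1 hx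
  exact ⟨a, A.F_le_Z_zero _ _ ha, b, A.F_le_Z_zero _ _ hb, c, hc, rfl⟩

/-- This equality of kernels makes the comparison both well defined and injective. On pages `≥ 1`
each side reduces to a boundary condition on `c` alone; page `0` is a separate calculation with the
relations of `𝒲_!`. -/
theorem ldecMk_eq_zero_iff (A : FilteredComplex.{u, v} R) (j : ℕ) {p n m m₀ : ℤ} (hm : m = n - p)
    (hm₀ : m = m₀ + 1) (a : A.C.X m) (ha : a ∈ A.Z 0 (2 * p - n - j) m) (b : A.C.X m₀)
    (hb : b ∈ A.Z 0 (2 * p - n + 1) m₀) (c : A.C.X m) (hc : c ∈ A.Z (j + 1) (2 * p - n) m) :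
    A.ldecMk j hm hm₀ a ha b hb c hc = 0 ↔ A.decMk j hm hm₀ a ha b hb c hc = 0 := by
  refine Iff.trans ?_ (A.decStar.cls_eq_zero_iff j hm (a + (A.C.d m₀ m).hom b + c)
    (A.add_mem_decStar_Z j hm hm₀ a ha b hb c hc)).symm
  cases j with
  | succ j =>
    rw [ldecMk_succ_eq_zero_iff]
    exact (A.add_mem_decStar_B_succ_iff j (by omega) hm₀ a b c (A.Z_le_F _ _ _ ha)
      (A.Z_le_F _ _ _ hb) hc).symm
  | zero =>
    rw [ldecMk_zero_eq_zero_iff]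
    refine Iff.trans ?_ (A.mem_decStar_B_zero_iff (P := 2 * p - n) (by omega) hm₀ _).symm
    have hc' := (A.mem_Z_iff _ _ _ _ rfl _).1 hc
    constructor
    · rintro ⟨x, hx, y, hy, h₁, h₂, h₃⟩
      -- The terms in `x` and `y` cancel in `-(x - a) + (c + x + d y) - d(y - b) = a + d b + c`,
      -- which exhibits the sum in `F_{P-1} + d F_P`.
      refine ⟨-(x - a) + (c + (x + (A.C.d m₀ m).hom y)), Submodule.add_mem _
        (Submodule.neg_mem _ h₁) (A.Z_le_F _ _ _ h₃), -(y - b), Submodule.neg_mem _ h₂, ?_⟩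
      rw [map_neg, map_sub]
      abel
    · rintro ⟨f, hf, g, hg, e⟩
      -- From `a + d b + c = f + d g`, the choices are `y = b - g` and `x = -(c + d y)`. Then `c + x
      -- + d y = 0` and `x - a = -f`. The identity `d y = f - a - c` bounds `d y` by `F_P`, so that
      -- `y ∈ Z_1^{P+1}`.
      have hdy : (A.C.d m₀ m).hom (b - g) = f - a - c := by
        rw [map_sub, sub_eq_iff_eq_add, sub_sub, sub_add_eq_add_sub, e]
        abel
      have ha' : a ∈ A.F (2 * p - n) m := by simpa using A.Z_le_F _ _ _ ha
      have hy : b - g ∈ A.Z 1 (2 * p - n + 1) m₀ := by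
        rw [mem_Z_iff _ _ _ _ m hm₀, hdy]
        refine ⟨Submodule.sub_mem _ (A.Z_le_F _ _ _ hb) (A.mono_le (by omega) _ hg), ?_⟩
        refine A.mono_le (p := 2 * p - n) (by push_cast; omega) _ ?_
        exact Submodule.sub_mem _ (Submodule.sub_mem _ (A.mono_le (by omega) _ hf) ha') hc'.1
      refine ⟨-(c + (A.C.d m₀ m).hom (b - g)), Submodule.neg_mem _ (Submodule.add_mem _ hc
        (A.d_mem_Z_of_mem_Z (by push_cast; omega) hm₀ _ hy)), b - g, hy, ?_, ?_, ?_⟩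
      · rw [hdy, show -(c + (f - a - c)) - a = -f by abel]
        exact Submodule.neg_mem _ hf
      · rw [sub_sub_cancel_left]
        exact Submodule.neg_mem _ hg
      · rw [show c + (-(c + (A.C.d m₀ m).hom (b - g)) + (A.C.d m₀ m).hom (b - g)) = 0 by abel]
        exact Submodule.zero_mem _

/-- The module of triples mapping onto the pages of `LDec(E(A))` and of `E(Dec^*(A))`. -/
abbrev Triple (A : FilteredComplex.{u, v} R) (j : ℕ) (p n : ℤ) : Type v :=
  A.Z 0 (2 * p - n - j) (n - p) × A.Z 0 (2 * p - n + 1) (n - p - 1) ×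
    A.Z (j + 1) (2 * p - n) (n - p)

/-- `ldecMk` as a linear map. -/
noncomputable def ldecMkₗ (A : FilteredComplex.{u, v} R) (j : ℕ) (p n : ℤ) :
    A.Triple j p n →ₗ[R] (((LDec R).obj A.toESpSe).page j).X p n :=
  (A.toESpSe.nerveObj.shriekObj.quotMk j (2 * p - n) p).comp
    ((A.toESpSe.nerveObj.shriekMk j (2 * p - n) p).comp
      ((A.nerveMkₗ 0 (by omega)).prodMap ((A.nerveMkₗ 0 (by omega)).prodMap
        (A.nerveMkₗ (j + 1) (by omega)))))

/-- `decMk` as a linear map. -/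
def decMkₗ (A : FilteredComplex.{u, v} R) (j : ℕ) (p n : ℤ) :
    A.Triple j p n →ₗ[R] (A.decStar.toESpSe.page j).X p n where
  toFun t := A.decMk j rfl (sub_add_cancel _ 1).symm t.1 t.1.2 t.2.1 t.2.1.2 t.2.2 t.2.2.2
  map_add' s t := by
    refine Eq.trans ?_ (A.decStar.cls_add j rfl _ _ _ _).symm
    refine A.decStar.cls_congr j rfl ?_ _ _
    change (s.1.1 + t.1.1 : A.C.X (n - p)) + (A.C.d (n - p - 1) (n - p)).hom
      (s.2.1.1 + t.2.1.1) + (s.2.2.1 + t.2.2.1) =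
      (s.1.1 + (A.C.d (n - p - 1) (n - p)).hom s.2.1.1 + s.2.2.1 : A.C.X (n - p)) +
        (t.1.1 + (A.C.d (n - p - 1) (n - p)).hom t.2.1.1 + t.2.2.1)
    rw [map_add]
    abel
  map_smul' k t := by
    refine Eq.trans ?_ (A.decStar.smul_cls j rfl _ _ _).symm
    refine A.decStar.cls_congr j rfl ?_ _ _
    change (k • t.1.1 : A.C.X (n - p)) + (A.C.d (n - p - 1) (n - p)).hom
      (k • t.2.1.1) + (k • t.2.2.1) =
        k • (t.1.1 + (A.C.d (n - p - 1) (n - p)).hom t.2.1.1 + t.2.2.1 : A.C.X (n - p))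
    rw [map_smul, ← smul_add, ← smul_add]

/-- The isomorphism from a page of `LDec(E(A))` to the same page of `E(Dec^*(A))`. -/
noncomputable def ldecEquiv (A : FilteredComplex.{u, v} R) (j : ℕ) (p n : ℤ) :
    (((LDec R).obj A.toESpSe).page j).X p n ≃ₗ[R] (A.decStar.toESpSe.page j).X p n :=
  LinearEquiv.ofKerEq (A.ldecMkₗ j p n) (A.decMkₗ j p n)
    (fun ξ => by
      obtain ⟨a, ha, b, hb, c, hc, rfl⟩ :=
        A.exists_ldecMk j (m := n - p) (m₀ := n - p - 1) rfl (by omega) ξ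
      exact ⟨(⟨a, ha⟩, ⟨b, hb⟩, ⟨c, hc⟩), rfl⟩)
    (fun ξ => by
      obtain ⟨a, ha, b, hb, c, hc, rfl⟩ :=
        A.exists_decMk j (m := n - p) (m₀ := n - p - 1) rfl (by omega) ξ
      exact ⟨(⟨a, ha⟩, ⟨b, hb⟩, ⟨c, hc⟩), rfl⟩)
    (Submodule.ext fun _ => A.ldecMk_eq_zero_iff j rfl (by omega) _ _ _ _ _ _)

theorem ldecEquiv_ldecMk (A : FilteredComplex.{u, v} R) (j : ℕ) {p n m m₀ : ℤ} (hm : m = n - p)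
    (hm₀ : m = m₀ + 1) (a : A.C.X m) (ha : a ∈ A.Z 0 (2 * p - n - j) m) (b : A.C.X m₀)
    (hb : b ∈ A.Z 0 (2 * p - n + 1) m₀) (c : A.C.X m) (hc : c ∈ A.Z (j + 1) (2 * p - n) m) :
    A.ldecEquiv j p n (A.ldecMk j hm hm₀ a ha b hb c hc) =
      A.decMk j hm hm₀ a ha b hb c hc := by
  subst hm
  obtain rfl : m₀ = n - p - 1 := by omega
  exact LinearEquiv.ofKerEq_apply (A.ldecMkₗ j p n) (A.decMkₗ j p n) _ _ _
    (⟨a, ha⟩, ⟨b, hb⟩, ⟨c, hc⟩)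

/-- The second slot is the one that gets differentiated, so moving `a` there reproduces `d(a + d b +
c) = d a + d c`. The indices fit because `2p' - n' + 1 = 2p - n - j`. -/
theorem ldecMk_d (A : FilteredComplex.{u, v} R) (j : ℕ) {p n m m₀ m' p' n' : ℤ} (hm : m = n - p)
    (hm₀ : m = m₀ + 1) (hp : p' = p - ((j + 0 : ℕ) : ℤ)) (hn : n' = n + 1 - ((j + 0 : ℕ) : ℤ))
    (hm' : m' = n' - p') (a : A.C.X m) (ha : a ∈ A.Z 0 (2 * p - n - j) m) (b : A.C.X m₀)
    (hb : b ∈ A.Z 0 (2 * p - n + 1) m₀) (c : A.C.X m) (hc : c ∈ A.Z (j + 1) (2 * p - n) m) :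
    (((LDec R).obj A.toESpSe).page j).d p n p' n' hp hn (A.ldecMk j hm hm₀ a ha b hb c hc) =
      A.ldecMk j hm' (show m' = m + 1 by omega) 0 (Submodule.zero_mem _) a
        (by convert ha using 2; push_cast at *; omega) ((A.C.d m m').hom c)
        (A.d_mem_Z_of_mem_Z (r := j + 1) (by push_cast at *; omega) (by omega) c hc) := by
  have e₁ := A.nerveMk_zero 0 (p := 2 * p' - n' - j) (n := p' - j) (m := m') (by omega)
  have e₂ := A.nerveMk_cast 0 (p := 2 * p - n - j) (n := p - j)
    (p' := 2 * p' - n' + 1) (n' := p') (by push_cast at *; omega)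
    (by push_cast at *; omega) (by omega) a ha
  have e₃ := A.nerveMk_d (j + 1) (p := 2 * p - n) (n := p) (m' := m') (p' := 2 * p' - n') (n' := p')
    (by push_cast at *; omega) (by push_cast at *; omega) (by omega) (by omega) c hc
  refine (LDec.mk_d A.toESpSe j hp hn _ _ _).trans ?_
  rw [ldecMk, e₁]
  exact congrArg₂ (LDec.mk A.toESpSe j p' n' 0) e₂ e₃

theorem ldecMk_φ (A : FilteredComplex.{u, v} R) (j : ℕ) {p n m m₀ : ℤ} (hm : m = n - p)
    (hm₀ : m = m₀ + 1) (a : A.C.X m) (ha : a ∈ A.Z 0 (2 * p - n - (j + 1 : ℕ)) m) (b : A.C.X m₀)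
    (hb : b ∈ A.Z 0 (2 * p - n + 1) m₀) (c : A.C.X m) (hc : c ∈ A.Z (j + 1 + 1) (2 * p - n) m) :
    ∃ h : A.ldecMk j hm hm₀ 0 (Submodule.zero_mem _) b hb c (A.Z_succ_le _ _ _ hc) ∈
        (((LDec R).obj A.toESpSe).page j).cycles p n,
      ((LDec R).obj A.toESpSe).φ j p n (A.ldecMk (j + 1) hm hm₀ a ha b hb c hc) =
        (((LDec R).obj A.toESpSe).page j).cls p n ⟨_, h⟩ := by
  obtain ⟨h, e⟩ := LDec.mk_φ A.toESpSe j p n (A.nerveMk 0 (by omega) a ha)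
    (A.nerveMk 0 (by omega) b hb) (A.nerveMk (j + 1 + 1) (by omega) c hc)
  have e' : LDec.mk A.toESpSe j p n 0 (A.nerveMk 0 (by omega) b hb)
      (A.toESpSe.nerveObj.w (j + 1) (2 * p - n) p (A.nerveMk (j + 1 + 1) (by omega) c hc)) =
      A.ldecMk j hm hm₀ 0 (Submodule.zero_mem _) b hb c (A.Z_succ_le _ _ _ hc) :=
    congrArg₂ (fun x y => LDec.mk A.toESpSe j p n x (A.nerveMk 0 (by omega) b hb) y)
      (A.nerveMk_zero 0 (p := 2 * p - n - j) (n := p - j) (m := m) (by omega)).symm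
      (A.nerveMk_w (j + 1) (p := 2 * p - n) (n := p) (by omega) c hc)
  refine ⟨e' ▸ h, e.trans ?_⟩
  exact congrArg ((((LDec R).obj A.toESpSe).page j).cls p n) (Subtype.ext e')

theorem decMk_d (A : FilteredComplex.{u, v} R) (j : ℕ) {p n m m₀ m' p' n' : ℤ} (hm : m = n - p)
    (hm₀ : m = m₀ + 1) (hp : p' = p - ((j + 0 : ℕ) : ℤ)) (hn : n' = n + 1 - ((j + 0 : ℕ) : ℤ))
    (hm' : m' = n' - p') (a : A.C.X m) (ha : a ∈ A.Z 0 (2 * p - n - j) m) (b : A.C.X m₀)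
    (hb : b ∈ A.Z 0 (2 * p - n + 1) m₀) (c : A.C.X m) (hc : c ∈ A.Z (j + 1) (2 * p - n) m)
    (h₀ ha' hc') :
    (A.decStar.toESpSe.page j).d p n p' n' hp hn (A.decMk j hm hm₀ a ha b hb c hc) =
      A.decMk j hm' (show m' = m + 1 by omega) 0 h₀ a ha' ((A.C.d m m').hom c) hc' := by
  refine (A.decStar.d_cls j hm hp hn hm' _ _).trans ?_
  refine A.decStar.cls_congr j hm' ?_ _ _
  change (A.C.d m m').hom (a + (A.C.d m₀ m).hom b + c) =
    0 + (A.C.d m m').hom a + (A.C.d m m').hom c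
  rw [map_add, map_add, A.d_d]
  abel

/-- Used for the first entry of a triple on page `j + 1`: the characteristic map of `LDec` discards
it, and this inclusion shows that it represents zero on page `j` of `E(Dec^*(A))`. -/
theorem F_le_decStar_B (A : FilteredComplex.{u, v} R) (j : ℕ) {p P m : ℤ}
    (hP : P + (j + 1 : ℕ) ≤ p - m) : A.F P m ≤ A.decStar.B j p m := by
  cases j with
  | zero => exact A.F_le_decStar_F (p := p - 1) (by push_cast at hP; omega)
  | succ j => exact A.F_le_decStar_B_succ j (by push_cast at *; omega)

/-- The morphism from `LDec(E(A))` to `E(Dec^*(A))`. -/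
noncomputable def ldecHom (A : FilteredComplex.{u, v} R) :
    TrESpSe.Hom ((LDec R).obj A.toESpSe) A.decStar.toESpSe where
  f j :=
    { f := fun p n => (A.ldecEquiv j p n).toLinearMap
      comm := fun p n p' n' hp hn ξ => by
        obtain ⟨a, ha, b, hb, c, hc, rfl⟩ :=
          A.exists_ldecMk j (m := n - p) (m₀ := n - p - 1) rfl (by omega) ξ
        rw [A.ldecMk_d j rfl (by omega) hp hn rfl]
        refine (A.ldecEquiv_ldecMk j _ _ _ _ _ _ _ _).trans ?_
        refine (A.decMk_d j rfl (by omega) hp hn rfl a ha b hb c hc _ _ _).symm.trans ?_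
        exact congrArg _ (A.ldecEquiv_ldecMk j _ _ _ _ _ _ _ _).symm }
  comm j p n ξ := by
    obtain ⟨a, ha, b, hb, c, hc, rfl⟩ :=
      A.exists_ldecMk (j + 1) (m := n - p) (m₀ := n - p - 1) rfl (by omega) ξ
    obtain ⟨h, e⟩ := A.ldecMk_φ j rfl (by omega) a ha b hb c hc
    rw [e]
    refine (congrArg (A.decStar.toESpSe.φ j p n)
      (A.ldecEquiv_ldecMk (j + 1) _ _ _ _ _ _ _ _)).trans ?_
    have hZ := A.add_mem_decStar_Z (j + 1) rfl (by omega) a ha b hb c hc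
    refine (A.decStar.toESpSe_φ_cls j rfl _ hZ (A.decStar.cls_mem_cycles j rfl _ hZ)).trans ?_
    refine congrArg ((A.decStar.toESpSe.page j).cls p n) (Subtype.ext ?_)
    refine Eq.trans ?_ (A.ldecEquiv_ldecMk j rfl (by omega) 0 (Submodule.zero_mem _) b hb c
      (A.Z_succ_le _ _ _ hc)).symm
    refine (A.decStar.cls_eq_cls_iff j (p := p) (n := n) rfl _ _ (A.decStar.Z_succ_le j _ _ hZ)
      (A.add_mem_decStar_Z j rfl (by omega) 0 (Submodule.zero_mem _) b hb c
        (A.Z_succ_le _ _ _ hc))).2 ?_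
    -- The two representatives differ exactly by `a ∈ F_{P-j-1}`, with `P = 2p - n`.
    refine A.F_le_decStar_B j (P := 2 * p - n - (j + 1 : ℕ)) (by omega) ?_
    have e' : a + (A.C.d (n - p - 1) (n - p)).hom b + c -
        (0 + (A.C.d (n - p - 1) (n - p)).hom b + c) = a := by
      rw [zero_add, add_assoc, add_sub_cancel_right]
    exact e'.symm ▸ A.Z_le_F _ _ _ ha

theorem Hom.LDec_map_ldecMk {A B : FilteredComplex.{u, v} R} (f : Hom A B) (j : ℕ)
    {p n m m₀ : ℤ} (hm : m = n - p)
    (hm₀ : m = m₀ + 1) (a : A.C.X m) (ha : a ∈ A.Z 0 (2 * p - n - j) m) (b : A.C.X m₀)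
    (hb : b ∈ A.Z 0 (2 * p - n + 1) m₀) (c : A.C.X m) (hc : c ∈ A.Z (j + 1) (2 * p - n) m) :
    (TrESpSe.Hom.f ((LDec R).map f.toESpSe) j).f p n (A.ldecMk j hm hm₀ a ha b hb c hc) =
      B.ldecMk j hm hm₀ ((f.hom.f m).hom a) (f.map_Z _ _ _ _ ha) ((f.hom.f m₀).hom b)
        (f.map_Z _ _ _ _ hb) ((f.hom.f m).hom c) (f.map_Z _ _ _ _ hc) :=
  congrArg (fun t => B.toESpSe.nerveObj.shriekObj.quotMk j (2 * p - n) p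
    (B.toESpSe.nerveObj.shriekMk j (2 * p - n) p t))
    (Prod.ext (f.nerveMap_nerveMk 0 _ a ha)
      (Prod.ext (f.nerveMap_nerveMk 0 _ b hb) (f.nerveMap_nerveMk (j + 1) _ c hc)))

/-- Both composites send the class of `(a, b, c)` to the class of `f a + d (f b) + f c`, since `f`
is a chain map and acts entrywise on triples. -/
theorem ldecHom_naturality {A B : FilteredComplex.{u, v} R} (f : A ⟶ B) :
    (LDec R).map (Hom.toESpSe f) ≫ B.ldecHom =
      (A.ldecHom ≫ Hom.toESpSe (Hom.decStar f) :
        (LDec R).obj A.toESpSe ⟶ B.decStar.toESpSe) := by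
  refine TrESpSe.Hom.ext (funext fun j => BigradedComplex.Hom.ext (funext fun p =>
      funext fun n => LinearMap.ext fun ξ => ?_))
  obtain ⟨a, ha, b, hb, c, hc, rfl⟩ :=
    A.exists_ldecMk j (m := n - p) (m₀ := n - p - 1) rfl (by omega) ξ
  refine (congrArg (B.ldecEquiv j p n)
    (Hom.LDec_map_ldecMk f j rfl (by omega) a ha b hb c hc)).trans ?_
  refine (B.ldecEquiv_ldecMk j _ _ _ _ _ _ _ _).trans ?_
  refine Eq.trans ?_ (congrArg (((Hom.toESpSe (Hom.decStar f)).f j).f p n)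
    (A.ldecEquiv_ldecMk j rfl (by omega) a ha b hb c hc).symm)
  refine Eq.trans ?_ ((Hom.decStar f).toESpSe_cls j rfl _ _).symm
  refine B.decStar.cls_congr j rfl ?_ _ _
  change (f.hom.f (n - p)).hom a + (B.C.d (n - p - 1) (n - p)).hom ((f.hom.f (n - p - 1)).hom b) +
    (f.hom.f (n - p)).hom c = (f.hom.f (n - p)).hom (a + (A.C.d (n - p - 1) (n - p)).hom b + c)
  rw [map_add, map_add, Hom.map_d f]

theorem ldecHom_ofPair (A : FilteredComplex.{u, v} R) {p n m m₀ : ℤ} (hm : m = n - p)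
    (hm₀ : m = m₀ + 1) (a : A.C.X m) (ha : a ∈ A.F (2 * p - n) m)
    (b : A.C.X m₀) (hb : b ∈ A.F (2 * p - n + 1) m₀) (hm' : m = p - (2 * p - n))
    (hm₀' : m₀ = p - (2 * p - n + 1)) :
    ∃ h : a + (A.C.d m₀ m).hom b ∈ A.decStar.F p m,
      (A.ldecHom.f 0).f p n (LDec.ofPair A.toESpSe p n
        (A.cls 0 hm' a (A.F_le_Z_zero _ _ ha))
        (A.cls 0 hm₀' b (A.F_le_Z_zero _ _ hb))) =
      A.decStar.cls 0 hm (a + (A.C.d m₀ m).hom b) (A.decStar.F_le_Z_zero _ _ h) := by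
  refine ⟨(A.mem_decStar_F_iff (P := 2 * p - n) (by omega) hm₀ _).2 ⟨a, ha, b, hb, rfl⟩, ?_⟩
  have ha' : a ∈ A.Z 0 (2 * p - n - (0 : ℕ)) m := by simpa using A.F_le_Z_zero _ _ ha
  have e : LDec.ofPair A.toESpSe p n
        (A.cls 0 hm' a (A.F_le_Z_zero _ _ ha))
        (A.cls 0 hm₀' b (A.F_le_Z_zero _ _ hb)) =
      A.ldecMk 0 hm hm₀ a ha' b (A.F_le_Z_zero _ _ hb) 0 (Submodule.zero_mem _) := by
    refine congrArg (fun t => A.toESpSe.nerveObj.shriekObj.quotMk 0 (2 * p - n) p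
      (A.toESpSe.nerveObj.shriekMk 0 (2 * p - n) p t)) ?_
    refine Prod.ext ?_ (Prod.ext (A.nerveZero_cls (by omega) b _) (A.nerveMk_zero 1 _).symm)
    -- The first slot has index `2p - n - j`, which at `j = 0` equals `2p - n` only up to a cast.
    refine (congrArg A.toESpSe.nerveZero (A.cast_cls 0 (by simp) (by simp) (by omega) a
      (A.F_le_Z_zero _ _ ha))).trans ?_
    exact A.nerveZero_cls (by push_cast; omega) a ha'
  rw [e]
  refine (A.ldecEquiv_ldecMk 0 hm hm₀ _ _ _ _ _ _).trans ?_
  exact A.decStar.cls_congr 0 hm (add_zero _) _ _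

theorem ldecHom_ofNerve (A : FilteredComplex.{u, v} R) (j : ℕ) {p n m : ℤ} (hm : m = n - p)
    (a : A.C.X m) (ha : a ∈ A.Z (j + 1) (2 * p - n) m)
    (c : A.toESpSe.nerveModule (j + 1) (2 * p - n) p)
    (hm' : m = p - (2 * p - n)) (hc : c.1.1 (Fin.last (j + 1)) = A.cls (j + 1) hm' a ha) :
    ∃ h : a ∈ A.decStar.Z j p m,
      (A.ldecHom.f j).f p n (LDec.ofNerve A.toESpSe j p n c) = A.decStar.cls j hm a h := by
  refine ⟨A.Z_succ_le_decStar_Z j (by omega) ha, ?_⟩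
  -- The pair `c` comes from some `b`, which need not be `a`. Agreement of the last terms gives `b -
  -- a ∈ B_{j+1}^P`, and this lies in `B_j` for `Dec^*(A)`, so the value depends only on
  -- `[a]_{j+1}`.
  obtain ⟨b, hb, rfl⟩ := A.exists_nerveMk (j + 1) (m := m) (by omega) c
  have hba := (A.cls_eq_cls_iff (j + 1) (by omega) b a hb ha).1 hc
  have e : LDec.ofNerve A.toESpSe j p n (A.nerveMk (j + 1) (by omega) b hb) =
      A.ldecMk j hm (sub_add_cancel _ 1).symm 0 (Submodule.zero_mem _) 0
        (Submodule.zero_mem _) b hb :=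
    congrArg (fun t => A.toESpSe.nerveObj.shriekObj.quotMk j (2 * p - n) p
      (A.toESpSe.nerveObj.shriekMk j (2 * p - n) p t))
      (Prod.ext (A.nerveMk_zero 0 _).symm (Prod.ext (A.nerveMk_zero 0 _).symm rfl))
  rw [e]
  refine (A.ldecEquiv_ldecMk j hm _ _ _ _ _ _ _).trans ?_
  refine (A.decStar.cls_eq_cls_iff j hm _ _ _ _).2 ?_
  rw [map_zero, zero_add, zero_add]
  exact A.B_succ_le_decStar_B j (by omega) hba

end FilteredComplex

/-! ### The natural isomorphism and its inverse. -/

theorem FilteredComplex.ldecHom_bijective {R : Type u} [CommRing R] (A : FilteredComplex.{u, v} R)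
    (j : ℕ) (p n : ℤ) : Function.Bijective ((A.ldecHom.f j).f p n) :=
  (A.ldecEquiv j p n).bijective

/-- The isomorphism from `LDec(E(A))` to `E(Dec^*(A))`. -/
noncomputable def FilteredComplex.ldecIsoObj {R : Type u} [CommRing R]
    (A : FilteredComplex.{u, v} R) : (LDec R).obj A.toESpSe ≅ A.decStar.toESpSe :=
  A.ldecHom.isoOfBijective A.ldecHom_bijective

/-- The natural isomorphism from `LDec(E(A))` to `E(Dec^*(A))`. -/
noncomputable def ldecIso (R : Type u) [CommRing R]
    (hL : ∀ C : FilteredComplex.{u, v} R,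
      TrESpSe.IsSpectralSequence ((LDec R).obj ((spectralSequence R).obj C).obj)) :
    ObjectProperty.lift TrESpSe.IsSpectralSequence
      (spectralSequence R ⋙ ObjectProperty.ι TrESpSe.IsSpectralSequence ⋙ LDec R) hL ≅
        DecStar.{u, v} R ⋙ spectralSequence R :=
  NatIso.ofComponents (fun C => ObjectProperty.isoMk _ C.ldecIsoObj)
    fun f => ObjectProperty.hom_ext _ (FilteredComplex.ldecHom_naturality f)

/-- The isomorphism `η` is taken to be `(ldecIso R hL).symm`, so its inverse is `ldecHom` by
definition and the formulas on pairs and on the nerve apply verbatim. -/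
theorem ldecIso_symm_inv_app_apply (R : Type u) [CommRing R]
    (hL : ∀ C : FilteredComplex.{u, v} R,
      TrESpSe.IsSpectralSequence ((LDec R).obj ((spectralSequence R).obj C).obj))
    (C : FilteredComplex.{u, v} R) (j : ℕ) (p n : ℤ)
    (ξ : (((LDec R).obj C.toESpSe).page j).X p n) :
    (((ldecIso R hL).symm.inv.app C).hom.f j).f p n ξ = (C.ldecHom.f j).f p n ξ := rfl

set_option maxHeartbeats 1600000 in
theorem mainTheorem12 (R : Type u) [CommRing R] :
    ∃ (hL : ∀ C : FilteredComplex.{u, v} R,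
        TrESpSe.IsSpectralSequence ((LDec R).obj ((spectralSequence R).obj C).obj))
      (η : DecStar.{u, v} R ⋙ spectralSequence R ≅
        ObjectProperty.lift TrESpSe.IsSpectralSequence
          (spectralSequence R ⋙ ObjectProperty.ι TrESpSe.IsSpectralSequence ⋙ LDec R) hL),
      -- on the `0`-page, the inverse isomorphism is `(a, b) ↦ [a + d b]`
      (∀ (C : FilteredComplex.{u, v} R) (p n m m₀ : ℤ) (hm : m = n - p) (hm₀ : m = m₀ + 1)
        (a : C.C.X m) (ha : a ∈ C.F (2 * p - n) m)
        (b : C.C.X m₀) (hb : b ∈ C.F (2 * p - n + 1) m₀),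
        ∃ h : a + (C.C.d m₀ m).hom b ∈ C.decStar.F p m,
          ((η.inv.app C).hom.f 0).f p n
            (LDec.ofPair C.toESpSe p n
              (C.cls 0 (by omega) a (C.F_le_Z_zero _ _ ha))
              (C.cls 0 (by omega) b (C.F_le_Z_zero _ _ hb))) =
            C.decStar.cls 0 hm (a + (C.C.d m₀ m).hom b) (C.decStar.F_le_Z_zero _ _ h)) ∧
      -- on the `j`-page, the inverse isomorphism is Deligne's map `[a]_{j+1} ↦ [a]_j`
      (∀ (C : FilteredComplex.{u, v} R) (j : ℕ) (p n m : ℤ) (hm : m = n - p)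
        (a : C.C.X m) (ha : a ∈ C.Z (j + 1) (2 * p - n) m)
        (c : C.toESpSe.nerveModule (j + 1) (2 * p - n) p),
        c.1.1 ⟨j + 1, by omega⟩ = C.cls (j + 1) (by omega) a ha →
        ∃ h : a ∈ C.decStar.Z j p m,
          ((η.inv.app C).hom.f j).f p n (LDec.ofNerve C.toESpSe j p n c) =
            C.decStar.cls j hm a h) := by
  refine ⟨fun C => C.ldecHom.isSpectralSequence_of_bijective C.ldecHom_bijective
      C.decStar.toESpSe_isSpectralSequence, (ldecIso R _).symm, ?_, ?_⟩
  · intro C p n m m₀ hm hm₀ a ha b hb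
    obtain ⟨h, e⟩ := C.ldecHom_ofPair hm hm₀ a ha b hb (by omega) (by omega)
    exact ⟨h, (ldecIso_symm_inv_app_apply R _ C 0 p n _).trans e⟩
  · intro C j p n m hm a ha c hc
    obtain ⟨h, e⟩ := C.ldecHom_ofNerve j hm a ha c (by omega) hc
    exact ⟨h, (ldecIso_symm_inv_app_apply R _ C j p n _).trans e⟩
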